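/- **Setting.** Let $k$ be a perfect field, $\overline{k}$ its algebraic closure, $\mathbb{A}^n:=\overline{k}^n$, and $1\le s<r\le n$. Let $F_1,\ldots,F_r,G\in k[X_1,\ldots,X_n]$ be such that $F_1,\ldots,F_r$ form a regular sequence in the localization $k[X_1,\ldots,X_n]_G$ and the ideal generated by $F_1,\ldots,F_j$ in $k[X_1,\ldots,X_n]_G$ is radical for $1\le j\le r$. Let $V_s\subset\mathbb{A}^n$ be the Zariski closure of $\{F_1=0,\ldots,F_s=0,G\ne0\}$ and $\delta_s:=\deg V_s$ (the sum of the degrees of its irreducible components). Assume that $\pi_s:V_s\to\mathbb{A}^{n-s}$, $\pi_s(x):=(x_1,\ldots,x_{n-s})$, is a finite morphism (dominant and integral on every irreducible component) of degree $\dim_{k(X_1,\ldots,X_{n-s})}\big(k(X_1,\ldots,X_{n-s})\otimes k[V_s]\big)=\delta_s$. Let $p^s=(p_1,\ldots,p_{n-s})\in k^{n-s}$ be such that the fiber $\pi_s^{-1}(p^s)$ is unramified, is contained in $\{G\neq 0\}$, and has its points separated by $X_{n-s+1}$. Let $m_s,v_{n-s+2},\ldots,v_n\in k[T]$, with $m_s$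 monic of degree $\delta_s$ and $\deg v_i<\delta_s$, be a Kronecker representation of this fiber, that is, $$\pi_s^{-1}(p^s)=\{p^s\}\times\{(x_{n-s+1},\ldots,x_n): m_s(x_{n-s+1})=0,\ x_{n-s+i}=v_{n-s+i}(x_{n-s+1})\ (2\le i\le s)\}.$$ Put $p^{s+1}:=(p_1,\ldots,p_{n-s-1})$ and let $C_s:=\pi_s^{-1}(\{p^{s+1}\}\times\mathbb{A}^1)$ be the lifting curve, regarded in $\mathbb{A}^{s+1}$ with coordinates $X_{n-s},\ldots,X_n$. Let $\mathbf F_s:=\big(F_i(p^{s+1},X_{n-s},\ldots,X_n)\big)_{1\le i\le s}$, let $J_s$ be its Jacobian matrix with respect to $X_{n-s+1},\ldots,X_n$, and let $N(V):=V-J_s(V)^{-1}\mathbf F_s(V)$. "With precision $t$" means modulo $(X_{n-s}-p_{n-s})^t$. **Algorithm (Newton lifting).** Put $M^0:=m_s(T)$, $V^0_{n-s+1}:=T$, $V^0_{n-s+i}:=v_{n-s+i}(T)$ for $2\le i\le s$, and $j:=0$. While $2^j<\delta_s+1$: compute $(v_{n-s+1}^{j+1},\ldots,v_n^{j+1}):=N(V^j)$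 modulo $M^j$ with precision $2^{j+1}$ (failing if $\det J_s(V^j)$ is not invertible modulo $M^j$ with that precision); put $\Delta:=v^{j+1}_{n-s+1}-T$; put $V^{j+1}_i:=v^{j+1}_i-\big(\Delta\,\partial v^{j+1}_i/\partial T \bmod M^j\big)$ for $n-s+1\le i\le n$ and $M^{j+1}:=M^j-\big(\Delta\,\partial M^j/\partial T\bmod M^j\big)$, the remainders being taken with precision $2^{j+1}$; increase $j$ by one. Finally return $M^j$ and $\frac{\partial M^j}{\partial T}V_i^j \bmod M^j$ $(n-s+1\le i\le n)$, with precision $\delta_s+1$. **Theorem.** The algorithm does not fail, and it returns polynomials $M_s$ and $W^s_{n-s+1},\ldots,W^s_n$ in $k[X_{n-s}][T]$ such that: 1. $M_s$, $W^s_{n-s+i}$ $(2\le i\le s)$ form a Kronecker representation of $C_s$ with $X_{n-s+1}$ as primitive element. That is, if $R:=k[X_{n-s}]$, $K:=k(X_{n-s})$, and $I^e\subset K[X_{n-s+1},\ldots,X_n]$ is the extension of the vanishing ideal of $C_s$, then $X_{n-s}$ defines a finite morphism $C_s\to\mathbb{A}^1$; $M_s\in R[T]$ is monic and is the minimal polynomial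 over $K$ of $X_{n-s+1}$ modulo $I^e$; $\deg_T M_s=\dim_K K[X_{n-s+1},\ldots,X_n]/I^e$; $\deg_T W^s_{n-s+i}<\deg_T M_s$; and $I^e$ is generated by $M_s(X_{n-s+1})$ and the polynomials $M_s'(X_{n-s+1})X_{n-s+i}-W^s_{n-s+i}(X_{n-s+1})$ $(2\le i\le s)$, where $M_s':=\partial M_s/\partial T$. 2. $\deg M_s=\deg_TM_s=\delta_s$, and $\deg_T W^s_{n-s+i}<\delta_s$ and $\deg W^s_{n-s+i}\le\delta_s$ for $1\le i\le s$, where $\deg$ is the total degree in $X_{n-s},T$. 3. On $C_s$ one has $M_s(X_{n-s},X_{n-s+1})=0$ and $\frac{\partial M_s}{\partial T}(X_{n-s},X_{n-s+1})\,X_{n-s+i}=W^s_{n-s+i}(X_{n-s},X_{n-s+1})$ for $1\le i\le s$. 4. $M_s(p_{n-s},T)=m_s$, the polynomials $m_s'$ and $m_s$ are coprime, and $W^s_{n-s+i}(p_{n-s},T)\equiv m_s'\,v_{n-s+i}\pmod{m_s}$ for $2\le i\le s$. -/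

import Mathlib

namespace NewtonLifting

/-! ### Reduced regular sequences, the varieties `V_s`, degree -/

/-- `F_1, …, F_r` form a reduced regular sequence on `{G ≠ 0}`: they form a regular sequence in the
localization `k[X_1, …, X_n]_G`, and each ideal `(F_1, …, F_j)_G`, `1 ≤ j ≤ r`, is radical there. -/
structure IsReducedRegularSequence {k : Type*} [Field k] {n r : ℕ}
    (F : Fin r → MvPolynomial (Fin n) k) (G : MvPolynomial (Fin n) k) : Prop where
  regular : RingTheory.Sequence.IsRegular (Localization.Away G)
    (List.ofFn fun i => algebraMap (MvPolynomial (Fin n) k) (Localization.Away G) (F i))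
  radical : ∀ j : ℕ, 1 ≤ j → j ≤ r →
    (Ideal.span {f : Localization.Away G | ∃ i : Fin r, i.val < j ∧
      f = algebraMap (MvPolynomial (Fin n) k) (Localization.Away G) (F i)}).IsRadical

/-- The Zariski closure `V_s` of `{F_1 = 0, …, F_s = 0, G ≠ 0}` in affine `n`-space over the
algebraic closure of `k`. -/
def affineClosure {k : Type*} [Field k] {n r : ℕ} (F : Fin r → MvPolynomial (Fin n) k)
    (G : MvPolynomial (Fin n) k) (s : ℕ) : Set (Fin n → AlgebraicClosure k) :=
  MvPolynomial.zeroLocus (AlgebraicClosure k) (MvPolynomial.vanishingIdeal k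
    {x : Fin n → AlgebraicClosure k | (∀ i : Fin r, i.val < s → MvPolynomial.aeval x (F i) = 0) ∧
      MvPolynomial.aeval x G ≠ 0})

/-- Degree of the irreducible `k`-variety defined by the prime ideal `P`: the maximal number of
points in a finite intersection with a linear (that is, affine-linear) subspace whose codimension
is the dimension of the variety. -/
noncomputable def irreducibleDegree {k : Type*} [Field k] {n : ℕ}
    (P : Ideal (MvPolynomial (Fin n) k)) : ℕ∞ :=
  ⨆ L : {L : AffineSubspace (AlgebraicClosure k) (Fin n → AlgebraicClosure k) //
      ringKrullDim (MvPolynomial (Fin n) k ⧸ P) +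
          ((Module.finrank (AlgebraicClosure k) L.direction : ℕ) : WithBot ℕ∞) =
        ((n : ℕ) : WithBot ℕ∞) ∧
      (MvPolynomial.zeroLocus (AlgebraicClosure k) P ∩
        (L : Set (Fin n → AlgebraicClosure k))).Finite},
    (MvPolynomial.zeroLocus (AlgebraicClosure k) P ∩
      (L.1 : Set (Fin n → AlgebraicClosure k))).encard

/-- Degree of a `k`-variety: the sum of the degrees of its irreducible `k`-components. -/
noncomputable def varietyDegree {k : Type*} [Field k] {n : ℕ}
    (V : Set (Fin n → AlgebraicClosure k)) : ℕ∞ :=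
  ∑ P ∈ ((MvPolynomial.vanishingIdeal k V).finite_minimalPrimes_of_isNoetherianRing
      (MvPolynomial (Fin n) k)).toFinset, irreducibleDegree P

/-! ### The projection `π_s` -/

/-- The homomorphism `f : R → A` followed by `A → A ⧸ I` is dual to a finite morphism: on every
irreducible component of the variety of `I` it is injective (dominance) and integral. -/
def IsFiniteOnComponents {R A : Type*} [CommRing R] [CommRing A] (f : R →+* A) (I : Ideal A) :
    Prop :=
  ∀ P ∈ I.minimalPrimes, Function.Injective ((Ideal.Quotient.mk P).comp f) ∧
    ((Ideal.Quotient.mk P).comp f).IsIntegral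

/-- The inclusion `k[X_1, …, X_{n-s}] → k[X_1, …, X_n]`. -/
noncomputable def freeVars (k : Type*) [Field k] (n s : ℕ) :
    MvPolynomial (Fin (n - s)) k →+* MvPolynomial (Fin n) k :=
  (MvPolynomial.rename (Fin.castLE (Nat.sub_le n s)) :
    MvPolynomial (Fin (n - s)) k →ₐ[k] MvPolynomial (Fin n) k).toRingHom

/-- Degree of the morphism dual to `f : R → A`, for a domain `R` with fraction field `K`: the
dimension of `K ⊗_R A` over `K`. -/
noncomputable def morphismDegree {R A : Type*} [CommRing R] [IsDomain R] [CommRing A]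
    (f : R →+* A) : ℕ :=
  letI : Algebra R A := f.toAlgebra
  Module.finrank (FractionRing R) (TensorProduct R (FractionRing R) A)

/-- The fiber `π_s⁻¹(p^s)` of the projection of `V` to the first `n - s` coordinates. -/
def fiber {k : Type*} [Field k] {n s : ℕ} (V : Set (Fin n → AlgebraicClosure k))
    (p : Fin (n - s) → k) : Set (Fin n → AlgebraicClosure k) :=
  {x | x ∈ V ∧ ∀ i : Fin (n - s), x (Fin.castLE (Nat.sub_le n s) i) =
    algebraMap k (AlgebraicClosure k) (p i)}

/-- The projection of `V` to the first `n - s` coordinates is unramified at `x`: its differential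
(the same projection) is injective on the tangent space of `V` at `x`. -/
def IsUnramifiedAt (k : Type*) [Field k] {n : ℕ} (s : ℕ) (V : Set (Fin n → AlgebraicClosure k))
    (x : Fin n → AlgebraicClosure k) : Prop :=
  ∀ u : Fin n → AlgebraicClosure k,
    (∀ f ∈ MvPolynomial.vanishingIdeal k V,
      ∑ j : Fin n, MvPolynomial.aeval x (MvPolynomial.pderiv j f) * u j = 0) →
    (∀ i : Fin (n - s), u (Fin.castLE (Nat.sub_le n s) i) = 0) → u = 0

/-! ### The lifting curve `C_s`

Coordinates are 0-based: `X_{n-s}` has index `n - s - 1`, and `X_{n-s+i}`, `1 ≤ i ≤ s`, has index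
`n - s + (i - 1)`. -/

/-- Index of the coordinate `X_{n-s}`. -/
def paramIdx {n s : ℕ} (h : s < n) : Fin n := ⟨n - s - 1, by omega⟩

/-- Index of the coordinate `X_{n-s+i+1}`, for `0 ≤ i < s`. -/
def depIdx {n s : ℕ} (h : s < n) (i : Fin s) : Fin n := ⟨n - s + i.val, by omega⟩

/-- The last coordinate `p_{n-s}` of `p^s`. -/
def lastCoord {k : Type*} {n s : ℕ} (h : s < n) (p : Fin (n - s) → k) : k :=
  p ⟨n - s - 1, by omega⟩

/-- The lifting curve `C_s`: the points of `V` with `X_1 = p_1, …, X_{n-s-1} = p_{n-s-1}`. -/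
def liftingCurve {k : Type*} [Field k] {n s : ℕ} (V : Set (Fin n → AlgebraicClosure k))
    (p : Fin (n - s) → k) : Set (Fin n → AlgebraicClosure k) :=
  {x | x ∈ V ∧ ∀ i : Fin (n - s), i.val < n - s - 1 →
    x (Fin.castLE (Nat.sub_le n s) i) = algebraMap k (AlgebraicClosure k) (p i)}

/-- Evaluation of an element of `k[X_{n-s}][X_{n-s+1}, …, X_n]` at a point of affine `n`-space. -/
noncomputable def evalCurve {k : Type*} [Field k] {n s : ℕ} (h : s < n)
    (x : Fin n → AlgebraicClosure k) :
    MvPolynomial (Fin s) (Polynomial k) →+* AlgebraicClosure k :=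
  MvPolynomial.eval₂Hom
    (Polynomial.aeval (x (paramIdx h)) : Polynomial k →ₐ[k] AlgebraicClosure k).toRingHom
    (fun i => x (depIdx h i))

/-- The ideal in `k[X_{n-s}][X_{n-s+1}, …, X_n]` of the polynomials vanishing on (the isomorphic
image in affine `(s+1)`-space of) the curve `C`. -/
noncomputable def curveIdeal {k : Type*} [Field k] {n s : ℕ} (h : s < n)
    (C : Set (Fin n → AlgebraicClosure k)) : Ideal (MvPolynomial (Fin s) (Polynomial k)) :=
  ⨅ x ∈ C, RingHom.ker (evalCurve h x)

/-! ### Kronecker representations -/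

/-- Kronecker representation of an ideal `I` of `R[Y_1, …, Y_s]`, where `R` is the polynomial ring
in the free variables, with primitive element `Y_z`. Here `K` is the fraction field of `R` and
`I^e` is the extension of `I` to `K[Y_1, …, Y_s]`. -/
structure IsKroneckerRepresentation {R : Type*} [CommRing R] [IsDomain R] {s : ℕ} (z : Fin s)
    (I : Ideal (MvPolynomial (Fin s) R)) (M : Polynomial R)
    (W : Fin s → Polynomial (FractionRing R)) : Prop where
  /-- Noether position. -/
  finite : IsFiniteOnComponents (MvPolynomial.C : R →+* MvPolynomial (Fin s) R) I
  monic : M.Monic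
  /-- `M` is the minimal polynomial of `Y_z` over `K`. -/
  isMinpoly : M.map (algebraMap R (FractionRing R)) =
    minpoly (FractionRing R) (Ideal.Quotient.mk
      (I.map (MvPolynomial.map (algebraMap R (FractionRing R)))) (MvPolynomial.X z))
  /-- `Y_z` is a primitive element: the degree of `M` is the dimension of `K[Y_1, …, Y_s] ⧸ I^e`. -/
  primitive : M.natDegree = Module.finrank (FractionRing R)
    (MvPolynomial (Fin s) (FractionRing R) ⧸
      I.map (MvPolynomial.map (algebraMap R (FractionRing R))))
  degree_lt : ∀ i, i ≠ z → (W i).degree < M.degree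
  /-- `I^e` is generated by `M(Y_z)` and the `M'(Y_z) Y_i - W_i(Y_z)` for `i ≠ z`. -/
  ideal_eq : I.map (MvPolynomial.map (algebraMap R (FractionRing R))) =
    Ideal.span
      ({Polynomial.aeval (MvPolynomial.X z) (M.map (algebraMap R (FractionRing R)))} ∪
        {f | ∃ i, i ≠ z ∧ f =
          Polynomial.aeval (MvPolynomial.X z)
              (Polynomial.derivative (M.map (algebraMap R (FractionRing R)))) * MvPolynomial.X i -
            Polynomial.aeval (MvPolynomial.X z) (W i)})

/-- Total degree of an element of `k[X_{n-s}][T]` in the two variables. -/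
noncomputable def bivariateDegree {k : Type*} [Field k] (Q : Polynomial (Polynomial k)) : ℕ :=
  Q.support.sup fun i => (Q.coeff i).natDegree + i

/-! ### The Newton lifting algorithm

An element of `k[[X_{n-s} - p_{n-s}]][T]` known with precision `t` is represented by an element
of `k[X_{n-s}][T]`, and the operations are carried out modulo `(X_{n-s} - p_{n-s})^t`. Below, the
scalar `a` stands for `p_{n-s}`. -/

/-- Truncation to precision `t`: each coefficient is reduced modulo `(X - a)^t`. -/
noncomputable def trunc {k : Type*} [Field k] (a : k) (t : ℕ) (Q : Polynomial (Polynomial k)) :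
    Polynomial (Polynomial k) :=
  Q.sum fun i c => Polynomial.monomial i (c.modByMonic ((Polynomial.X - Polynomial.C a) ^ t))

/-- `Q mod M` with precision `t`, for `M` monic in `T`. -/
noncomputable def reduce {k : Type*} [Field k] (a : k) (t : ℕ) (M Q : Polynomial (Polynomial k)) :
    Polynomial (Polynomial k) :=
  trunc a t (Q.modByMonic M)

open Classical in
/-- Modular inversion: the reduced inverse of `D` modulo `M` with precision `t` (it is unique);
the computation fails if there is none. -/
noncomputable def modInverse {k : Type*} [Field k] (a : k) (t : ℕ)
    (M D : Polynomial (Polynomial k)) : Option (Polynomial (Polynomial k)) :=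
  if h : ∃ u : Polynomial (Polynomial k), reduce a t M u = u ∧
      reduce a t M (u * D) = reduce a t M 1 then some h.choose else none

/-- The data held by the algorithm: `M^j` and `V^j_{n-s+1}, …, V^j_n`. -/
structure State (k : Type*) [Field k] (s : ℕ) where
  M : Polynomial (Polynomial k)
  V : Fin s → Polynomial (Polynomial k)

/-- The specialized system `F_i(p_1, …, p_{n-s-1}, X_{n-s}, …, X_n)`, as elements of
`k[X_{n-s}][X_{n-s+1}, …, X_n]`. -/
noncomputable def specialize {k : Type*} [Field k] {n s : ℕ} (p : Fin (n - s) → k) :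
    MvPolynomial (Fin n) k →ₐ[k] MvPolynomial (Fin s) (Polynomial k) :=
  MvPolynomial.aeval fun i : Fin n =>
    if h₁ : i.val < n - s then
      if i.val < n - s - 1 then MvPolynomial.C (Polynomial.C (p ⟨i.val, h₁⟩))
      else MvPolynomial.C Polynomial.X
    else MvPolynomial.X ⟨i.val - (n - s), by omega⟩

/-- The Jacobian matrix `(∂F_i/∂X_{n-s+j})` of the specialized system. -/
noncomputable def jacobian {k : Type*} [Field k] {s : ℕ}
    (F : Fin s → MvPolynomial (Fin s) (Polynomial k)) :
    Matrix (Fin s) (Fin s) (MvPolynomial (Fin s) (Polynomial k)) :=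
  Matrix.of fun i j => MvPolynomial.pderiv j (F i)

/-- The Newton-Hensel operator `V - J(V)⁻¹ F(V)`, computed modulo `M` with precision `t`, where
`J(V)⁻¹` is the adjugate times the modular inverse of the determinant. -/
noncomputable def newtonHensel {k : Type*} [Field k] {s : ℕ} (a : k) (t : ℕ)
    (F : Fin s → MvPolynomial (Fin s) (Polynomial k)) (S : State k s) :
    Option (Fin s → Polynomial (Polynomial k)) :=
  let J : Matrix (Fin s) (Fin s) (Polynomial (Polynomial k)) :=
    (jacobian F).map (MvPolynomial.aeval S.V)
  (modInverse a t S.M J.det).map fun u i =>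
    reduce a t S.M (S.V i - u * ∑ j : Fin s, J.adjugate i j * MvPolynomial.aeval S.V (F j))

/-- One pass through the loop (steps 4.1 to 4.5) with index `j`; `z` is the index of the primitive
element `X_{n-s+1}`. -/
noncomputable def loopBody {k : Type*} [Field k] {s : ℕ} (a : k)
    (F : Fin s → MvPolynomial (Fin s) (Polynomial k)) (z : Fin s) (j : ℕ) (S : State k s) :
    Option (State k s) :=
  (newtonHensel a (2 ^ (j + 1)) F S).map fun v =>
    let Δ : Polynomial (Polynomial k) := v z - Polynomial.X
    { M := S.M - reduce a (2 ^ (j + 1)) S.M (Δ * Polynomial.derivative S.M)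
      V := fun i => v i - reduce a (2 ^ (j + 1)) S.M (Δ * Polynomial.derivative (v i)) }

/-- The loop: while `2 ^ j < δ + 1`, execute the body and increase `j`. -/
noncomputable def loop {k : Type*} [Field k] {s : ℕ} (a : k)
    (F : Fin s → MvPolynomial (Fin s) (Polynomial k)) (z : Fin s) (δ : ℕ) (j : ℕ)
    (S : State k s) : Option (State k s) :=
  if 2 ^ j < δ + 1 then (loopBody a F z j S).bind fun S' => loop a F z δ (j + 1) S'
  else some S
termination_by δ + 1 - j
decreasing_by
  have h := Nat.lt_two_pow_self (n := j)
  omega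

/-- The Newton lifting algorithm. The input is `m` and `v_i` for `i ≠ z` (the entry `v z` is not
used); the output is `M` and the `W_i`, with precision `δ + 1` where `δ = deg m`. The value is
`none` if a modular inversion fails. -/
noncomputable def newtonLifting {k : Type*} [Field k] {s : ℕ} (a : k)
    (F : Fin s → MvPolynomial (Fin s) (Polynomial k)) (z : Fin s) (m : Polynomial k)
    (v : Fin s → Polynomial k) :
    Option (Polynomial (Polynomial k) × (Fin s → Polynomial (Polynomial k))) :=
  (loop a F z m.natDegree 0
      { M := m.map Polynomial.C
        V := fun i => if i = z then Polynomial.X else (v i).map Polynomial.C }).map fun S =>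
    (trunc a (m.natDegree + 1) S.M,
      fun i => reduce a (m.natDegree + 1) S.M (Polynomial.derivative S.M * S.V i))

end NewtonLifting

/-! Write t for `X_{n-s}`, a for `p_{n-s}`, z for the index of the primitive element, and B for the
coordinate ring of the lifting curve over k[t], with coordinate functions `y i`. The output is first
described without the algorithm. B is integral over k[t] because V_s is finite over affine space,
and torsion-free by going-down, since the base ring is normal. Hence B is free over the principal
ideal domain k[t]. Take M to be the characteristic polynomial of multiplication by `y z`. Take `W i`
to be minus the Λ-coefficient of the characteristic polynomial of `y z + Λ * y i` (the `pencil`).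
Comparing coefficients of Λ in Cayley–Hamilton gives M'(y_z) y_i = W_i(y_z)
(`aeval_derivative_charpoly_mul`).

The fiber at t = a controls B. Unramifiedness makes the Jacobian determinant invertible there
(`det_depJacobian_ne_zero`), so the fiber is reduced (`fiberIdeal_eq_vanishingIdeal`). By Nakayama,
a polynomial of degree less than δ = deg π_s cannot annihilate the primitive element on the fiber.
As deg m = δ, this makes m squarefree, hence separable over the perfect field (`separable_and_dvd`),
and the fiber ring is k[T]/(m). Therefore B has rank δ and M specializes to m (`map_charpoly_eq`).

The bound δ on total degrees is geometric. For general ν, the specialization Λ = ν of the pencil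
defines a plane curve which a generic line meets in as many points as its total degree
(`exists_line_card_eq`). Its points are images of points of C_s, so the line pulls back to an affine
subspace that cuts V_s in at least that many points, and at most deg V_s = δ
(`bivariateDegree_map_pencil_le`). As this holds for infinitely many ν, it holds for the
coefficients in Λ.

The algorithm computes this output by a doubling invariant: at precision N, `S.M` agrees with M and
`S.V i` represents `y i` in B modulo (t - a)^N. In B modulo (t - a)^(2N), `S.M` has an exact root θ
near `y z`; the Newton step computes polynomials with value `y i` at θ, and the correction by Δ
moves the base point from θ back to `y z` (`IsLiftingData.loopBody`). At precision δ + 1 truncation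
loses nothing, because all coefficients have degree at most δ. -/

namespace NewtonLifting

/-! ### Arithmetic modulo `M` and a power of `X - a`. -/

section Truncation

open Polynomial

variable {k : Type*} [Field k] (a : k)

theorem coeff_trunc (t : ℕ) (Q : k[X][X]) (i : ℕ) :
    (trunc a t Q).coeff i = (Q.coeff i) %ₘ ((X - C a) ^ t) := by
  unfold trunc
  rw [Polynomial.sum_def, finsetSum_coeff]
  simp only [coeff_monomial]
  rw [Finset.sum_ite_eq']
  split_ifs with h
  · rfl
  · rw [notMem_support_iff.1 h, zero_modByMonic]

theorem monic_X_sub_C_pow (t : ℕ) : ((X - C a : k[X]) ^ t).Monic := (monic_X_sub_C a).pow t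

theorem trunc_eq_trunc_iff (t : ℕ) (P Q : k[X][X]) :
    trunc a t P = trunc a t Q ↔ C ((X - C a) ^ t) ∣ P - Q := by
  rw [Polynomial.ext_iff, C_dvd_iff_dvd_coeff]
  refine forall_congr' fun i => ?_
  rw [coeff_trunc, coeff_trunc, coeff_sub,
    ← modByMonic_eq_zero_iff_dvd (monic_X_sub_C_pow a t), sub_modByMonic, sub_eq_zero]

theorem trunc_eq_self (t : ℕ) (Q : k[X][X]) (h : ∀ i, (Q.coeff i).natDegree < t) :
    trunc a t Q = Q := by
  ext1 i
  rw [coeff_trunc, (modByMonic_eq_self_iff (monic_X_sub_C_pow a t)).2]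
  rw [degree_pow, degree_X_sub_C, nsmul_one]
  exact lt_of_le_of_lt degree_le_natDegree (by exact_mod_cast h i)

theorem dvd_trunc_sub (t : ℕ) (Q : k[X][X]) : C ((X - C a) ^ t) ∣ trunc a t Q - Q := by
  rw [← trunc_eq_trunc_iff]
  ext1 i
  rw [coeff_trunc, coeff_trunc, (modByMonic_eq_self_iff (monic_X_sub_C_pow a t)).2]
  exact degree_modByMonic_lt _ (monic_X_sub_C_pow a t)

theorem degree_trunc_lt {t : ℕ} {Q : k[X][X]} {d : WithBot ℕ} (h : Q.degree < d) :
    (trunc a t Q).degree < d := by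
  refine lt_of_le_of_lt ((degree_le_iff_coeff_zero _ _).2 fun i hi => ?_) h
  rw [coeff_trunc, coeff_eq_zero_of_degree_lt hi, zero_modByMonic]

/-- The ideal of the polynomials that vanish modulo `M` with precision `t`. -/
noncomputable def precisionIdeal (t : ℕ) (M : k[X][X]) : Ideal k[X][X] :=
  Ideal.span {M, C ((X - C a) ^ t)}

theorem mem_precisionIdeal {t : ℕ} {M Q : k[X][X]} :
    Q ∈ precisionIdeal a t M ↔ ∃ u v, u * M + v * C ((X - C a) ^ t) = Q :=
  Ideal.mem_span_pair

theorem degree_reduce_lt {M : k[X][X]} (hM : M.Monic) (t : ℕ) (Q : k[X][X]) :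
    (reduce a t M Q).degree < M.degree :=
  degree_trunc_lt a (degree_modByMonic_lt Q hM)

theorem reduce_sub_mem {M : k[X][X]} (t : ℕ) (Q : k[X][X]) :
    reduce a t M Q - Q ∈ precisionIdeal a t M := by
  obtain ⟨c, hc⟩ := dvd_trunc_sub a t (Q %ₘ M)
  refine (mem_precisionIdeal a).2 ⟨-(Q /ₘ M), c, ?_⟩
  have := modByMonic_add_div Q M
  unfold reduce
  linear_combination -hc - this

/-- Taking remainders by a monic `M` is linear over the coefficient ring, so the remainder of `u * M
+ v * C ((X - a)^t)` is `(X - a)^t` times the remainder of `v`. This is what makes `reduce` a normal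
form modulo `precisionIdeal`. -/
theorem dvd_of_mem_precisionIdeal {M : k[X][X]} (hM : M.Monic) {t : ℕ} {Q : k[X][X]}
    (hQ : Q.degree < M.degree) (h : Q ∈ precisionIdeal a t M) : C ((X - C a) ^ t) ∣ Q := by
  obtain ⟨u, v, rfl⟩ := (mem_precisionIdeal a).1 h
  rw [← (modByMonic_eq_self_iff hM).2 hQ, add_modByMonic, mul_comm u,
    (modByMonic_eq_zero_iff_dvd hM).2 (dvd_mul_right _ _), zero_add, mul_comm, ← smul_eq_C_mul,
    smul_modByMonic, smul_eq_C_mul]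
  exact dvd_mul_right _ _

theorem reduce_eq_reduce_iff {M : k[X][X]} (hM : M.Monic) (t : ℕ) (P Q : k[X][X]) :
    reduce a t M P = reduce a t M Q ↔ P - Q ∈ precisionIdeal a t M := by
  constructor
  · intro h
    have h1 := reduce_sub_mem (M := M) a t P
    have h2 := reduce_sub_mem (M := M) a t Q
    rw [h] at h1
    convert sub_mem h2 h1 using 1
    ring
  · intro h
    unfold reduce
    rw [trunc_eq_trunc_iff]
    refine dvd_of_mem_precisionIdeal a hM ?_ ?_
    · exact lt_of_le_of_lt (degree_sub_le _ _)
        (max_lt (degree_modByMonic_lt _ hM) (degree_modByMonic_lt _ hM))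
    · obtain ⟨u, v, e⟩ := (mem_precisionIdeal a).1 h
      refine (mem_precisionIdeal a).2 ⟨u - (P /ₘ M) + Q /ₘ M, v, ?_⟩
      have h1 := modByMonic_add_div P M
      have h2 := modByMonic_add_div Q M
      linear_combination e - h1 + h2

theorem reduce_reduce {M : k[X][X]} (hM : M.Monic) (t : ℕ) (Q : k[X][X]) :
    reduce a t M (reduce a t M Q) = reduce a t M Q :=
  (reduce_eq_reduce_iff a hM t _ _).2 (reduce_sub_mem a t Q)

theorem reduce_eq_self {M : k[X][X]} (hM : M.Monic) {t : ℕ} {Q : k[X][X]}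
    (hQ : Q.degree < M.degree) (h : ∀ i, (Q.coeff i).natDegree < t) : reduce a t M Q = Q := by
  rw [reduce, (modByMonic_eq_self_iff hM).2 hQ, trunc_eq_self a t Q h]

/-- Any inverse can be reduced to the normal form demanded by `modInverse`, so the computation fails
only when `D` is really not invertible. -/
theorem exists_modInverse_eq {M : k[X][X]} (hM : M.Monic) (t : ℕ) (D : k[X][X])
    (h : ∃ u, u * D - 1 ∈ precisionIdeal a t M) :
    ∃ u, modInverse a t M D = some u ∧ u * D - 1 ∈ precisionIdeal a t M := by
  have h' : ∃ u : k[X][X], reduce a t M u = u ∧ reduce a t M (u * D) = reduce a t M 1 := by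
    obtain ⟨u, hu⟩ := h
    refine ⟨reduce a t M u, reduce_reduce a hM t u, (reduce_eq_reduce_iff a hM t _ _).2 ?_⟩
    convert add_mem (Ideal.mul_mem_right D _ (reduce_sub_mem (M := M) a t u)) hu using 1
    ring
  refine ⟨h'.choose, dif_pos h', ?_⟩
  exact (reduce_eq_reduce_iff a hM t _ _).1 h'.choose_spec.2

theorem precisionIdeal_congr {t : ℕ} {M M' : k[X][X]} (h : C ((X - C a) ^ t) ∣ M - M') :
    precisionIdeal a t M = precisionIdeal a t M' := by
  obtain ⟨c, hc⟩ := h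
  ext Q
  rw [mem_precisionIdeal, mem_precisionIdeal]
  constructor
  · rintro ⟨u, v, rfl⟩
    exact ⟨u, v + u * c, by linear_combination -u * hc⟩
  · rintro ⟨u, v, rfl⟩
    exact ⟨u, v - u * c, by linear_combination u * hc⟩

end Truncation

/-! ### First-order expansion in several variables. -/

section Taylor

open Polynomial

/-- First-order Taylor expansion along a vector whose entries have pairwise products `0`. -/
theorem aeval_add_of_mul_eq_zero {R S σ : Type*} [CommRing R] [CommRing S] [Algebra R S]
    [Fintype σ] (y h : σ → S) (hh : ∀ i j, h i * h j = 0) (f : MvPolynomial σ R) :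
    MvPolynomial.aeval (fun i => y i + h i) f =
      MvPolynomial.aeval y f + ∑ i, MvPolynomial.aeval y (MvPolynomial.pderiv i f) * h i := by
  classical
  induction f using MvPolynomial.induction_on with
  | C r => simp
  | add p q hp hq =>
    simp only [map_add, hp, hq, add_mul, Finset.sum_add_distrib]; ring
  | mul_X p j hp =>
    have h0 : (∑ i, MvPolynomial.aeval y (MvPolynomial.pderiv i p) * h i) * h j = 0 := by
      rw [Finset.sum_mul]
      exact Finset.sum_eq_zero fun i _ => by rw [mul_assoc, hh, mul_zero]
    have h1 : ∑ i, MvPolynomial.aeval y (MvPolynomial.pderiv i (p * MvPolynomial.X j)) * h i =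
        (∑ i, MvPolynomial.aeval y (MvPolynomial.pderiv i p) * h i) * y j +
          MvPolynomial.aeval y p * h j := by
      simp only [Derivation.leibniz, MvPolynomial.pderiv_X, smul_eq_mul, map_add, map_mul,
        MvPolynomial.aeval_X, add_mul, Finset.sum_add_distrib]
      rw [add_comm, Finset.sum_mul]
      congr 1
      · exact Finset.sum_congr rfl fun i _ => by ring
      · rw [Finset.sum_eq_single j] <;> simp +contextual [eq_comm]
    rw [h1, map_mul, map_mul, hp, MvPolynomial.aeval_X, MvPolynomial.aeval_X]
    linear_combination h0

end Taylor

/-! ### Computing in the coordinate ring of the curve near the fiber. -/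

section Core

open Polynomial

/-- The coordinate ring `B` of a lifting curve over `k[X_{n-s}]`, with coordinate functions `y`,
an equation `M` of the primitive element `y z`, and the data `m`, `v` of the fiber at `a`. -/
structure IsLiftingData {k : Type*} [Field k] {s : ℕ} {B : Type*} [CommRing B] [Algebra k[X] B]
    (a : k) (F : Fin s → MvPolynomial (Fin s) k[X]) (z : Fin s) (m : k[X]) (v : Fin s → k[X])
    (M : k[X][X]) (y : Fin s → B) : Prop where
  monic : M.Monic
  aeval_eq_zero : aeval (y z) M = 0
  map_eval : M.map (evalRingHom a) = m
  dvd_of_mem : ∀ q : k[X][X], aeval (y z) q ∈ Ideal.span {algebraMap k[X] B (X - C a)} →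
    m ∣ q.map (evalRingHom a)
  system : ∀ j, MvPolynomial.aeval y (F j) = 0
  jacobian_unit : ∃ u, u * MvPolynomial.aeval y (jacobian F).det - 1 ∈
    Ideal.span {algebraMap k[X] B (X - C a)}
  coord : ∀ i, i ≠ z → aeval (y z) ((v i).map C : k[X][X]) - y i ∈
    Ideal.span {algebraMap k[X] B (X - C a)}
  generates : ∀ b, ∃ q : k[X][X], aeval (y z) q - b ∈ Ideal.span {algebraMap k[X] B (X - C a)}
  regular : ∀ b, algebraMap k[X] B (X - C a) * b = 0 → b = 0
  coprime : IsCoprime m (derivative m)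

theorem dvd_sub_map_map_eval {k : Type*} [Field k] (a : k) (q : k[X][X]) :
    C (X - C a) ∣ q - (q.map (evalRingHom a)).map C := by
  rw [C_dvd_iff_dvd_coeff]
  intro i
  rw [coeff_sub, coeff_map, coeff_map, coe_evalRingHom]
  exact X_sub_C_dvd_sub_C_eval

variable {k : Type*} [Field k] {s : ℕ} {B : Type*} [CommRing B] [Algebra k[X] B]
    {a : k} {F : Fin s → MvPolynomial (Fin s) k[X]} {z : Fin s} {m : k[X]} {v : Fin s → k[X]}
    {Ms : k[X][X]} {y : Fin s → B}

/-- An element coprime to `p` is coprime to every power of `p`. -/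
theorem isUnit_mod_pow {A : Type*} [CommRing A] {x p : A} (n : ℕ)
    (h : ∃ u, u * x - 1 ∈ Ideal.span {p}) : ∃ u, u * x - 1 ∈ Ideal.span {p ^ n} := by
  obtain ⟨u, hu⟩ := h
  obtain ⟨c, hc⟩ := Ideal.mem_span_singleton'.1 hu
  have : IsCoprime x p := ⟨u, -c, by linear_combination -hc⟩
  obtain ⟨u', c', h'⟩ := this.pow_right (n := n)
  exact ⟨u', Ideal.mem_span_singleton'.2 ⟨-c', by linear_combination -h'⟩⟩

/-- The dictionary between truncated polynomial arithmetic and `B`. If `q (y z)` is divisible by `X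
- a`, then `m` divides `q` at `X = a`, so `q` is a multiple of `Ms` plus `(X - a) * q₁`. Since `X -
a` is regular on `B`, one factor cancels and induction applies to `q₁`. -/
theorem IsLiftingData.mem_pow_iff (h : IsLiftingData a F z m v Ms y) (N : ℕ) (q : k[X][X]) :
    aeval (y z) q ∈ Ideal.span {algebraMap k[X] B (X - C a) ^ N} ↔
      q ∈ precisionIdeal a N Ms := by
  constructor
  · induction N generalizing q with
    | zero => intro _; exact (mem_precisionIdeal a).2 ⟨0, q, by simp⟩
    | succ N ih =>
      intro hq
      obtain ⟨b, hb⟩ := Ideal.mem_span_singleton'.1 hq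
      obtain ⟨g, hg⟩ := h.dvd_of_mem q
        (Ideal.mem_span_singleton'.2 ⟨b * algebraMap k[X] B (X - C a) ^ N, by rw [← hb]; ring⟩)
      -- The difference vanishes at `X = a`, because `Ms` specializes to `m` there.
      have hd : C (X - C a) ∣ q - Ms * g.map C := by
        have h1 := dvd_sub_map_map_eval a (q - Ms * g.map C)
        rw [Polynomial.map_sub, Polynomial.map_mul, h.map_eval, Polynomial.map_map] at h1
        have : (evalRingHom a).comp C = RingHom.id k := by ext x; simp
        rw [this, Polynomial.map_id, ← hg, sub_self, Polynomial.map_zero, sub_zero] at h1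
        exact h1
      obtain ⟨q₁, hq₁⟩ := hd
      have h2 : aeval (y z) q = algebraMap k[X] B (X - C a) * aeval (y z) q₁ := by
        have := congrArg (aeval (y z)) hq₁
        rw [map_sub, map_mul, map_mul, h.aeval_eq_zero, zero_mul, sub_zero, aeval_C] at this
        exact this
      have h3 : aeval (y z) q₁ = b * algebraMap k[X] B (X - C a) ^ N := by
        rw [← sub_eq_zero]
        refine h.regular _ ?_
        linear_combination -h2 - hb
      obtain ⟨u, w, e⟩ := (mem_precisionIdeal a).1
        (ih q₁ (Ideal.mem_span_singleton'.2 ⟨b, h3.symm⟩))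
      refine (mem_precisionIdeal a).2 ⟨g.map C + C (X - C a) * u, w, ?_⟩
      rw [pow_succ, C_mul]
      linear_combination C (X - C a) * e - hq₁
  · intro hq
    obtain ⟨u, w, rfl⟩ := (mem_precisionIdeal a).1 hq
    rw [map_add, map_mul, map_mul, h.aeval_eq_zero, mul_zero, zero_add, aeval_C, map_pow]
    exact Ideal.mul_mem_left _ _ (Ideal.mem_span_singleton_self _)

/-- The loop invariant: `S` is correct with precision `N`. -/
structure IsCorrectState (a : k) (z : Fin s) (Ms : k[X][X]) (y : Fin s → B) (N : ℕ)
    (S : State k s) : Prop where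
  degree_sub_lt : (S.M - Ms).degree < Ms.degree
  dvd_sub : C ((X - C a) ^ N) ∣ S.M - Ms
  coord : ∀ i, aeval (y z) (S.V i) - y i ∈ Ideal.span {algebraMap k[X] B (X - C a) ^ N}

theorem IsCorrectState.monic {N : ℕ} {S : State k s} (hS : IsCorrectState a z Ms y N S)
    (hM : Ms.Monic) : S.M.Monic := by
  have := hM.add_of_left (q := S.M - Ms) hS.degree_sub_lt
  rwa [add_sub_cancel] at this

theorem IsCorrectState.degree_eq {N : ℕ} {S : State k s} (hS : IsCorrectState a z Ms y N S) :
    S.M.degree = Ms.degree := by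
  have := degree_add_eq_left_of_degree_lt hS.degree_sub_lt
  rwa [add_sub_cancel] at this

theorem aeval_sub_mem_of_sub_mem {A σ : Type*} [CommRing A] [Algebra k[X] A] {I : Ideal A}
    {y y' : σ → A} (h : ∀ i, y i - y' i ∈ I) (f : MvPolynomial σ k[X]) :
    MvPolynomial.aeval y f - MvPolynomial.aeval y' f ∈ I := by
  have h1 : ∀ y : σ → A, Ideal.Quotient.mk I (MvPolynomial.aeval y f) =
      MvPolynomial.aeval (fun i => Ideal.Quotient.mk I (y i)) f := fun y => by
    rw [← Ideal.Quotient.mkₐ_eq_mk k[X], MvPolynomial.comp_aeval_apply]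
  rw [← Ideal.Quotient.eq, h1, h1]
  congr 1
  exact congrArg _ (funext fun i => Ideal.Quotient.eq.2 (h i))

/-- The modular inverse needed in the Newton step exists. -/
theorem IsLiftingData.exists_inverse (h : IsLiftingData a F z m v Ms y) {N t : ℕ} (hN : N ≠ 0)
    {S : State k s} (hS : IsCorrectState a z Ms y N S) :
    ∃ u, u * MvPolynomial.aeval S.V (jacobian F).det - 1 ∈ precisionIdeal a t S.M := by
  obtain ⟨b, hb⟩ := h.jacobian_unit
  obtain ⟨q, hq⟩ := h.generates b
  have hle : Ideal.span {algebraMap k[X] B (X - C a) ^ N} ≤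
      Ideal.span {algebraMap k[X] B (X - C a)} := by
    rw [Ideal.span_singleton_le_span_singleton]; exact dvd_pow_self _ hN
  have hD : aeval (y z) (MvPolynomial.aeval S.V (jacobian F).det) -
      MvPolynomial.aeval y (jacobian F).det ∈ Ideal.span {algebraMap k[X] B (X - C a)} := by
    rw [MvPolynomial.comp_aeval_apply]
    exact aeval_sub_mem_of_sub_mem (fun i => hle (hS.coord i)) _
  -- `q` represents the inverse of the Jacobian determinant on the fiber. At precision 1 the vector
  -- `S.V` already agrees with `y`, because `N ≠ 0`.
  have h1 : q * MvPolynomial.aeval S.V (jacobian F).det - 1 ∈ precisionIdeal a 1 Ms := by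
    rw [← h.mem_pow_iff, pow_one, map_sub (aeval (R := k[X]) (y z)), map_mul, map_one]
    convert add_mem (add_mem (Ideal.mul_mem_left _ (aeval (y z) q) hD)
      (Ideal.mul_mem_right (MvPolynomial.aeval y (jacobian F).det) _ hq)) hb using 1
    ring
  have hdvd : C ((X - C a) ^ 1) ∣ S.M - Ms :=
    (_root_.map_dvd C (pow_dvd_pow _ (Nat.one_le_iff_ne_zero.2 hN))).trans hS.dvd_sub
  rw [← precisionIdeal_congr a hdvd] at h1
  obtain ⟨u, w, e⟩ := (mem_precisionIdeal a).1 h1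
  -- Working modulo `S.M`, invertibility modulo `X - a` lifts to invertibility modulo any power of
  -- it.
  obtain ⟨u', hu'⟩ := isUnit_mod_pow (A := k[X][X] ⧸ Ideal.span {S.M}) t
    (x := Ideal.Quotient.mk _ (MvPolynomial.aeval S.V (jacobian F).det))
    (p := Ideal.Quotient.mk _ (C (X - C a)))
    ⟨Ideal.Quotient.mk _ q, Ideal.mem_span_singleton'.2 ⟨Ideal.Quotient.mk _ w, by
      rw [← map_mul, ← map_mul, ← map_one (Ideal.Quotient.mk _), ← map_sub, Ideal.Quotient.eq]
      refine Ideal.mem_span_singleton'.2 ⟨-u, ?_⟩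
      rw [pow_one] at e
      linear_combination -e⟩⟩
  obtain ⟨u', rfl⟩ := Ideal.Quotient.mk_surjective u'
  obtain ⟨c, hc⟩ := Ideal.mem_span_singleton'.1 hu'
  obtain ⟨c, rfl⟩ := Ideal.Quotient.mk_surjective c
  rw [← map_pow, ← map_mul, ← map_mul, ← map_one (Ideal.Quotient.mk _), ← map_sub,
    Ideal.Quotient.eq] at hc
  obtain ⟨d, hd⟩ := Ideal.mem_span_singleton'.1 hc
  refine ⟨u', (mem_precisionIdeal a).2 ⟨-d, c, ?_⟩⟩
  rw [C_pow]
  linear_combination -hd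

end Core

/-! ### One Newton step, at double precision. -/

section Step

open Polynomial

variable {k : Type*} [Field k] {s : ℕ}

theorem sub_dvd_aeval_sub {R A : Type*} [CommRing R] [CommRing A] [Algebra R A] (q : R[X])
    (x y : A) : x - y ∣ aeval x q - aeval y q := by
  rw [← eval_map_algebraMap, ← eval_map_algebraMap]
  exact sub_dvd_eval_sub x y _

/-- The Newton step at a root `θ` of `M` close to the primitive element recovers the coordinates,
if the squares of the errors vanish. -/
theorem exists_root_newton {A : Type*} [CommRing A] [Algebra k[X] A] {p : A} (hp : p * p = 0)
    {F : Fin s → MvPolynomial (Fin s) k[X]} {z : Fin s} {S : State k s} {y : Fin s → A}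
    (hM : p ∣ aeval (y z) S.M) (hM' : IsUnit (aeval (y z) (derivative S.M)))
    (hV : ∀ i, p ∣ aeval (y z) (S.V i) - y i) (hF : ∀ j, MvPolynomial.aeval y (F j) = 0)
    {u : k[X][X]} {v : Fin s → k[X][X]}
    (hu : ∀ θ : A, aeval θ S.M = 0 →
      aeval θ u * aeval θ (MvPolynomial.aeval S.V (jacobian F).det) = 1)
    (hv : ∀ θ : A, aeval θ S.M = 0 → ∀ i, aeval θ (v i) = aeval θ (S.V i - u * ∑ j : Fin s,
      ((jacobian F).map (MvPolynomial.aeval S.V)).adjugate i j * MvPolynomial.aeval S.V (F j))) :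
    ∃ θ : A, aeval θ S.M = 0 ∧ p ∣ y z - θ ∧ ∀ i, aeval θ (v i) = y i := by
  obtain ⟨w, hw⟩ := isUnit_iff_exists_inv.1 hM'
  obtain ⟨c, hc⟩ := hM
  -- A univariate Newton correction of `y z`. It is an exact root because `aeval (y z) S.M` is a
  -- multiple of `p` and `p * p = 0`.
  have hθ : aeval (y z + -(aeval (y z) S.M * w)) S.M = 0 := by
    rw [aeval_add_of_sq_eq_zero]
    · linear_combination -aeval (y z) S.M * hw
    · rw [hc]; linear_combination (c * w) ^ 2 * hp
  obtain ⟨θ, rfl⟩ : ∃ θ, θ = y z + -(aeval (y z) S.M * w) := ⟨_, rfl⟩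
  set θ := y z + -(aeval (y z) S.M * w) with hθdef
  have hdiv : p ∣ y z - θ := ⟨c * w, by rw [hθdef, hc]; ring⟩
  refine ⟨θ, hθ, hdiv, fun i => ?_⟩
  have hV' : ∀ i, p ∣ aeval θ (S.V i) - y i := fun i => by
    have h1 : p ∣ aeval θ (S.V i) - aeval (y z) (S.V i) := by
      rw [dvd_sub_comm]
      exact hdiv.trans (sub_dvd_aeval_sub (S.V i) (y z) θ)
    convert dvd_add h1 (hV i) using 1
    ring
  choose e he using hV'
  have hy : y = fun i => aeval θ (S.V i) + -(p * e i) := funext fun i => by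
    rw [← he]; ring
  -- Taylor expansion of `F` at `V(θ)`, whose distance to the zero `y` is `p * e`: only the linear
  -- term survives.
  have hFV : ∀ j, aeval θ (MvPolynomial.aeval S.V (F j)) =
      ∑ l, aeval θ (MvPolynomial.aeval S.V (jacobian F j l)) * (p * e l) := fun j => by
    have h1 := hF j
    rw [hy, aeval_add_of_mul_eq_zero _ _ (fun i j => by linear_combination e i * e j * hp)] at h1
    simp only [MvPolynomial.comp_aeval_apply]
    rw [← sub_eq_zero, ← h1, sub_eq_add_neg, ← Finset.sum_neg_distrib]
    simp [jacobian]
  -- Since the adjugate times the Jacobian is the determinant, multiplying by the inverse `u`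
  -- recovers the error `p * e i` exactly.
  have hadj : ∑ j, aeval θ (((jacobian F).map (MvPolynomial.aeval S.V)).adjugate i j) *
      aeval θ (MvPolynomial.aeval S.V (F j)) =
      aeval θ (MvPolynomial.aeval S.V (jacobian F).det) * (p * e i) := by
    have h1 := Matrix.adjugate_mul ((jacobian F).map (MvPolynomial.aeval S.V))
    have h2 : ((jacobian F).map (MvPolynomial.aeval S.V)).det =
        MvPolynomial.aeval S.V (jacobian F).det := by
      rw [AlgHom.map_det]; rfl
    have h3 : ∀ l, ∑ j, aeval θ (((jacobian F).map (MvPolynomial.aeval S.V)).adjugate i j) *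
        aeval θ (MvPolynomial.aeval S.V (jacobian F j l)) =
        if i = l then aeval θ (MvPolynomial.aeval S.V (jacobian F).det) else 0 := fun l => by
      have h4 := congrFun (congrFun h1 i) l
      rw [Matrix.mul_apply, h2] at h4
      have h5 := congrArg (aeval θ) h4
      simp only [map_sum, map_mul, Matrix.map_apply, Matrix.smul_apply, Matrix.one_apply,
        smul_eq_mul, mul_ite, mul_one, mul_zero] at h5
      rw [h5]
      split_ifs <;> simp
    simp only [hFV, Finset.mul_sum]
    rw [Finset.sum_comm]
    simp only [← mul_assoc, ← Finset.sum_mul, h3]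
    simp
  rw [hv θ hθ i, map_sub, map_mul, map_sum]
  simp only [map_mul]
  rw [hadj]
  linear_combination he i - p * e i * hu θ hθ

variable {B : Type*} [CommRing B] [Algebra k[X] B]
    {a : k} {F : Fin s → MvPolynomial (Fin s) k[X]} {z : Fin s} {m : k[X]} {v : Fin s → k[X]}
    {Ms : k[X][X]} {y : Fin s → B}

/-- Modulo `X - a`, `S.M` becomes `m`, which vanishes at `y z`. A Bézout relation `c * m + d * m' =
1` therefore makes `d (y z)` an inverse of the derivative there, and units lift to higher powers. -/
theorem IsLiftingData.isUnit_derivative (h : IsLiftingData a F z m v Ms y) {N : ℕ}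
    {S : State k s} (hS : IsCorrectState a z Ms y N S) (hN : N ≠ 0) (t : ℕ) :
    IsUnit (Ideal.Quotient.mk (Ideal.span {algebraMap k[X] B (X - C a) ^ t})
      (aeval (y z) (derivative S.M))) := by
  obtain ⟨c, d, hcd⟩ := h.coprime
  have h1 : d.map C * derivative S.M - 1 ∈ precisionIdeal a 1 Ms := by
    have h2 : C (X - C a) ∣ derivative S.M - (derivative m).map C := by
      have h3 := dvd_sub_map_map_eval a (derivative Ms)
      rw [← derivative_map, h.map_eval] at h3
      have h4 : C (X - C a) ∣ derivative S.M - derivative Ms := by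
        obtain ⟨g, hg⟩ := hS.dvd_sub
        rw [← derivative_sub, hg, derivative_C_mul, C_pow]
        exact (dvd_pow_self _ hN).mul_right _
      convert dvd_add h4 h3 using 1
      ring
    have h5 := dvd_sub_map_map_eval a Ms
    rw [h.map_eval] at h5
    obtain ⟨g, hg⟩ := h2
    obtain ⟨g', hg'⟩ := h5
    have h6 := congrArg (Polynomial.map C) hcd
    rw [Polynomial.map_add, Polynomial.map_mul, Polynomial.map_mul, Polynomial.map_one] at h6
    refine (mem_precisionIdeal a).2 ⟨-c.map C, d.map C * g + c.map C * g', ?_⟩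
    rw [pow_one]
    linear_combination -d.map C * hg - h6 - c.map C * hg'
  rw [← h.mem_pow_iff, pow_one, map_sub (aeval (R := k[X]) (y z)), map_mul, map_one] at h1
  obtain ⟨u, hu⟩ := isUnit_mod_pow t ⟨_, h1⟩
  refine IsUnit.of_mul_eq_one_right (Ideal.Quotient.mk _ u) ?_
  rw [← map_mul, ← map_one (Ideal.Quotient.mk _), Ideal.Quotient.eq]
  exact hu

/-- A polynomial of degree less than that of `M` which is small at a point close to the primitive
element has small coefficients, hence has the same value at both points to double precision. -/
theorem IsLiftingData.mk_aeval_eq (h : IsLiftingData a F z m v Ms y) {N : ℕ} {q : k[X][X]}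
    (hq : q.degree < Ms.degree) {θ : B ⧸ Ideal.span {algebraMap k[X] B (X - C a) ^ (2 * N)}}
    (hz : algebraMap k[X] _ (X - C a) ^ N ∣ Ideal.Quotient.mk _ (y z) - θ)
    (hqθ : algebraMap k[X] _ (X - C a) ^ N ∣ aeval θ q) :
    aeval (Ideal.Quotient.mk (Ideal.span {algebraMap k[X] B (X - C a) ^ (2 * N)}) (y z)) q =
      aeval θ q := by
  have hpp : algebraMap k[X] (B ⧸ Ideal.span {algebraMap k[X] B (X - C a) ^ (2 * N)}) (X - C a) ^ N *
      algebraMap k[X] _ (X - C a) ^ N = 0 := by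
    rw [← pow_add, ← two_mul]
    exact Ideal.Quotient.eq_zero_iff_mem.2 (Ideal.mem_span_singleton_self _)
  obtain ⟨c, hc⟩ : algebraMap k[X] (B ⧸ Ideal.span {algebraMap k[X] B (X - C a) ^ (2 * N)})
      (X - C a) ^ N ∣ aeval (Ideal.Quotient.mk _ (y z)) q := by
    have h1 := hz.trans (sub_dvd_aeval_sub q _ θ)
    convert dvd_add h1 hqθ using 1
    ring
  obtain ⟨c, rfl⟩ := Ideal.Quotient.mk_surjective c
  -- Divisibility by `(X - a)^N` in the quotient by `(X - a)^(2N)` is already divisibility in `B`.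
  have h2 : q ∈ precisionIdeal a N Ms := by
    rw [← h.mem_pow_iff]
    have h3 : Ideal.Quotient.mk (Ideal.span {algebraMap k[X] B (X - C a) ^ (2 * N)})
        (aeval (y z) q) = Ideal.Quotient.mk _ (algebraMap k[X] B (X - C a) ^ N * c) := by
      rw [← Ideal.Quotient.mkₐ_eq_mk k[X], ← aeval_algHom_apply]
      exact hc
    obtain ⟨d, hd⟩ := Ideal.mem_span_singleton'.1 (Ideal.Quotient.eq.1 h3)
    refine Ideal.mem_span_singleton'.2 ⟨c + d * algebraMap k[X] B (X - C a) ^ N, ?_⟩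
    rw [two_mul, pow_add] at hd
    linear_combination hd
  -- With the factor `(X - a)^N` extracted from `q`, the second factor comes from `q'`, whose values
  -- at `y z` and `θ` differ by a multiple of `(X - a)^N`.
  obtain ⟨q', rfl⟩ := dvd_of_mem_precisionIdeal a h.monic hq h2
  obtain ⟨e, he⟩ := hz.trans (sub_dvd_aeval_sub q' _ θ)
  rw [map_mul, map_mul, aeval_C, aeval_C, map_pow]
  linear_combination algebraMap k[X] _ (X - C a) ^ N * he + e * hpp

end Step

/-! ### The loop invariant, termination and the final truncation. -/

section Loop

open Polynomial

variable {k : Type*} [Field k] {s : ℕ} {B : Type*} [CommRing B] [Algebra k[X] B]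
    {a : k} {F : Fin s → MvPolynomial (Fin s) k[X]} {z : Fin s} {m : k[X]} {v : Fin s → k[X]}
    {Ms : k[X][X]} {y : Fin s → B}

/-- Everything is read off at the root `θ` of `S.M` close to `y z`, in `B` modulo `(X - a)^(2N)`
with `N = 2 ^ j`. There the Newton output `w` satisfies `w i (θ) = y i`; in particular `Δ(θ) = y z -
θ`. The update replaces each `q` by a polynomial whose value at `y z` is `q (θ)`. Applied to `S.M`
this gives 0, and applied to `w i` it gives `y i`. -/
theorem IsLiftingData.loopBody (h : IsLiftingData a F z m v Ms y) {j : ℕ} {S : State k s}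
    (hS : IsCorrectState a z Ms y (2 ^ j) S) :
    ∃ S', loopBody a F z j S = some S' ∧ IsCorrectState a z Ms y (2 ^ (j + 1)) S' := by
  have hN : 2 ^ j ≠ 0 := by positivity
  have hSM := hS.monic h.monic
  obtain ⟨u, hu, huD⟩ := exists_modInverse_eq a hSM (2 ^ (j + 1)) _ (h.exists_inverse hN hS)
  have hdet : ((NewtonLifting.jacobian F).map (MvPolynomial.aeval S.V)).det =
      MvPolynomial.aeval S.V (NewtonLifting.jacobian F).det := by
    rw [AlgHom.map_det]; rfl
  obtain ⟨w, hw⟩ : ∃ w : Fin s → k[X][X], w = fun i => reduce a (2 ^ (j + 1)) S.M (S.V i - u *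
      ∑ l : Fin s, ((NewtonLifting.jacobian F).map (MvPolynomial.aeval S.V)).adjugate i l *
        MvPolynomial.aeval S.V (F l)) := ⟨_, rfl⟩
  refine ⟨_, by
    rw [NewtonLifting.loopBody, newtonHensel]
    dsimp only
    rw [hdet, hu, Option.map_some, Option.map_some, ← hw], ?_⟩
  have e2 : 2 ^ (j + 1) = 2 * 2 ^ j := by ring
  rw [e2] at huD hw ⊢
  generalize 2 ^ j = N at *
  -- Evaluation at a root of `S.M` kills the precision ideal, so the reductions made by the
  -- algorithm do not change values at `θ`.
  have hker : ∀ θ : B ⧸ Ideal.span {algebraMap k[X] B (X - C a) ^ (2 * N)}, aeval θ S.M = 0 →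
      ∀ q ∈ precisionIdeal a (2 * N) S.M, aeval θ q = 0 := by
    intro θ hθ q hq
    obtain ⟨c, d, rfl⟩ := (mem_precisionIdeal a).1 hq
    have : aeval θ (C ((X - C a) ^ (2 * N))) = 0 := by
      rw [aeval_C, map_pow]
      exact Ideal.Quotient.eq_zero_iff_mem.2 (Ideal.mem_span_singleton_self _)
    rw [map_add, map_mul, map_mul, hθ, this, mul_zero, mul_zero, add_zero]
  have hred : ∀ θ : B ⧸ Ideal.span {algebraMap k[X] B (X - C a) ^ (2 * N)}, aeval θ S.M = 0 →
      ∀ q, aeval θ (reduce a (2 * N) S.M q) = aeval θ q := by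
    intro θ hθ q
    rw [← sub_eq_zero, ← map_sub]
    exact hker θ hθ _ (reduce_sub_mem a _ _)
  have hmk : ∀ q : k[X][X], aeval (Ideal.Quotient.mk (Ideal.span
      {algebraMap k[X] B (X - C a) ^ (2 * N)}) (y z)) q = Ideal.Quotient.mk _ (aeval (y z) q) := by
    intro q
    rw [← Ideal.Quotient.mkₐ_eq_mk k[X], aeval_algHom_apply]
  have hdvd : ∀ b ∈ Ideal.span {algebraMap k[X] B (X - C a) ^ N},
      algebraMap k[X] (B ⧸ Ideal.span {algebraMap k[X] B (X - C a) ^ (2 * N)}) (X - C a) ^ N ∣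
        Ideal.Quotient.mk _ b := by
    intro b hb
    obtain ⟨c, rfl⟩ := Ideal.mem_span_singleton.1 hb
    exact ⟨Ideal.Quotient.mk _ c, by rw [map_mul]; rfl⟩
  have hpp : algebraMap k[X] (B ⧸ Ideal.span {algebraMap k[X] B (X - C a) ^ (2 * N)}) (X - C a) ^ N *
      algebraMap k[X] _ (X - C a) ^ N = 0 := by
    rw [← pow_add, ← two_mul]
    exact Ideal.Quotient.eq_zero_iff_mem.2 (Ideal.mem_span_singleton_self _)
  obtain ⟨θ, hθ, hzθ, hwθ⟩ := exists_root_newton (F := F) (z := z) (S := S)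
    (y := fun i => Ideal.Quotient.mk (Ideal.span {algebraMap k[X] B (X - C a) ^ (2 * N)}) (y i))
    (u := u) (v := w) hpp
    (by
      rw [hmk]
      refine hdvd _ ?_
      rw [h.mem_pow_iff]
      obtain ⟨c, hc⟩ := hS.dvd_sub
      exact (mem_precisionIdeal a).2 ⟨1, c, by linear_combination -hc⟩)
    (by rw [hmk]; exact h.isUnit_derivative hS hN _)
    (fun i => by rw [hmk, ← map_sub]; exact hdvd _ (hS.coord i))
    (fun l => by
      have := h.system l
      rw [← Ideal.Quotient.mkₐ_eq_mk k[X], ← MvPolynomial.comp_aeval_apply, this, map_zero])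
    (fun θ hθ => by
      have := hker θ hθ _ huD
      rwa [map_sub (aeval (R := k[X]) θ), map_mul, map_one, sub_eq_zero] at this)
    (fun θ hθ i => by rw [hw]; exact hred θ hθ _)
  have hΔ : aeval θ (w z - X) = Ideal.Quotient.mk _ (y z) - θ := by
    rw [map_sub (aeval (R := k[X]) θ), hwθ, aeval_X]
  have hsq : (Ideal.Quotient.mk (Ideal.span {algebraMap k[X] B (X - C a) ^ (2 * N)}) (y z) - θ) ^ 2
      = 0 := by
    obtain ⟨c, hc⟩ := hzθ
    rw [hc]
    linear_combination c ^ 2 * hpp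
  -- By Taylor, `q (y z) = q (θ) + q' (θ) * (y z - θ)`, as the square of the displacement is 0. The
  -- reduced correction has value `q' (θ) * (y z - θ)` at `θ`; being small and of low degree, it has
  -- the same value at `y z` by `mk_aeval_eq`.
  have key : ∀ q : k[X][X], Ideal.Quotient.mk (Ideal.span {algebraMap k[X] B (X - C a) ^ (2 * N)})
      (aeval (y z) (q - reduce a (2 * N) S.M ((w z - X) * derivative q))) = aeval θ q := by
    intro q
    have hr : aeval θ (reduce a (2 * N) S.M ((w z - X) * derivative q)) =
        aeval θ (derivative q) * (Ideal.Quotient.mk _ (y z) - θ) := by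
      rw [hred θ hθ, map_mul, hΔ, mul_comm (_ - θ)]
    have h1 := aeval_add_of_sq_eq_zero q θ _ hsq
    rw [add_sub_cancel] at h1
    rw [← hmk, map_sub (aeval (R := k[X]) (Ideal.Quotient.mk _ (y z))), h.mk_aeval_eq (lt_of_lt_of_eq (degree_reduce_lt a hSM _ _) hS.degree_eq) hzθ
      (hr ▸ hzθ.mul_left _), h1, hr, add_sub_cancel_right]
  have hdeg : (S.M - reduce a (2 * N) S.M ((w z - X) * derivative S.M) - Ms).degree < Ms.degree := by
    rw [sub_right_comm]
    exact lt_of_le_of_lt (degree_sub_le _ _) (max_lt hS.degree_sub_lt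
      (lt_of_lt_of_eq (degree_reduce_lt a hSM _ _) hS.degree_eq))
  refine ⟨hdeg, dvd_of_mem_precisionIdeal a h.monic hdeg ?_, fun i => ?_⟩
  · rw [← h.mem_pow_iff, map_sub _ _ Ms, h.aeval_eq_zero, sub_zero,
      ← Ideal.Quotient.eq_zero_iff_mem, key, hθ]
  · rw [← Ideal.Quotient.eq, key, hwθ]

/-- `n` bounds the remaining passes: as `j < 2 ^ j`, the guard fails once `j` reaches `δ + 1`. -/
theorem IsLiftingData.loop (h : IsLiftingData a F z m v Ms y) (δ : ℕ) (n j : ℕ)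
    (hn : δ + 1 ≤ n + j) {S : State k s} (hS : IsCorrectState a z Ms y (2 ^ j) S) :
    ∃ S' N, loop a F z δ j S = some S' ∧ δ + 1 ≤ N ∧ IsCorrectState a z Ms y N S' := by
  induction n generalizing j S with
  | zero =>
    have := Nat.lt_two_pow_self (n := j)
    rw [NewtonLifting.loop, if_neg (by omega)]
    exact ⟨S, 2 ^ j, rfl, by omega, hS⟩
  | succ n ih =>
    rw [NewtonLifting.loop]
    split_ifs with hj
    · obtain ⟨S', hS', hc⟩ := h.loopBody hS
      rw [hS', Option.bind_some]
      exact ih (j + 1) (by omega) hc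
    · exact ⟨S, 2 ^ j, rfl, by omega, hS⟩

theorem IsLiftingData.isCorrectState_initial (h : IsLiftingData a F z m v Ms y) :
    IsCorrectState a z Ms y (2 ^ 0)
      { M := m.map C, V := fun i => if i = z then X else (v i).map C } := by
  have hmon' : m.Monic := h.map_eval ▸ h.monic.map _
  have hmon : (m.map C : k[X][X]).Monic := hmon'.map _
  have hd : (m.map C : k[X][X]).degree = Ms.degree := by
    rw [hmon'.degree_map, ← h.map_eval, h.monic.degree_map]
  refine ⟨(degree_sub_lt_left hd hmon.ne_zero ?_).trans_eq hd, ?_, fun i => ?_⟩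
  · exact hmon.leadingCoeff.trans h.monic.leadingCoeff.symm
  · rw [pow_zero, pow_one, dvd_sub_comm, ← h.map_eval]
    exact dvd_sub_map_map_eval a Ms
  · rw [pow_zero, pow_one]
    dsimp only
    split_ifs with hi
    · rw [hi, aeval_X, sub_self]; exact zero_mem _
    · exact h.coord i hi

/-- Correctness of the Newton lifting algorithm, in terms of the coordinate ring of the curve. -/
theorem IsLiftingData.newtonLifting_eq (h : IsLiftingData a F z m v Ms y)
    (hMs : ∀ i, (Ms.coeff i).natDegree ≤ m.natDegree) (W : Fin s → k[X][X])
    (hWdeg : ∀ i, (W i).degree < Ms.degree)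
    (hWcoeff : ∀ i l, ((W i).coeff l).natDegree ≤ m.natDegree)
    (hW : ∀ i, aeval (y z) (derivative Ms) * y i = aeval (y z) (W i)) :
    newtonLifting a F z m v = some (Ms, W) := by
  have hS0 := h.isCorrectState_initial
  obtain ⟨S, N, hS, hN, hc⟩ := h.loop m.natDegree (m.natDegree + 1) 0 (by omega) hS0
  rw [newtonLifting, hS, Option.map_some]
  have hd : C ((X - C a) ^ (m.natDegree + 1)) ∣ S.M - Ms :=
    (_root_.map_dvd C (pow_dvd_pow _ hN)).trans hc.dvd_sub
  congr 2
  -- Coefficients of degree at most δ are unchanged by truncation at δ + 1, so agreement to that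
  -- precision is equality.
  · rw [← trunc_eq_self a (m.natDegree + 1) Ms fun i => Nat.lt_succ_of_le (hMs i),
      trunc_eq_trunc_iff]
    exact hd
  · funext i
    have hSM := hc.monic h.monic
    rw [← reduce_eq_self (t := m.natDegree + 1) a hSM (lt_of_lt_of_eq (hWdeg i) hc.degree_eq.symm)
      (fun l => Nat.lt_succ_of_le (hWcoeff i l)), reduce_eq_reduce_iff a hSM,
      precisionIdeal_congr a hd, ← h.mem_pow_iff, map_sub _ _ (W i), map_mul, ← hW]
    have h1 : aeval (y z) (S.V i) - y i ∈
        Ideal.span {algebraMap k[X] B (X - C a) ^ (m.natDegree + 1)} :=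
      Ideal.span_singleton_le_span_singleton.2 (pow_dvd_pow _ hN) (hc.coord i)
    -- The derivative is with respect to `T`, so it does not lower the precision in `X`.
    have h2 : aeval (y z) (derivative S.M - derivative Ms) ∈
        Ideal.span {algebraMap k[X] B (X - C a) ^ (m.natDegree + 1)} := by
      obtain ⟨c, hc⟩ := hd
      rw [← derivative_sub, hc, derivative_C_mul, map_mul, aeval_C, map_pow]
      exact Ideal.mul_mem_right _ _ (Ideal.mem_span_singleton_self _)
    rw [map_sub _ (derivative S.M)] at h2
    convert add_mem (Ideal.mul_mem_left _ (aeval (y z) (derivative S.M)) h1)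
      (Ideal.mul_mem_right (y i) _ h2) using 1
    ring

end Loop

/-! ### The Jacobian criterion along the fiber. -/

section Fiber

open MvPolynomial

variable {k : Type*} [Field k] {n r s : ℕ}

theorem zeroLocus_vanishingIdeal_affineClosure (F : Fin r → MvPolynomial (Fin n) k)
    (G : MvPolynomial (Fin n) k) (s : ℕ) :
    zeroLocus (AlgebraicClosure k) (vanishingIdeal k (affineClosure F G s)) =
      affineClosure F G s :=
  zeroLocus_vanishingIdeal_galoisConnection.l_u_l_eq_l _

theorem aeval_eq_zero_of_mem_affineClosure {F : Fin r → MvPolynomial (Fin n) k}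
    {G : MvPolynomial (Fin n) k} {x : Fin n → AlgebraicClosure k} (hx : x ∈ affineClosure F G s)
    {i : Fin r} (hi : i.val < s) : aeval x (F i) = 0 :=
  hx (F i) fun _ hy => hy.1 i hi

/-- On `G ≠ 0` the variety `V_s` is defined by `F_1, …, F_s`. -/
theorem IsReducedRegularSequence.exists_pow_mul_mem {F : Fin r → MvPolynomial (Fin n) k}
    {G : MvPolynomial (Fin n) k} (hFG : IsReducedRegularSequence F G) (hs : 1 ≤ s) (hsr : s ≤ r)
    {f : MvPolynomial (Fin n) k} (hf : f ∈ vanishingIdeal k (affineClosure F G s)) :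
    ∃ N, G ^ N * f ∈ Ideal.span {g | ∃ i : Fin r, i.val < s ∧ g = F i} := by
  set J := Ideal.span {g | ∃ i : Fin r, i.val < s ∧ g = F i} with hJ
  -- By the Nullstellensatz: at a zero of `J` either `G` vanishes, or the point lies in V_s and `f`
  -- vanishes.
  have h1 : G * f ∈ J.radical := by
    rw [← vanishingIdeal_zeroLocus_eq_radical (K := AlgebraicClosure k), mem_vanishingIdeal_iff]
    intro x hx
    by_cases hG : aeval x G = 0
    · rw [map_mul, hG, zero_mul]
    · rw [map_mul, hf x, mul_zero]
      exact zeroLocus_vanishingIdeal_le _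
        ⟨fun i hi => hx _ (Ideal.subset_span ⟨i, hi, rfl⟩), hG⟩
  have hmap : J.map (algebraMap _ (Localization.Away G)) =
      Ideal.span {f : Localization.Away G | ∃ i : Fin r, i.val < s ∧
        f = algebraMap (MvPolynomial (Fin n) k) (Localization.Away G) (F i)} := by
    rw [hJ, Ideal.map_span]
    congr 1
    ext g
    simp only [Set.mem_image, Set.mem_ofPred_eq]
    constructor
    · rintro ⟨_, ⟨i, hi, rfl⟩, rfl⟩; exact ⟨i, hi, rfl⟩
    · rintro ⟨i, hi, rfl⟩; exact ⟨_, ⟨i, hi, rfl⟩, rfl⟩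
  -- Radicality is assumed only after inverting `G`; clearing that denominator produces the power of
  -- `G`.
  have h2 : algebraMap _ (Localization.Away G) (G * f) ∈ J.map (algebraMap _ _) := by
    obtain ⟨N, hN⟩ := h1
    have h3 := hFG.radical s hs hsr
    rw [← hmap] at h3
    refine h3 ⟨N, ?_⟩
    rw [← map_pow]
    exact Ideal.mem_map_of_mem _ hN
  obtain ⟨_, ⟨N, rfl⟩, hN⟩ := (IsLocalization.algebraMap_mem_map_algebraMap_iff
    (Submonoid.powers G) (Localization.Away G) J _).1 h2
  exact ⟨N + 1, by rw [pow_succ, mul_assoc]; exact hN⟩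

theorem depIdx_injective (h : s < n) : Function.Injective (depIdx h : Fin s → Fin n) := by
  intro i j hij
  simp only [depIdx, Fin.mk.injEq] at hij
  exact Fin.ext (by omega)

theorem eq_castLE_or_eq_depIdx (h : s < n) (l : Fin n) :
    (∃ i, l = Fin.castLE (Nat.sub_le n s) i) ∨ ∃ i, l = depIdx h i := by
  by_cases hl : l.val < n - s
  · exact Or.inl ⟨⟨l, hl⟩, rfl⟩
  · refine Or.inr ⟨⟨l.val - (n - s), by omega⟩, Fin.ext ?_⟩
    simp only [depIdx]
    omega

theorem depIdx_ne_castLE (h : s < n) (i : Fin s) (j : Fin (n - s)) :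
    depIdx h i ≠ Fin.castLE (Nat.sub_le n s) j := by
  intro hij
  have := congrArg Fin.val hij
  simp only [depIdx, Fin.val_castLE] at this
  omega

/-- The Jacobian matrix of `F_1, …, F_s` with respect to the last `s` variables. -/
noncomputable def depJacobian (h : s < n) (F : Fin s → MvPolynomial (Fin n) k) :
    Matrix (Fin s) (Fin s) (MvPolynomial (Fin n) k) :=
  Matrix.of fun i j => pderiv (depIdx h j) (F i)

/-- A kernel vector of the Jacobian matrix, extended by zero in the free coordinates, annihilates
the differentials at `x` of all elements of (F_1, …, F_s). A function `f` vanishing on V_s has `G ^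
N * f` in that ideal, and `G` is nonzero at `x`, so the differential of `f` is annihilated too. The
vector is thus tangent to V_s and vertical, hence zero when the projection is unramified. -/
theorem det_depJacobian_ne_zero {F : Fin r → MvPolynomial (Fin n) k}
    {G : MvPolynomial (Fin n) k} (hFG : IsReducedRegularSequence F G) (hs : 1 ≤ s) (hsr : s ≤ r)
    (h : s < n) {x : Fin n → AlgebraicClosure k} (hx : x ∈ affineClosure F G s)
    (hunram : IsUnramifiedAt k s (affineClosure F G s) x) (hG : aeval x G ≠ 0) :
    aeval x (depJacobian h fun i => F (Fin.castLE hsr i)).det ≠ 0 := by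
  rw [AlgHom.map_det]
  intro h0
  obtain ⟨u, hu0, hu⟩ := Matrix.exists_mulVec_eq_zero_iff.2 h0
  set U : Fin n → AlgebraicClosure k := Function.extend (depIdx h) u 0 with hU
  have hUdep : ∀ i, U (depIdx h i) = u i := fun i => (depIdx_injective h).extend_apply _ _ _
  have hUfree : ∀ i, U (Fin.castLE (Nat.sub_le n s) i) = 0 := fun i =>
    Function.extend_apply' _ _ _ fun ⟨j, hj⟩ => depIdx_ne_castLE h j i hj
  have hmul : ∀ f g : MvPolynomial (Fin n) k, ∑ j, aeval x (pderiv j (f * g)) * U j =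
      aeval x f * ∑ j, aeval x (pderiv j g) * U j + aeval x g * ∑ j, aeval x (pderiv j f) * U j := by
    intro f g
    rw [Finset.mul_sum, Finset.mul_sum, ← Finset.sum_add_distrib]
    refine Finset.sum_congr rfl fun j _ => ?_
    simp only [Derivation.leibniz, smul_eq_mul, map_add, map_mul]
    ring
  have hspan : ∀ f ∈ Ideal.span {g | ∃ i : Fin r, i.val < s ∧ g = F i},
      ∑ j, aeval x (pderiv j f) * U j = 0 := by
    intro f hf
    refine Submodule.span_induction (p := fun f _ => ∑ j, aeval x (pderiv j f) * U j = 0)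
      ?_ (by simp) ?_ ?_ hf |>.trans rfl
    · rintro _ ⟨i, hi, rfl⟩
      have h1 := congrFun hu ⟨i, hi⟩
      rw [← Fintype.sum_of_injective (depIdx h) (depIdx_injective h)
        (fun j => aeval x (pderiv (depIdx h j) (F i)) * u j)]
      · exact h1
      · intro l hl
        rcases eq_castLE_or_eq_depIdx h l with ⟨i, rfl⟩ | ⟨i, rfl⟩
        · rw [hUfree, mul_zero]
        · exact absurd ⟨i, rfl⟩ hl
      · intro j; rw [hUdep]
    · intro f g _ _ hf hg
      simp only [map_add, add_mul, Finset.sum_add_distrib, hf, hg, add_zero]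
    · intro c f hf' hf
      rw [smul_eq_mul, hmul, hf, mul_zero, zero_add]
      have h1 : Ideal.span {g | ∃ i : Fin r, i.val < s ∧ g = F i} ≤ vanishingIdeal k {x} := by
        rw [Ideal.span_le]
        rintro _ ⟨i, hi, rfl⟩ y rfl
        exact aeval_eq_zero_of_mem_affineClosure hx hi
      rw [h1 hf' x rfl, zero_mul]
  refine hu0 (funext fun i => ?_)
  have h2 : U = 0 := by
    refine hunram U (fun f hf => ?_) hUfree
    obtain ⟨N, hN⟩ := hFG.exists_pow_mul_mem hs hsr hf
    have h3 := hspan _ hN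
    rw [hmul, hf x hx, zero_mul, add_zero] at h3
    exact (mul_eq_zero.1 h3).resolve_left (by rw [map_pow]; exact pow_ne_zero _ hG)
  rw [← hUdep, h2]; rfl

/-- The ideal generated by the vanishing ideal of `V` and the equations of the fiber over `p`. -/
noncomputable def fiberIdeal (V : Set (Fin n → AlgebraicClosure k)) (p : Fin (n - s) → k) :
    Ideal (MvPolynomial (Fin n) k) :=
  vanishingIdeal k V ⊔
    Ideal.span (Set.range fun i => X (Fin.castLE (Nat.sub_le n s) i) - C (p i))

theorem zeroLocus_fiberIdeal {V : Set (Fin n → AlgebraicClosure k)}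
    (hV : zeroLocus (AlgebraicClosure k) (vanishingIdeal k V) = V) (p : Fin (n - s) → k) :
    zeroLocus (AlgebraicClosure k) (fiberIdeal V p) = fiber V p := by
  ext x
  constructor
  · intro hx
    refine ⟨hV ▸ zeroLocus_anti_mono le_sup_left hx, fun i => ?_⟩
    have := hx _ (Ideal.mem_sup_right (Ideal.subset_span ⟨i, rfl⟩))
    rwa [map_sub, aeval_X, aeval_C, sub_eq_zero] at this
  · rintro ⟨hx, hxp⟩
    have : fiberIdeal V p ≤ vanishingIdeal k {x} := by
      refine sup_le (vanishingIdeal_anti_mono (Set.singleton_subset_iff.2 hx)) ?_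
      rw [Ideal.span_le]
      rintro _ ⟨i, rfl⟩
      rw [SetLike.mem_coe, mem_vanishingIdeal_singleton_iff, map_sub, aeval_X, aeval_C, hxp, sub_self]
    exact fun f hf => this hf x rfl

theorem derivation_algHom_apply {σ A M : Type*} [Fintype σ] [CommRing A] [Algebra k A]
    [AddCommGroup M] [Module A M] [Module k M] [IsScalarTower k A M] (D : Derivation k A M)
    (φ : MvPolynomial σ k →ₐ[k] A) (f : MvPolynomial σ k) :
    D (φ f) = ∑ l, φ (pderiv l f) • D (φ (X l)) := by
  classical
  induction f using MvPolynomial.induction_on with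
  | C c =>
    have : φ (C c) = algebraMap k A c := φ.commutes c
    simp [this]
  | add p q hp hq => simp only [map_add, hp, hq, add_smul, Finset.sum_add_distrib]
  | mul_X p j hp =>
    simp only [map_mul, Derivation.leibniz, hp, pderiv_X, smul_eq_mul, map_add, add_smul,
      Finset.sum_add_distrib, mul_smul, ← Finset.smul_sum]
    congr 1
    rw [Finset.sum_eq_single j] <;> simp +contextual [eq_comm]

/-- A quotient of the polynomial ring is unramified if the first `n - s` coordinates are constant
and the Jacobian determinant of `s` relations in the last `s` variables is invertible. -/
theorem formallyUnramified_of_isUnit_det (h : s < n) {A : Type*} [CommRing A] [Algebra k A]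
    {φ : MvPolynomial (Fin n) k →ₐ[k] A} (hφ : Function.Surjective φ) {p : Fin (n - s) → k}
    (hp : ∀ i, φ (X (Fin.castLE (Nat.sub_le n s) i)) = algebraMap k A (p i))
    {F : Fin s → MvPolynomial (Fin n) k} (hF : ∀ i, φ (F i) = 0)
    (hdet : IsUnit (φ (depJacobian h F).det)) : Algebra.FormallyUnramified k A := by
  have hfree : ∀ i, KaehlerDifferential.D k A (φ (X (Fin.castLE (Nat.sub_le n s) i))) = 0 :=
    fun i => by rw [hp, Derivation.map_algebraMap]
  have hrel : ∀ i, ∑ j, φ (depJacobian h F i j) • KaehlerDifferential.D k A (φ (X (depIdx h j))) =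
      0 := by
    intro i
    have h1 := derivation_algHom_apply (KaehlerDifferential.D k A) φ (F i)
    rw [hF, map_zero] at h1
    rw [h1]
    refine Fintype.sum_of_injective (depIdx h) (depIdx_injective h) _ _ (fun l hl => ?_)
      fun j => rfl
    rcases eq_castLE_or_eq_depIdx h l with ⟨i, rfl⟩ | ⟨i, rfl⟩
    · rw [hfree, smul_zero]
    · exact absurd ⟨i, rfl⟩ hl
  have hdep : ∀ j, KaehlerDifferential.D k A (φ (X (depIdx h j))) = 0 := by
    intro j
    -- Cramer's rule for the linear relations `hrel` between the differentials of the last `s`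
    -- coordinates.
    have h1 : φ (depJacobian h F).det • KaehlerDifferential.D k A (φ (X (depIdx h j))) = 0 := by
      have h2 : ∀ l, ∑ i, φ ((depJacobian h F).adjugate j i) * φ (depJacobian h F i l) =
          if j = l then φ (depJacobian h F).det else 0 := by
        intro l
        have h3 := congrFun (congrFun (Matrix.adjugate_mul (depJacobian h F)) j) l
        rw [Matrix.mul_apply] at h3
        have h4 := congrArg φ h3
        simp only [map_sum, map_mul, Matrix.smul_apply, Matrix.one_apply, smul_eq_mul, mul_ite,
          mul_one, mul_zero] at h4
        rw [h4]; split_ifs <;> simp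
      have h5 : ∑ i, φ ((depJacobian h F).adjugate j i) • ∑ l, φ (depJacobian h F i l) •
          KaehlerDifferential.D k A (φ (X (depIdx h l))) = 0 := by
        simp only [hrel, smul_zero, Finset.sum_const_zero]
      simp only [Finset.smul_sum, smul_smul] at h5
      rw [Finset.sum_comm] at h5
      simp only [← Finset.sum_smul, h2, ite_smul, zero_smul] at h5
      simpa using h5
    exact (hdet.smul_eq_zero).1 h1
  have hD : ∀ b, KaehlerDifferential.D k A b = 0 := by
    intro b
    obtain ⟨f, rfl⟩ := hφ b
    rw [derivation_algHom_apply]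
    refine Finset.sum_eq_zero fun l _ => ?_
    rcases eq_castLE_or_eq_depIdx h l with ⟨i, rfl⟩ | ⟨i, rfl⟩
    · rw [hfree, smul_zero]
    · rw [hdep, smul_zero]
  refine ⟨⟨fun a b => ?_⟩⟩
  have htop : (⊤ : Submodule A (KaehlerDifferential k A)) = ⊥ := by
    rw [← KaehlerDifferential.span_range_derivation, Submodule.span_eq_bot]
    rintro _ ⟨b, rfl⟩
    exact hD b
  have hz : ∀ c : KaehlerDifferential k A, c = 0 := fun c => by
    rw [← Submodule.mem_bot A, ← htop]; trivial
  rw [hz a, hz b]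

end Fiber

/-! ### Reducedness of the fiber and its minimal polynomial. -/

section FiberIdeal

open MvPolynomial

variable {k : Type*} [Field k] {n r s : ℕ}

/-- The ideal `I + (f)` has no zeros over the algebraic closure, so it contains 1 by the
Nullstellensatz. -/
theorem isUnit_mk_of_aeval_ne_zero {I : Ideal (MvPolynomial (Fin n) k)}
    {f : MvPolynomial (Fin n) k}
    (h : ∀ x ∈ zeroLocus (AlgebraicClosure k) I, aeval x f ≠ 0) :
    IsUnit (Ideal.Quotient.mk I f) := by
  have h1 : zeroLocus (AlgebraicClosure k) (I ⊔ Ideal.span {f}) = ∅ := by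
    rw [Set.eq_empty_iff_forall_notMem]
    intro x hx
    exact h x (zeroLocus_anti_mono le_sup_left hx)
      (hx f (Ideal.mem_sup_right (Ideal.mem_span_singleton_self f)))
  have h2 := vanishingIdeal_zeroLocus_eq_radical (K := AlgebraicClosure k) (I ⊔ Ideal.span {f})
  rw [h1, vanishingIdeal_empty, eq_comm, Ideal.radical_eq_top] at h2
  obtain ⟨a, ha, b, hb, hab⟩ := Submodule.mem_sup.1 ((Ideal.eq_top_iff_one _).1 h2)
  obtain ⟨c, rfl⟩ := Ideal.mem_span_singleton.1 hb
  refine IsUnit.of_mul_eq_one (Ideal.Quotient.mk I c) ?_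
  rw [← map_mul, ← map_one (Ideal.Quotient.mk I), Ideal.Quotient.eq, ← hab]
  convert neg_mem ha using 1
  ring

/-- An unramified fiber contained in `G ≠ 0` is reduced. -/
theorem fiberIdeal_eq_vanishingIdeal {F : Fin r → MvPolynomial (Fin n) k}
    {G : MvPolynomial (Fin n) k} (hFG : IsReducedRegularSequence F G) (hs : 1 ≤ s) (hsr : s ≤ r)
    (h : s < n) {p : Fin (n - s) → k}
    (hunram : ∀ x ∈ fiber (affineClosure F G s) p, IsUnramifiedAt k s (affineClosure F G s) x)
    (hG : ∀ x ∈ fiber (affineClosure F G s) p, aeval x G ≠ 0) :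
    fiberIdeal (affineClosure F G s) p = vanishingIdeal k (fiber (affineClosure F G s) p) := by
  have hz := zeroLocus_fiberIdeal (zeroLocus_vanishingIdeal_affineClosure F G s) p
  have hdet : IsUnit (Ideal.Quotient.mk (fiberIdeal (affineClosure F G s) p)
      (depJacobian h fun i => F (Fin.castLE hsr i)).det) := by
    refine isUnit_mk_of_aeval_ne_zero fun x hx => ?_
    rw [hz] at hx
    exact det_depJacobian_ne_zero hFG hs hsr h hx.1 (hunram x hx) (hG x hx)
  have hle : vanishingIdeal k (affineClosure F G s) ≤ fiberIdeal (affineClosure F G s) p :=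
    le_sup_left
  have := formallyUnramified_of_isUnit_det h
    (φ := Ideal.Quotient.mkₐ k (fiberIdeal (affineClosure F G s) p))
    (Ideal.Quotient.mkₐ_surjective _ _) (p := p) (F := fun i => F (Fin.castLE hsr i))
    (fun i => by
      rw [Ideal.Quotient.mkₐ_eq_mk, ← Ideal.Quotient.mk_algebraMap, Ideal.Quotient.eq]
      exact Ideal.mem_sup_right (Ideal.subset_span ⟨i, rfl⟩))
    (fun i => Ideal.Quotient.eq_zero_iff_mem.2 (hle fun x hx =>
      aeval_eq_zero_of_mem_affineClosure hx i.2)) hdet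
  have hft : Algebra.FiniteType k (MvPolynomial (Fin n) k ⧸ fiberIdeal (affineClosure F G s) p) :=
    inferInstance
  -- An unramified algebra of finite type over a field is reduced, so the fiber ideal is radical.
  have hred := Algebra.FormallyUnramified.isReduced_of_field k
    (MvPolynomial (Fin n) k ⧸ fiberIdeal (affineClosure F G s) p)
  rw [← hz, vanishingIdeal_zeroLocus_eq_radical]
  exact ((Ideal.isRadical_iff_quotient_reduced _).2 hred).radical.symm

/-- Multiply the integral equations found modulo each of the finitely many minimal primes: the value
of the product lies in every minimal prime, hence in the radical ideal `I`. -/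
theorem isIntegral_of_isFiniteOnComponents {R A : Type*} [CommRing R] [CommRing A]
    [IsNoetherianRing A] {f : R →+* A} {I : Ideal A} (hI : I.IsRadical)
    (h : IsFiniteOnComponents f I) : ((Ideal.Quotient.mk I).comp f).IsIntegral := by
  intro a
  obtain ⟨a, rfl⟩ := Ideal.Quotient.mk_surjective a
  have hfin := I.finite_minimalPrimes_of_isNoetherianRing A
  have h1 : ∀ P ∈ I.minimalPrimes, ∃ q : Polynomial R, q.Monic ∧ q.eval₂ f a ∈ P := by
    intro P hP
    obtain ⟨q, hq, hq0⟩ := (h P hP).2 (Ideal.Quotient.mk P a)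
    refine ⟨q, hq, ?_⟩
    rwa [← Polynomial.hom_eval₂, Ideal.Quotient.eq_zero_iff_mem] at hq0
  choose! q hq hqP using h1
  refine ⟨∏ P ∈ hfin.toFinset, q P, Polynomial.monic_prod_of_monic _ _ fun P hP =>
    hq P (hfin.mem_toFinset.1 hP), ?_⟩
  rw [← Polynomial.hom_eval₂, Ideal.Quotient.eq_zero_iff_mem]
  refine hI (Ideal.sInf_minimalPrimes (I := I) ▸ (Ideal.mem_sInf.2 fun {P} hP => ?_))
  rw [Polynomial.eval₂_finsetProd]
  have := hfin.mem_toFinset.2 hP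
  exact Ideal.mem_of_dvd _ (Finset.dvd_prod_of_mem _ this) (hqP P hP)

theorem isRadical_vanishingIdeal (V : Set (Fin n → AlgebraicClosure k)) :
    (vanishingIdeal k V).IsRadical := by
  rintro f ⟨N, hN⟩ x hx
  have := hN x hx
  rw [map_pow] at this
  exact eq_zero_of_pow_eq_zero this

theorem finrank_fractionRing_tensorProduct_le {R A : Type*} [CommRing R] [IsDomain R]
    [CommRing A] [Algebra R A] {d : ℕ} (w : Fin d → A) {c : R} (hc : c ≠ 0)
    (h : ∀ a, c • a ∈ Submodule.span R (Set.range w)) :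
    Module.finrank (FractionRing R) (TensorProduct R (FractionRing R) A) ≤ d := by
  have htop : Submodule.span (FractionRing R)
      (Set.range fun i => (1 : FractionRing R) ⊗ₜ[R] w i) = ⊤ := by
    rw [eq_top_iff]
    rintro t -
    induction t using TensorProduct.induction_on with
    | zero => exact zero_mem _
    | add x y hx hy => exact add_mem hx hy
    | tmul x a =>
      have h1 : ∀ b ∈ Submodule.span R (Set.range w), (1 : FractionRing R) ⊗ₜ[R] b ∈
          Submodule.span (FractionRing R) (Set.range fun i => (1 : FractionRing R) ⊗ₜ[R] w i) := by
        intro b hb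
        induction hb using Submodule.span_induction with
        | mem b hb => obtain ⟨i, rfl⟩ := hb; exact Submodule.subset_span ⟨i, rfl⟩
        | zero => rw [TensorProduct.tmul_zero]; exact zero_mem _
        | add b b' _ _ hb hb' => rw [TensorProduct.tmul_add]; exact add_mem hb hb'
        | smul e b _ hb =>
          rw [← TensorProduct.smul_tmul, ← mul_one (e • (1 : FractionRing R)), ← smul_eq_mul,
            ← TensorProduct.smul_tmul']
          exact Submodule.smul_mem _ _ hb
      have hc' : algebraMap R (FractionRing R) c ≠ 0 :=
        fun h0 => hc (IsFractionRing.injective R (FractionRing R) (by rw [h0, map_zero]))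
      have h2 : x ⊗ₜ[R] a = (x * (algebraMap R (FractionRing R) c)⁻¹) •
          ((1 : FractionRing R) ⊗ₜ[R] (c • a)) := by
        rw [← TensorProduct.smul_tmul, TensorProduct.smul_tmul', smul_eq_mul, Algebra.smul_def,
          mul_one, mul_assoc, inv_mul_cancel₀ hc', mul_one]
      rw [h2]
      exact Submodule.smul_mem _ _ (h1 _ (h a))
  have := finrank_le_of_span_eq_top htop
  rwa [Fintype.card_fin] at this

/-- If every coordinate is a polynomial in `X_z` on the fiber, then so is every polynomial. -/
theorem exists_aeval_X_sub_mem {I : Ideal (MvPolynomial (Fin n) k)} {z : Fin n}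
    {τ : Fin n → Polynomial k} (hτ : ∀ l, X l - Polynomial.aeval (X z) (τ l) ∈ I)
    (f : MvPolynomial (Fin n) k) :
    f - Polynomial.aeval (X z) (aeval τ f : Polynomial k) ∈ I := by
  rw [← Ideal.Quotient.eq]
  have : (Ideal.Quotient.mkₐ k I) =
      ((Ideal.Quotient.mkₐ k I).comp (Polynomial.aeval (X z))).comp (aeval τ) := by
    ext l
    simp only [AlgHom.comp_apply, aeval_X]
    exact Ideal.Quotient.eq.2 (hτ l)
  exact congrArg (fun φ => φ f) this

/-- Nakayama: if the `w i` span `A` modulo `P`, then some `c` in `1 + P` multiplies all of `A` into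
their span. As `P` is proper, `c ≠ 0`, so the `w i` span after passing to the fraction field. -/
theorem morphismDegree_le {R A : Type*} [CommRing R] [IsDomain R] [CommRing A] {f : R →+* A}
    (hf : f.Finite) {P : Ideal R} (hP : P ≠ ⊤) {d : ℕ} (w : Fin d → A)
    (h : ∀ a, ∃ c : Fin d → R, a - ∑ i, f (c i) * w i ∈ P.map f) : morphismDegree f ≤ d := by
  let _ : Algebra R A := f.toAlgebra
  have : Module.Finite R A := hf
  have hsup : (⊤ : Submodule R A) ≤ Submodule.span R (Set.range w) ⊔ P • ⊤ := by
    rintro a -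
    obtain ⟨c, hc⟩ := h a
    rw [← sub_add_cancel a (∑ i, f (c i) * w i), add_comm]
    refine Submodule.add_mem_sup (sum_mem fun i _ => ?_) ?_
    · exact Submodule.smul_mem _ (c i) (Submodule.subset_span ⟨i, rfl⟩)
    · rw [Ideal.smul_top_eq_map]
      exact hc
  obtain ⟨c, hc, hcN⟩ := Submodule.exists_sub_one_mem_and_smul_le_of_fg_of_le_sup
    (I := P) (Module.Finite.fg_top (R := R) (M := A)) le_rfl hsup
  refine finrank_fractionRing_tensorProduct_le w (c := c) ?_ fun a => ?_
  · rintro rfl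
    rw [zero_sub, neg_mem_iff] at hc
    exact hP ((Ideal.eq_top_iff_one _).2 hc)
  · exact hcN (Submodule.smul_mem_pointwise_smul a c ⊤ trivial)

theorem finite_mk_comp_freeVars {V : Set (Fin n → AlgebraicClosure k)}
    (hfin : IsFiniteOnComponents (freeVars k n s) (vanishingIdeal k V)) :
    ((Ideal.Quotient.mk (vanishingIdeal k V)).comp (freeVars k n s)).Finite := by
  refine (isIntegral_of_isFiniteOnComponents (isRadical_vanishingIdeal V) hfin).to_finite ?_
  refine RingHom.FiniteType.of_comp_finiteType (f := algebraMap k _) ?_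
  have h2 : ((Ideal.Quotient.mk (vanishingIdeal k V)).comp (freeVars k n s)).comp
      (algebraMap k (MvPolynomial (Fin (n - s)) k)) =
      algebraMap k (MvPolynomial (Fin n) k ⧸ vanishingIdeal k V) := by
    ext c
    simp only [RingHom.comp_apply, freeVars]
    rw [AlgHom.toRingHom_eq_coe, RingHom.coe_coe, AlgHom.commutes]
    rfl
  rw [h2]
  exact RingHom.finiteType_algebraMap.2 inferInstance

/-- Puts the fiber in the form required by `morphismDegree_le`: its ideal is extended from the
kernel of evaluation at `p` on the base. -/
theorem map_mk_fiberIdeal (V : Set (Fin n → AlgebraicClosure k)) (p : Fin (n - s) → k) :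
    (fiberIdeal V p).map (Ideal.Quotient.mk (vanishingIdeal k V)) =
      (RingHom.ker (MvPolynomial.eval p)).map
        ((Ideal.Quotient.mk (vanishingIdeal k V)).comp (freeVars k n s)) := by
  have h1 : (freeVars k n s : _ →+* _) '' (Set.range fun i => (X i - C (p i))) =
      Set.range fun i => X (Fin.castLE (Nat.sub_le n s) i) - C (p i) := by
    rw [← Set.range_comp]
    congr 1
    funext i
    simp [freeVars]
  rw [fiberIdeal, Ideal.map_sup, Ideal.map_quotient_self, bot_sup_eq, ← h1, ← Ideal.map_span,
    Ideal.map_map]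
  congr 1
  refine le_antisymm (Ideal.span_le.2 ?_) fun f hf => ?_
  · rintro _ ⟨i, rfl⟩
    simp [RingHom.mem_ker]
  · rw [RingHom.mem_ker] at hf
    rw [← Ideal.Quotient.eq_zero_iff_mem]
    have : Ideal.Quotient.mkₐ k (Ideal.span (Set.range fun i => (X i - C (p i) :
        MvPolynomial (Fin (n - s)) k))) = (Algebra.ofId k _).comp (aeval p) := by
      ext i
      simp only [AlgHom.comp_apply, aeval_X]
      exact Ideal.Quotient.eq.2 (Ideal.subset_span ⟨i, rfl⟩)
    have h3 := congrArg (fun φ => φ f) this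
    have h4 : (aeval p f : k) = 0 := by rw [← hf, ← coe_aeval_eq_eval]; rfl
    rw [AlgHom.comp_apply, h4, map_zero] at h3
    exact h3

/-- Division by `q` shows that the powers of `X z` of exponent below `q.natDegree` span the fiber
ring, so they bound the generic rank. -/
theorem morphismDegree_le_natDegree {V : Set (Fin n → AlgebraicClosure k)}
    (hfin : IsFiniteOnComponents (freeVars k n s) (vanishingIdeal k V)) {p : Fin (n - s) → k}
    {z : Fin n} {τ : Fin n → Polynomial k}
    (hτ : ∀ l, X l - Polynomial.aeval (X z) (τ l) ∈ fiberIdeal V p)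
    {q : Polynomial k} (hq : q ≠ 0) (hqI : Polynomial.aeval (X z) q ∈ fiberIdeal V p) :
    morphismDegree ((Ideal.Quotient.mk (vanishingIdeal k V)).comp (freeVars k n s)) ≤
      q.natDegree := by
  refine morphismDegree_le (finite_mk_comp_freeVars hfin) (P := RingHom.ker (MvPolynomial.eval p))
    (RingHom.ker_ne_top _) (fun i => Ideal.Quotient.mk _ (X z ^ i.val)) fun a => ?_
  obtain ⟨f, rfl⟩ := Ideal.Quotient.mk_surjective a
  obtain ⟨g, hg⟩ : ∃ g, g = (aeval τ f : Polynomial k) % q := ⟨_, rfl⟩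
  have h1 : f - Polynomial.aeval (X z) g ∈ fiberIdeal V p := by
    have h2 := exists_aeval_X_sub_mem hτ f
    have h3 : Polynomial.aeval (X z) (q * (aeval τ f / q)) ∈ fiberIdeal V p := by
      rw [map_mul]
      exact Ideal.mul_mem_right _ _ hqI
    convert add_mem h2 h3 using 1
    have h4 := congrArg (Polynomial.aeval (X z : MvPolynomial (Fin n) k))
      (EuclideanDomain.mod_add_div (aeval τ f : Polynomial k) q)
    rw [map_add, ← hg] at h4
    linear_combination -h4
  refine ⟨fun i => C (g.coeff i), ?_⟩
  rw [← map_mk_fiberIdeal]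
  have h2 : ∑ i : Fin q.natDegree, (Ideal.Quotient.mk (vanishingIdeal k V)).comp (freeVars k n s)
      (C (g.coeff i)) * Ideal.Quotient.mk _ (X z ^ i.val) =
      Ideal.Quotient.mk _ (Polynomial.aeval (X z) g) := by
    by_cases hg0 : g = 0
    · simp [hg0]
    rw [Polynomial.aeval_eq_sum_range' (n := q.natDegree), map_sum, Finset.sum_range]
    · refine Finset.sum_congr rfl fun i _ => ?_
      rw [RingHom.comp_apply, ← map_mul, freeVars, smul_eq_C_mul]
      simp
    · exact Polynomial.natDegree_lt_natDegree hg0 (hg ▸ EuclideanDomain.mod_lt _ hq)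
  rw [h2, ← map_sub]
  exact Ideal.mem_map_of_mem _ h1

/-- Consequences of the description of a reduced fiber of the expected degree by `m` and `τ`. -/
theorem separable_and_dvd [PerfectField k] {V : Set (Fin n → AlgebraicClosure k)}
    (hfin : IsFiniteOnComponents (freeVars k n s) (vanishingIdeal k V)) {p : Fin (n - s) → k}
    {z : Fin n} {τ : Fin n → Polynomial k}
    (hτ : ∀ l, X l - Polynomial.aeval (X z) (τ l) ∈ fiberIdeal V p)
    {m : Polynomial k} (hm : m.Monic)
    (hdeg : morphismDegree ((Ideal.Quotient.mk (vanishingIdeal k V)).comp (freeVars k n s)) =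
      m.natDegree)
    (hI : ∀ q : Polynomial k, Polynomial.aeval (X z) q ∈ fiberIdeal V p ↔
      ∀ t : AlgebraicClosure k, Polynomial.aeval t m = 0 → Polynomial.aeval t q = 0) :
    IsCoprime m (Polynomial.derivative m) ∧
      ∀ q : Polynomial k, Polynomial.aeval (X z) q ∈ fiberIdeal V p → m ∣ q := by
  have hle : ∀ q : Polynomial k, q ≠ 0 → Polynomial.aeval (X z) q ∈ fiberIdeal V p →
      m.natDegree ≤ q.natDegree := fun q hq hqI => hdeg ▸ morphismDegree_le_natDegree hfin hτ hq hqI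
  constructor
  -- If `m = x * x * c`, then `x * c` vanishes at all roots of `m`, so it cannot have smaller degree
  -- and `x` is constant.
  · refine PerfectField.separable_iff_squarefree.2 fun x ⟨c, hc⟩ => ?_
    have hne : x * x * c ≠ 0 := hc ▸ hm.ne_zero
    have hx : x ≠ 0 := fun h => hne (by rw [h]; ring)
    have hxc : x * c ≠ 0 := fun h => hne (by rw [mul_assoc, h, mul_zero])
    have h1 := hle (x * c) hxc ((hI _).2 fun t ht => by
      rw [hc, map_mul, map_mul, mul_assoc, mul_eq_zero] at ht
      rw [map_mul]
      rcases ht with ht | ht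
      · rw [ht, zero_mul]
      · exact ht)
    rw [hc, mul_assoc, Polynomial.natDegree_mul hx hxc] at h1
    exact Polynomial.isUnit_iff_degree_eq_zero.2
      (by rw [Polynomial.degree_eq_natDegree hx]; exact_mod_cast (by omega : x.natDegree = 0))
  · intro q hq
    by_contra hmq
    -- The remainder would also vanish at the roots of `m`, with degree below the lower bound `hle`.
    have h0 : q % m ≠ 0 := fun h => hmq (EuclideanDomain.mod_eq_zero.1 h)
    have h1 := hle (q % m) h0 ((hI _).2 fun t ht => by
      have h2 := (hI q).1 hq t ht
      rw [← EuclideanDomain.mod_add_div q m, map_add, map_mul, ht, zero_mul, add_zero] at h2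
      exact h2)
    exact absurd (Polynomial.natDegree_lt_natDegree h0 (EuclideanDomain.mod_lt _ hm.ne_zero))
      (not_lt.2 h1)

end FiberIdeal

/-! ### Going-down, dimension, and specialization to the curve. -/

section Curve

open MvPolynomial

variable {k : Type*} [Field k] {n r s : ℕ}

/-- Going-down for the integral extension of the normal domain `R` by the domain `A ⧸ P`, restated
for primes of `A` and a map `f`. -/
theorem exists_isPrime_le_comap_eq {R A : Type*} [CommRing R] [IsDomain R]
    [IsIntegrallyClosed R] [CommRing A] {f : R →+* A} {P : Ideal A} [P.IsPrime]
    (hinj : Function.Injective ((Ideal.Quotient.mk P).comp f))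
    (hint : ((Ideal.Quotient.mk P).comp f).IsIntegral) {Q : Ideal A} [Q.IsPrime] (hPQ : P ≤ Q)
    {p : Ideal R} [p.IsPrime] (hp : p ≤ Q.comap f) :
    ∃ Q' : Ideal A, Q'.IsPrime ∧ P ≤ Q' ∧ Q' ≤ Q ∧ Q'.comap f = p := by
  let _ : Algebra R (A ⧸ P) := ((Ideal.Quotient.mk P).comp f).toAlgebra
  have : FaithfulSMul R (A ⧸ P) := (faithfulSMul_iff_algebraMap_injective R (A ⧸ P)).2 hinj
  have : Algebra.IsIntegral R (A ⧸ P) := ⟨hint⟩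
  have hcomap : (Q.map (Ideal.Quotient.mk P)).comap (Ideal.Quotient.mk P) = Q := by
    rw [Ideal.comap_map_of_surjective _ Ideal.Quotient.mk_surjective,
      ← RingHom.ker_eq_comap_bot, Ideal.mk_ker, sup_eq_left.2 hPQ]
  have hQ : (Q.map (Ideal.Quotient.mk P)).IsPrime :=
    Ideal.map_isPrime_of_surjective Ideal.Quotient.mk_surjective (by rwa [Ideal.mk_ker])
  have hunder : (Q.map (Ideal.Quotient.mk P)).under R = Q.comap f := by
    conv_rhs => rw [← hcomap]
    rfl
  obtain ⟨Q', hQ'Q, hQ', hQ'p⟩ := Ideal.exists_ideal_le_liesOver_of_le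
    (p := p) (q := (Q.map (Ideal.Quotient.mk P)).under R) (Q.map (Ideal.Quotient.mk P))
    (hunder ▸ hp)
  refine ⟨Q'.comap (Ideal.Quotient.mk P), Ideal.comap_isPrime _ _, ?_,
    (Ideal.comap_mono hQ'Q).trans_eq hcomap, ?_⟩
  · conv_lhs => rw [← Ideal.mk_ker (I := P)]
    exact Ideal.ker_le_comap _
  · exact hQ'p.over.symm

/-- Incomparability shows that contraction of primes is strictly monotone, giving `≤`. Conversely, a
chain in `R` is lifted by lying-over at its top and going-down below it. -/
theorem ringKrullDim_quotient_eq {R A : Type*} [CommRing R] [IsDomain R]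
    [IsIntegrallyClosed R] [CommRing A] {f : R →+* A} {P : Ideal A} [P.IsPrime]
    (hinj : Function.Injective ((Ideal.Quotient.mk P).comp f))
    (hint : ((Ideal.Quotient.mk P).comp f).IsIntegral) :
    ringKrullDim (A ⧸ P) = ringKrullDim R := by
  let _ : Algebra R (A ⧸ P) := ((Ideal.Quotient.mk P).comp f).toAlgebra
  have : FaithfulSMul R (A ⧸ P) := (faithfulSMul_iff_algebraMap_injective R (A ⧸ P)).2 hinj
  have : Algebra.IsIntegral R (A ⧸ P) := ⟨hint⟩
  refine le_antisymm ?_ ?_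
  · refine Order.krullDim_le_of_strictMono (PrimeSpectrum.comap (algebraMap R (A ⧸ P))) ?_
    intro I J hIJ
    refine lt_of_le_of_ne (Ideal.comap_mono hIJ.le) fun he => ?_
    have h1 : I.asIdeal < J.asIdeal := hIJ
    obtain ⟨x, hxJ, hxI⟩ := SetLike.exists_of_lt h1
    have := Ideal.comap_lt_comap_of_integral_mem_sdiff (R := R) h1.le ⟨hxJ, hxI⟩
      (Algebra.IsIntegral.isIntegral x)
    exact this.ne (congrArg PrimeSpectrum.asIdeal he)
  · refine iSup_le fun l => ?_
    obtain ⟨Q, hQ, hQl⟩ : ∃ Q : Ideal (A ⧸ P), Q.IsPrime ∧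
        Q.comap (algebraMap R (A ⧸ P)) = l.last.asIdeal := by
      obtain ⟨Q, -, hQ, h⟩ := Ideal.exists_ideal_over_prime_of_isIntegral l.last.asIdeal
        (⊥ : Ideal (A ⧸ P)) (by
          rw [← RingHom.ker_eq_comap_bot, (RingHom.injective_iff_ker_eq_bot _).1
            (FaithfulSMul.algebraMap_injective R (A ⧸ P))]
          exact bot_le)
      exact ⟨Q, hQ, h⟩
    have : Q.LiesOver l.last.asIdeal := ⟨hQl.symm⟩
    obtain ⟨L, hL, -⟩ := Ideal.exists_ltSeries_of_hasGoingDown l Q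
    exact le_iSup_of_le L (by rw [hL])

/-- The restriction of the free variables to the line through `p` in the direction `X_{n-s}`. -/
noncomputable def lineHom (p : Fin (n - s) → k) :
    MvPolynomial (Fin (n - s)) k →ₐ[k] Polynomial k :=
  aeval fun i => if i.val < n - s - 1 then Polynomial.C (p i) else Polynomial.X

theorem specialize_freeVars (p : Fin (n - s) → k) (c : MvPolynomial (Fin (n - s)) k) :
    specialize p (freeVars k n s c) = C (lineHom p c) := by
  have : (specialize p).comp (rename (Fin.castLE (Nat.sub_le n s))) =
      (IsScalarTower.toAlgHom k (Polynomial k) (MvPolynomial (Fin s) (Polynomial k))).comp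
        (lineHom p) := by
    ext1 i
    simp only [AlgHom.comp_apply, rename_X, specialize, lineHom, aeval_X]
    rw [dif_pos (by exact i.2)]
    simp only [Fin.val_castLE, IsScalarTower.coe_toAlgHom', algebraMap_eq]
    split_ifs <;> rfl
  exact congrArg (fun φ => φ c) this

theorem specialize_X_depIdx (h : s < n) (p : Fin (n - s) → k) (i : Fin s) :
    specialize p (X (depIdx h i)) = X i := by
  rw [specialize, aeval_X, dif_neg (by simp [depIdx])]
  congr 1
  exact Fin.ext (by simp [depIdx])

theorem specialize_X_paramIdx (h : s < n) (p : Fin (n - s) → k) :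
    specialize p (X (paramIdx h)) = C Polynomial.X := by
  rw [specialize, aeval_X, dif_pos (by simp only [paramIdx]; omega),
    if_neg (by simp [paramIdx])]

theorem specialize_aeval_X_paramIdx (h : s < n) (p : Fin (n - s) → k) (c : Polynomial k) :
    specialize p (Polynomial.aeval (X (paramIdx h)) c) = C c := by
  rw [← Polynomial.aeval_algHom_apply, specialize_X_paramIdx]
  have : Polynomial.aeval (C Polynomial.X : MvPolynomial (Fin s) (Polynomial k)) =
      IsScalarTower.toAlgHom k (Polynomial k) (MvPolynomial (Fin s) (Polynomial k)) := by
    ext; simp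
  rw [this]
  rfl

theorem specialize_surjective (h : s < n) (p : Fin (n - s) → k) :
    Function.Surjective (specialize p : MvPolynomial (Fin n) k →ₐ[k] _) := by
  intro g
  rw [← AlgHom.mem_range]
  induction g using MvPolynomial.induction_on with
  | C c => exact ⟨_, specialize_aeval_X_paramIdx h p c⟩
  | add f g hf hg => exact add_mem hf hg
  | mul_X f i hf => exact mul_mem hf ⟨_, specialize_X_depIdx h p i⟩

theorem evalCurve_specialize (h : s < n) {V : Set (Fin n → AlgebraicClosure k)}
    {p : Fin (n - s) → k} {x : Fin n → AlgebraicClosure k} (hx : x ∈ liftingCurve V p)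
    (f : MvPolynomial (Fin n) k) : evalCurve h x (specialize p f) = aeval x f := by
  induction f using MvPolynomial.induction_on with
  | C c =>
    have h1 : specialize (s := s) p (C c : MvPolynomial (Fin n) k) = C (Polynomial.C c) :=
      (specialize p).commutes c
    rw [h1, evalCurve, coe_eval₂Hom, eval₂_C]
    simp
  | add f g hf hg => rw [map_add, map_add, map_add, hf, hg]
  | mul_X f l hf =>
    rw [map_mul, map_mul, map_mul, hf, aeval_X]
    congr 1
    rcases eq_castLE_or_eq_depIdx h l with ⟨i, rfl⟩ | ⟨i, rfl⟩
    · by_cases hi : i.val < n - s - 1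
      · rw [specialize, aeval_X, dif_pos (by exact i.2), if_pos (by exact hi), hx.2 i hi, evalCurve,
          coe_eval₂Hom, eval₂_C]
        simp
      · have : Fin.castLE (Nat.sub_le n s) i = paramIdx h :=
          Fin.ext (by simp only [Fin.val_castLE, paramIdx]; omega)
        rw [this, specialize_X_paramIdx, evalCurve, coe_eval₂Hom, eval₂_C]
        simp
    · rw [specialize_X_depIdx, evalCurve, coe_eval₂Hom, eval₂_X]

theorem specialize_mem_curveIdeal_iff (h : s < n) {V : Set (Fin n → AlgebraicClosure k)}
    {p : Fin (n - s) → k} {f : MvPolynomial (Fin n) k} :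
    specialize p f ∈ curveIdeal h (liftingCurve V p) ↔ ∀ x ∈ liftingCurve V p, aeval x f = 0 := by
  simp only [curveIdeal, Submodule.mem_iInf, RingHom.mem_ker]
  exact forall₂_congr fun x hx => by rw [evalCurve_specialize h hx]

theorem pderiv_specialize (h : s < n) (p : Fin (n - s) → k) (j : Fin s)
    (f : MvPolynomial (Fin n) k) :
    pderiv j (specialize p f) = specialize p (pderiv (depIdx h j) f) := by
  classical
  induction f using MvPolynomial.induction_on with
  | C c =>
    have h1 : specialize (s := s) p (C c : MvPolynomial (Fin n) k) = C (Polynomial.C c) :=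
      (specialize p).commutes c
    rw [h1, pderiv_C, pderiv_C, map_zero]
  | add f g hf hg => simp only [map_add, hf, hg]
  | mul_X f l hf =>
    simp only [map_mul, Derivation.leibniz, hf, smul_eq_mul, map_add]
    congr 2
    rcases eq_castLE_or_eq_depIdx h l with ⟨i, rfl⟩ | ⟨i, rfl⟩
    · rw [pderiv_X_of_ne (depIdx_ne_castLE h j i).symm, map_zero]
      have : X (Fin.castLE (Nat.sub_le n s) i) = freeVars k n s (X i) := by simp [freeVars]
      rw [this, specialize_freeVars, pderiv_C]
    · rw [specialize_X_depIdx, pderiv_X, pderiv_X]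
      by_cases hij : i = j
      · subst hij; simp
      · rw [Pi.single_eq_of_ne (fun e => hij e), Pi.single_eq_of_ne
          (fun e => hij (depIdx_injective h e)), map_zero]

theorem jacobian_specialize (h : s < n) (p : Fin (n - s) → k)
    (F : Fin s → MvPolynomial (Fin n) k) :
    (jacobian fun i => specialize p (F i)).det = specialize p (depJacobian h F).det := by
  rw [AlgHom.map_det]
  congr 1
  ext1 i j
  exact pderiv_specialize h p j (F i)

end Curve

/-! ### The coordinate ring of the curve is finite and torsion-free over `k[X]`. -/

section CurveRing

open MvPolynomial

variable {k : Type*} [Field k] {n r s : ℕ}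

/-- No component of the lifting curve lies over a point of the parameter line. -/
theorem mem_curveIdeal_of_C_mul_mem (h : s < n) {V : Set (Fin n → AlgebraicClosure k)}
    (hV : zeroLocus (AlgebraicClosure k) (vanishingIdeal k V) = V)
    (hfin : IsFiniteOnComponents (freeVars k n s) (vanishingIdeal k V)) {p : Fin (n - s) → k}
    {c : Polynomial k} (hc : c ≠ 0) {g : MvPolynomial (Fin s) (Polynomial k)}
    (hg : C c * g ∈ curveIdeal h (liftingCurve V p)) : g ∈ curveIdeal h (liftingCurve V p) := by
  obtain ⟨f, rfl⟩ := specialize_surjective h p g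
  have hline : lineHom p (Polynomial.aeval (X ⟨n - s - 1, by omega⟩) c) = c := by
    rw [← Polynomial.aeval_algHom_apply, lineHom, aeval_X, if_neg (by simp),
      Polynomial.aeval_X_left_apply]
  rw [← hline, ← specialize_freeVars, ← map_mul, specialize_mem_curveIdeal_iff] at hg
  rw [specialize_mem_curveIdeal_iff]
  intro x hx
  obtain ⟨P, hP, hPx⟩ := Ideal.exists_minimalPrimes_le
    (vanishingIdeal_anti_mono (k := k) (Set.singleton_subset_iff.2 hx.1))
  have := hP.1.1
  have hker : RingHom.ker (lineHom p : _ →ₐ[k] Polynomial k) ≤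
      (vanishingIdeal k {x}).comap (freeVars k n s) := by
    intro d hd
    rw [Ideal.mem_comap, mem_vanishingIdeal_singleton_iff, ← evalCurve_specialize h hx,
      specialize_freeVars, (RingHom.mem_ker).1 hd, map_zero, map_zero]
  have : (RingHom.ker (lineHom p : _ →ₐ[k] Polynomial k)).IsPrime := RingHom.ker_isPrime _
  -- Going-down yields an irreducible subvariety of V_s through `x` lying exactly over the parameter
  -- line. It is contained in the curve and dominates the line, so a nonzero polynomial in the
  -- parameter is not in `Q` and can be cancelled.
  obtain ⟨Q, hQ, hPQ, hQx, hQp⟩ := exists_isPrime_le_comap_eq (hfin P hP).1 (hfin P hP).2 hPx hker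
  have h1 : freeVars k n s (Polynomial.aeval (X ⟨n - s - 1, by omega⟩) c) * f ∈ Q := by
    rw [← IsPrime.vanishingIdeal_zeroLocus (K := AlgebraicClosure k) Q]
    intro y hy
    refine hg y ⟨hV ▸ zeroLocus_anti_mono (hP.1.2.trans hPQ) hy, fun i hi => ?_⟩
    have h2 : X i - C (p i) ∈ RingHom.ker (lineHom p : _ →ₐ[k] Polynomial k) := by
      rw [RingHom.mem_ker, map_sub, lineHom, aeval_X, if_pos hi, sub_eq_zero]
      exact ((lineHom p).commutes (p i)).symm
    rw [← hQp, Ideal.mem_comap] at h2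
    have h3 := hy _ h2
    rw [map_sub, map_sub, freeVars] at h3
    simpa [sub_eq_zero] using h3
  have h2 : f ∈ Q := by
    refine (hQ.mem_or_mem h1).resolve_left fun h3 => hc ?_
    rw [← Ideal.mem_comap, hQp, RingHom.mem_ker, hline] at h3
    exact h3
  exact (mem_vanishingIdeal_singleton_iff x f).1 (hQx h2)

/-- The coordinate ring of the curve `C` over `k[X_{n-s}]`. -/
abbrev CurveRing (h : s < n) (D : Set (Fin n → AlgebraicClosure k)) : Type _ :=
  MvPolynomial (Fin s) (Polynomial k) ⧸ curveIdeal h D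

/-- The restriction of polynomials to the lifting curve. -/
noncomputable def toCurveRing (h : s < n) (V : Set (Fin n → AlgebraicClosure k))
    (p : Fin (n - s) → k) : MvPolynomial (Fin n) k →+* CurveRing h (liftingCurve V p) :=
  (Ideal.Quotient.mk _).comp (specialize p).toRingHom

theorem toCurveRing_apply (h : s < n) (V : Set (Fin n → AlgebraicClosure k))
    (p : Fin (n - s) → k) (f : MvPolynomial (Fin n) k) :
    toCurveRing h V p f = Ideal.Quotient.mk _ (specialize p f) := rfl

theorem toCurveRing_surjective (h : s < n) (V : Set (Fin n → AlgebraicClosure k))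
    (p : Fin (n - s) → k) : Function.Surjective (toCurveRing h V p) :=
  Ideal.Quotient.mk_surjective.comp (specialize_surjective h p)

theorem toCurveRing_eq_zero_iff (h : s < n) {V : Set (Fin n → AlgebraicClosure k)}
    {p : Fin (n - s) → k} {f : MvPolynomial (Fin n) k} :
    toCurveRing h V p f = 0 ↔ ∀ x ∈ liftingCurve V p, aeval x f = 0 := by
  rw [toCurveRing_apply, Ideal.Quotient.eq_zero_iff_mem, specialize_mem_curveIdeal_iff]

theorem toCurveRing_aeval_paramIdx (h : s < n) (V : Set (Fin n → AlgebraicClosure k))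
    (p : Fin (n - s) → k) (c : Polynomial k) :
    toCurveRing h V p (Polynomial.aeval (X (paramIdx h)) c) = algebraMap _ _ c := by
  rw [toCurveRing_apply, specialize_aeval_X_paramIdx]; rfl

theorem curveRing_algebraMap_mul_eq_zero (h : s < n) {V : Set (Fin n → AlgebraicClosure k)}
    (hV : zeroLocus (AlgebraicClosure k) (vanishingIdeal k V) = V)
    (hfin : IsFiniteOnComponents (freeVars k n s) (vanishingIdeal k V)) {p : Fin (n - s) → k}
    {c : Polynomial k} (hc : c ≠ 0) (b : CurveRing h (liftingCurve V p))
    (hb : algebraMap _ _ c * b = 0) : b = 0 := by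
  obtain ⟨g, rfl⟩ := Ideal.Quotient.mk_surjective b
  refine Ideal.Quotient.eq_zero_iff_mem.2 (mem_curveIdeal_of_C_mul_mem h hV hfin hc ?_)
  rw [← Ideal.Quotient.eq_zero_iff_mem, map_mul]
  exact hb

theorem curveRing_isIntegral (h : s < n) {V : Set (Fin n → AlgebraicClosure k)}
    (hfin : IsFiniteOnComponents (freeVars k n s) (vanishingIdeal k V)) (p : Fin (n - s) → k) :
    Algebra.IsIntegral (Polynomial k) (CurveRing h (liftingCurve V p)) := by
  refine ⟨fun b => ?_⟩
  obtain ⟨f, rfl⟩ := toCurveRing_surjective h V p b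
  obtain ⟨q, hq, hqf⟩ := (isIntegral_of_isFiniteOnComponents (isRadical_vanishingIdeal V) hfin)
    (Ideal.Quotient.mk _ f)
  rw [← Polynomial.hom_eval₂, Ideal.Quotient.eq_zero_iff_mem] at hqf
  -- An integral equation on V_s restricts to the curve by restricting its coefficients to the line.
  refine ⟨q.map (lineHom p).toRingHom, hq.map _, ?_⟩
  have h1 := (toCurveRing_eq_zero_iff h (p := p)).2 fun x hx => hqf x hx.1
  rw [Polynomial.hom_eval₂] at h1
  rw [Polynomial.eval₂_map, ← h1]
  congr 1
  refine RingHom.ext fun c => ?_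
  simp only [RingHom.comp_apply, toCurveRing_apply, specialize_freeVars]
  rfl

theorem curveRing_finite (h : s < n) {V : Set (Fin n → AlgebraicClosure k)}
    (hfin : IsFiniteOnComponents (freeVars k n s) (vanishingIdeal k V)) (p : Fin (n - s) → k) :
    Module.Finite (Polynomial k) (CurveRing h (liftingCurve V p)) := by
  have := curveRing_isIntegral h hfin p
  have : Algebra.FiniteType (Polynomial k) (CurveRing h (liftingCurve V p)) := inferInstance
  exact Algebra.IsIntegral.finite (R := Polynomial k) (A := CurveRing h (liftingCurve V p))

theorem isFiniteOnComponents_curveIdeal (h : s < n) {V : Set (Fin n → AlgebraicClosure k)}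
    (hV : zeroLocus (AlgebraicClosure k) (vanishingIdeal k V) = V)
    (hfin : IsFiniteOnComponents (freeVars k n s) (vanishingIdeal k V)) (p : Fin (n - s) → k) :
    IsFiniteOnComponents (C : Polynomial k →+* MvPolynomial (Fin s) (Polynomial k))
      (curveIdeal h (liftingCurve V p)) := by
  intro P hP
  constructor
  · rw [injective_iff_map_eq_zero]
    intro c hc
    by_contra hc0
    rw [RingHom.comp_apply, Ideal.Quotient.eq_zero_iff_mem] at hc
    -- Elements of a minimal prime are zero divisors modulo the ideal; torsion-freeness excludes
    -- nonzero constants among them.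
    obtain ⟨g, hg, hcg⟩ := Ideal.exists_mul_mem_of_mem_minimalPrimes hP hc
    exact hg (mem_curveIdeal_of_C_mul_mem h hV hfin hc0 hcg)
  · have h1 : (algebraMap (Polynomial k) (CurveRing h (liftingCurve V p))).IsIntegral :=
      (curveRing_isIntegral h hfin p).isIntegral
    have h2 : (Ideal.Quotient.mk P).comp C = (Ideal.Quotient.factor hP.1.2).comp
        (algebraMap (Polynomial k) (CurveRing h (liftingCurve V p))) := rfl
    rw [h2]
    intro b
    obtain ⟨a, rfl⟩ := Ideal.Quotient.factor_surjective hP.1.2 b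
    exact (h1 a).map _

theorem fiber_subset_liftingCurve (V : Set (Fin n → AlgebraicClosure k)) (p : Fin (n - s) → k) :
    fiber V p ⊆ liftingCurve V p := fun _ hx => ⟨hx.1, fun i _ => hx.2 i⟩

end CurveRing

/-! ### Intersections of a plane curve with a generic line. -/

section PlaneCurve

open Polynomial

variable {K : Type*} [Field K]

/-- The restriction of a bivariate polynomial to the line `t = u + β T`. -/
noncomputable def lineRestrict (β u : K) (χ : K[X][X]) : K[X] :=
  χ.eval₂ (compRingHom (C u + C β * X)) X

theorem eval_lineRestrict (β u T : K) (χ : K[X][X]) :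
    (lineRestrict β u χ).eval T = χ.evalEval (u + β * T) T := by
  rw [lineRestrict, ← coe_evalRingHom, hom_eval₂, ← eval₂_evalRingHom]
  congr 1
  · ext <;> simp
  · simp

/-- The chain rule, with `η` the partial derivative of `χ` in the inner variable. That `η` does not
depend on the line allows the slope to be chosen afterwards. -/
theorem exists_derivative_lineRestrict (χ : K[X][X]) :
    ∃ η : K[X][X], ∀ β u, derivative (lineRestrict β u χ) =
      lineRestrict β u (C (C β) * η + derivative χ) := by
  induction χ using Polynomial.induction_on' with
  | add p q hp hq =>
    obtain ⟨η, hη⟩ := hp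
    obtain ⟨θ, hθ⟩ := hq
    refine ⟨η + θ, fun β u => ?_⟩
    have h1 := hη β u
    have h2 := hθ β u
    simp only [lineRestrict, eval₂_add, derivative_add, eval₂_mul, eval₂_C] at h1 h2 ⊢
    rw [h1, h2]
    ring
  | monomial n c =>
    refine ⟨monomial n (derivative c), fun β u => ?_⟩
    simp only [lineRestrict, eval₂_monomial, derivative_mul, derivative_monomial, eval₂_add,
      eval₂_mul, eval₂_C, coe_compRingHom, derivative_comp, derivative_X_pow, C_comp]
    simp
    ring

/-- Take `c` to be the resultant in the outer variable. Specialization at `a` may lower the degree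
of `H`, but this changes the resultant only by a power of the leading coefficient 1 of `χ`. -/
theorem exists_combination_eq_C {χ H : K[X][X]} (hχ : χ.Monic) (a : K)
    (h : IsCoprime (χ.map (evalRingHom a)) (H.map (evalRingHom a))) :
    ∃ A B c, A * χ + B * H = C c ∧ c.eval a ≠ 0 := by
  by_cases h0 : χ.natDegree = 0
  · rw [eq_one_of_monic_natDegree_zero hχ h0]
    exact ⟨1, 0, 1, by simp, by simp⟩
  obtain ⟨P, Q, -, -, e⟩ := exists_mul_add_mul_eq_C_resultant χ H le_rfl le_rfl (Or.inl h0)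
  refine ⟨P, Q, _, by rw [← e]; ring, ?_⟩
  have h1 := resultant_map_map χ H χ.natDegree H.natDegree (evalRingHom a)
  have h2 : (H.map (evalRingHom a)).natDegree ≤ H.natDegree := natDegree_map_le
  rw [← Nat.add_sub_cancel' h2, resultant_add_right_deg _ _ _ _ _ le_rfl] at h1
  rw [← coe_evalRingHom, ← Nat.add_sub_cancel' h2, ← h1, coeff_map, hχ.coeff_natDegree, map_one,
    one_pow, one_mul, ← hχ.natDegree_map (evalRingHom a)]
  exact resultant_ne_zero _ _ h

theorem lineRestrict_eq_sum {D : ℕ} {χ : K[X][X]}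
    (hD : ∀ i j, D < i + j → (χ.coeff i).coeff j = 0) (β u : K) : lineRestrict β u χ =
      ∑ i ∈ Finset.range (D + 1), (χ.coeff i).comp (C u + C β * X) * X ^ i := by
  refine eval₂_eq_sum_range' _ (Nat.lt_succ_of_le (natDegree_le_iff_coeff_eq_zero.2 fun i hi => ?_)) _
  ext j
  exact hD i j (by omega)

theorem natDegree_C_add_C_mul_X_le (β u : K) : (C u + C β * X).natDegree ≤ 1 := by
  compute_degree

theorem coeff_comp_C_add_C_mul_X {c : K[X]} {e : ℕ} (hc : c.natDegree ≤ e) (β u : K) :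
    (c.comp (C u + C β * X)).coeff e = c.coeff e * β ^ e := by
  rw [comp, eval₂_eq_sum_range' C (Nat.lt_succ_of_le hc), finsetSum_coeff,
    Finset.sum_range_succ, Finset.sum_eq_zero, zero_add, coeff_C_mul]
  · have := coeff_pow_of_natDegree_le (m := e) (natDegree_C_add_C_mul_X_le β u)
    rw [mul_one] at this
    rw [this]
    simp
  · intro j hj
    rw [coeff_C_mul, coeff_eq_zero_of_natDegree_lt (p := (C u + C β * X) ^ j), mul_zero]
    have := natDegree_pow_le_of_le j (natDegree_C_add_C_mul_X_le β u)
    rw [mul_one] at this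
    exact this.trans_lt (Finset.mem_range.1 hj)

theorem natDegree_coeff_le_of_totalDegree {D : ℕ} {χ : K[X][X]}
    (hD : ∀ i j, D < i + j → (χ.coeff i).coeff j = 0) {i : ℕ} (hi : i ≤ D) :
    (χ.coeff i).natDegree ≤ D - i :=
  natDegree_le_iff_coeff_eq_zero.2 fun j hj => hD i j (by omega)

/-- Only the homogeneous part of degree `D` contributes, evaluated in the direction `(β, 1)` of the
line. -/
theorem coeff_lineRestrict {D : ℕ} {χ : K[X][X]} (hD : ∀ i j, D < i + j → (χ.coeff i).coeff j = 0)
    (β u : K) : (lineRestrict β u χ).coeff D =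
      ∑ i ∈ Finset.range (D + 1), (χ.coeff i).coeff (D - i) * β ^ (D - i) := by
  rw [lineRestrict_eq_sum hD, finsetSum_coeff]
  refine Finset.sum_congr rfl fun i hi => ?_
  have hi' : i ≤ D := Nat.lt_succ_iff.1 (Finset.mem_range.1 hi)
  rw [coeff_mul_X_pow', if_pos hi',
    coeff_comp_C_add_C_mul_X (natDegree_coeff_le_of_totalDegree hD hi')]

theorem natDegree_lineRestrict_le {D : ℕ} {χ : K[X][X]}
    (hD : ∀ i j, D < i + j → (χ.coeff i).coeff j = 0)
    (β u : K) : (lineRestrict β u χ).natDegree ≤ D := by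
  rw [lineRestrict_eq_sum hD]
  refine natDegree_sum_le_of_forall_le _ _ fun i hi => ?_
  have hi' : i ≤ D := Nat.lt_succ_iff.1 (Finset.mem_range.1 hi)
  have h1 := natDegree_coeff_le_of_totalDegree hD hi'
  have h2 : ((χ.coeff i).comp (C u + C β * X)).natDegree ≤ D - i :=
    natDegree_comp_le.trans ((Nat.mul_le_mul h1 (natDegree_C_add_C_mul_X_le β u)).trans (by omega))
  refine natDegree_mul_le.trans ?_
  rw [natDegree_X_pow]
  omega

/-- A generic line meets the curve `χ = 0` in as many points as the total degree of `χ`. -/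
theorem exists_line_card_eq [IsAlgClosed K] {χ : K[X][X]} (hχ : χ.Monic) (a : K)
    (hsep : (χ.map (evalRingHom a)).Separable) {D : ℕ}
    (hD : ∀ i j, D < i + j → (χ.coeff i).coeff j = 0)
    {i₀ j₀ : ℕ} (hij : i₀ + j₀ = D) (hne : (χ.coeff i₀).coeff j₀ ≠ 0) :
    ∃ β u : K, ∃ T : Finset K, T.card = D ∧ ∀ τ, τ ∈ T ↔ χ.evalEval (u + β * τ) τ = 0 := by
  classical
  obtain ⟨η, hη⟩ := exists_derivative_lineRestrict χ
  have hinf : Infinite K := IsAlgClosed.instInfinite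
  set top : K[X] := ∑ i ∈ Finset.range (D + 1), C ((χ.coeff i).coeff (D - i)) * X ^ (D - i)
    with htop
  have htop0 : top ≠ 0 := by
    intro h0
    refine hne ?_
    have h1 : top.coeff j₀ = (χ.coeff i₀).coeff (D - i₀) := by
      rw [htop, finsetSum_coeff, Finset.sum_eq_single i₀]
      · rw [coeff_C_mul, coeff_X_pow, if_pos (by omega), mul_one]
      · intro i hi hi'
        have := Finset.mem_range.1 hi
        rw [coeff_C_mul, coeff_X_pow, if_neg (by omega), mul_zero]
      · intro h
        exact absurd (Finset.mem_range.2 (by omega)) h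
    rw [h0, coeff_zero, show D - i₀ = j₀ by omega] at h1
    exact h1.symm
  -- The slopes to avoid: those where the restriction drops degree, and those tangent to the curve
  -- at one of its points over `a`. Each tangency factor is nonzero because its constant term is the
  -- derivative of the separable fiber polynomial at a root.
  set bad : K[X] := top * ∏ τ ∈ (χ.map (evalRingHom a)).roots.toFinset,
    (X * C (η.evalEval a τ) + C ((derivative χ).evalEval a τ)) with hbad
  have hroot : ∀ τ, (χ.map (evalRingHom a)).eval τ = 0 → (derivative χ).evalEval a τ ≠ 0 := by
    intro τ h1 h2
    rw [← map_evalRingHom_eval, ← derivative_map] at h2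
    exact hsep.eval₂_derivative_ne_zero (RingHom.id K) h1 h2
  have hbad0 : bad ≠ 0 := by
    refine mul_ne_zero htop0 (Finset.prod_ne_zero_iff.2 fun τ hτ h0 => ?_)
    rw [Multiset.mem_toFinset, mem_roots (hχ.map _).ne_zero] at hτ
    have h1 := congrArg (eval 0) h0
    rw [eval_add, eval_mul, eval_X, zero_mul, zero_add, eval_C, eval_zero] at h1
    exact hroot τ hτ h1
  obtain ⟨β, hβ⟩ : ∃ β, bad.eval β ≠ 0 := by
    by_contra! h
    exact hbad0 (Polynomial.funext fun x => by rw [h x, eval_zero])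
  rw [hbad, eval_mul, mul_ne_zero_iff] at hβ
  have hcop : IsCoprime (χ.map (evalRingHom a))
      ((C (C β) * η + derivative χ).map (evalRingHom a)) := by
    rw [isCoprime_iff_aeval_ne_zero_of_isAlgClosed K K]
    intro τ
    by_contra! h
    rw [coe_aeval_eq_eval] at h
    refine Finset.prod_ne_zero_iff.1 (eval_prod _ _ β ▸ hβ.2) τ ?_ ?_
    · rw [Multiset.mem_toFinset, mem_roots (hχ.map _).ne_zero]
      exact h.1
    · have h2 := h.2
      rw [map_evalRingHom_eval, evalEval_add, evalEval_mul, evalEval_C, eval_C] at h2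
      rw [eval_add, eval_mul, eval_X, eval_C, eval_C, h2]
  obtain ⟨A, B, c, e, hc⟩ := exists_combination_eq_C hχ a hcop
  have hc0 : c ≠ 0 := by rintro rfl; simp at hc
  -- At a point of tangency both `χ` and its derivative along the line vanish, hence so does `c`.
  -- Only finitely many points of the curve satisfy this, and `u` keeps the line away from them.
  obtain ⟨u, hu⟩ : ∃ u, u ∉ (c.roots.toFinset.biUnion fun t =>
      ((χ.map (evalRingHom t)).roots.toFinset).image fun τ => t - β * τ) :=
    Infinite.exists_notMem_finset _
  have hsimple : ∀ τ, (lineRestrict β u χ).eval τ = 0 →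
      (derivative (lineRestrict β u χ)).eval τ ≠ 0 := by
    intro τ h1 h2
    rw [hη, eval_lineRestrict] at h2
    rw [eval_lineRestrict] at h1
    have h3 := congrArg (evalEval (u + β * τ) τ) e
    rw [evalEval_add, evalEval_mul, evalEval_mul, h1, h2, mul_zero, mul_zero, add_zero,
      evalEval_C] at h3
    refine hu (Finset.mem_biUnion.2 ⟨u + β * τ, ?_, Finset.mem_image.2 ⟨τ, ?_, add_sub_cancel_right _ _⟩⟩)
    · rw [Multiset.mem_toFinset, mem_roots hc0]; exact h3.symm
    · rw [Multiset.mem_toFinset, mem_roots (hχ.map _).ne_zero, IsRoot.def, map_evalRingHom_eval]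
      exact h1
  have hdeg : (lineRestrict β u χ).natDegree = D := by
    refine le_antisymm (natDegree_lineRestrict_le hD β u) (le_natDegree_of_ne_zero ?_)
    rw [coeff_lineRestrict hD]
    have := hβ.1
    rw [htop, eval_finsetSum] at this
    simpa using this
  have hne0 : lineRestrict β u χ ≠ 0 := fun h0 =>
    hsimple 0 (by rw [h0, eval_zero]) (by rw [h0, derivative_zero, eval_zero])
  refine ⟨β, u, (lineRestrict β u χ).roots.toFinset, ?_, fun τ => ?_⟩
  · rw [Multiset.toFinset_card_of_nodup, ← hdeg]
    · exact (IsAlgClosed.splits _).natDegree_eq_card_roots.symm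
    · refine Multiset.nodup_iff_count_le_one.2 fun τ => ?_
      rw [count_roots]
      by_contra! h
      have := (one_lt_rootMultiplicity_iff_isRoot hne0).1 h
      exact hsimple τ this.1 this.2
  · rw [Multiset.mem_toFinset, mem_roots hne0, IsRoot.def, eval_lineRestrict]

end PlaneCurve

/-! ### Roots of characteristic polynomials as values at points. -/

section Eigenvalues

open Matrix

variable {R B ι : Type*} [CommRing R] [CommRing B] [Algebra R B] [Fintype ι] [DecidableEq ι]

theorem eval_charpoly_eq_det {A : Type*} [CommRing A] (N : Matrix ι ι A) (w : A) :
    N.charpoly.eval w = (scalar ι w - N).det := by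
  rw [charpoly, eval_det, matPolyEquiv_charmatrix]
  simp

/-- The values of `μ b₁ + λ b₂` are roots of the specialized characteristic polynomial. -/
theorem eval_charpoly_eq_zero (bas : Module.Basis ι R B) {A : Type*} [CommRing A] (ψ : B →+* A)
    (μ ν : A) (b₁ b₂ : B) :
    (μ • (Algebra.leftMulMatrix bas b₁).map (ψ.comp (algebraMap R B)) +
      ν • (Algebra.leftMulMatrix bas b₂).map (ψ.comp (algebraMap R B))).charpoly.eval
        (μ * ψ b₁ + ν * ψ b₂) = 0 := by
  rw [eval_charpoly_eq_det]
  set N := scalar ι (μ * ψ b₁ + ν * ψ b₂) -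
    (μ • (Algebra.leftMulMatrix bas b₁).map (ψ.comp (algebraMap R B)) +
      ν • (Algebra.leftMulMatrix bas b₂).map (ψ.comp (algebraMap R B))) with hN
  -- The values of the basis at `ψ` form a common left eigenvector of all multiplication matrices.
  have hrow : ∀ b : B, (fun i => ψ (bas i)) ᵥ*
      (Algebra.leftMulMatrix bas b).map (ψ.comp (algebraMap R B)) = ψ b • fun i => ψ (bas i) := by
    intro b
    funext j
    have h1 := congrArg ψ (bas.sum_repr (b * bas j))
    simp only [map_sum, Algebra.smul_def, map_mul] at h1
    simp only [vecMul, dotProduct, map_apply, Algebra.leftMulMatrix_eq_repr_mul, Pi.smul_apply,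
      smul_eq_mul, RingHom.comp_apply]
    rw [← h1]
    exact Finset.sum_congr rfl fun i _ => mul_comm _ _
  have h0 : (fun i => ψ (bas i)) ᵥ* N = 0 := by
    rw [hN, vecMul_sub, vecMul_add, vecMul_smul, vecMul_smul, hrow, hrow]
    funext j
    simp [scalar_apply]
    ring
  -- Over a general ring a kernel vector only gives that the determinant kills its entries. These
  -- generate the unit ideal, because 1 is a combination of the basis.
  have h1 : N.det • (fun i => ψ (bas i)) = 0 := by
    have h2 := congrArg (fun x => x ᵥ* N.adjugate) h0
    simp only [vecMul_vecMul, mul_adjugate, zero_vecMul, vecMul_smul, vecMul_one] at h2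
    exact h2
  have h2 : ∑ i, ψ (bas.repr 1 i • bas i) = 1 := by rw [← map_sum, bas.sum_repr, map_one]
  rw [← mul_one N.det, ← h2, Finset.mul_sum]
  refine Finset.sum_eq_zero fun i _ => ?_
  have h3 : N.det * ψ (bas i) = 0 := congrFun h1 i
  rw [Algebra.smul_def, map_mul, mul_left_comm, h3, mul_zero]

/-- Every root of the specialized characteristic polynomial is the value of `μ b₁ + λ b₂` at some
geometric point. -/
theorem exists_algHom_of_eval_charpoly_eq_zero (bas : Module.Basis ι R B) {K : Type*} [Field K]
    [IsAlgClosed K] [Algebra R K] {μ ν w : K} {b₁ b₂ : B}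
    (hw : (μ • (Algebra.leftMulMatrix bas b₁).map (algebraMap R K) +
      ν • (Algebra.leftMulMatrix bas b₂).map (algebraMap R K)).charpoly.eval w = 0) :
    ∃ ψ : B →ₐ[R] K, μ * ψ b₁ + ν * ψ b₂ = w := by
  rw [eval_charpoly_eq_det] at hw
  have hmat : ∀ b, Algebra.leftMulMatrix (bas.baseChange K) ((1 : K) ⊗ₜ[R] b) =
      (Algebra.leftMulMatrix bas b).map (algebraMap R K) := by
    intro b
    ext i j
    rw [Algebra.leftMulMatrix_eq_repr_mul, map_apply, Algebra.leftMulMatrix_eq_repr_mul,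
      Module.Basis.baseChange_apply, Algebra.TensorProduct.tmul_mul_tmul, one_mul,
      Module.Basis.baseChange_repr_tmul]
    simp [Algebra.smul_def]
  set e : TensorProduct R K B := algebraMap K _ w - (μ • ((1 : K) ⊗ₜ[R] b₁) + ν • ((1 : K) ⊗ₜ[R] b₂))
    with he
  have hmate : Algebra.leftMulMatrix (bas.baseChange K) e = scalar ι w -
      (μ • (Algebra.leftMulMatrix bas b₁).map (algebraMap R K) +
        ν • (Algebra.leftMulMatrix bas b₂).map (algebraMap R K)) := by
    rw [he, map_sub, map_add, map_smul, map_smul, hmat, hmat, AlgHom.commutes]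
    rfl
  -- As multiplication by `e` has determinant 0, `e` lies in a maximal ideal. Its residue field is
  -- finite over the algebraically closed `K`, hence equal to `K`, which gives the point.
  have hnu : ¬ IsUnit e := by
    intro h
    have h1 := (isUnit_iff_isUnit_det _).1 (h.map (Algebra.leftMulMatrix (bas.baseChange K)))
    rw [hmate, hw] at h1
    exact not_isUnit_zero h1
  obtain ⟨I, hI, heI⟩ := exists_max_ideal_of_mem_nonunits hnu
  have : Module.Finite K (TensorProduct R K B) := Module.Finite.of_basis (bas.baseChange K)
  let _ : Field (TensorProduct R K B ⧸ I) := Ideal.Quotient.field I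
  have hbij : Function.Bijective (algebraMap K (TensorProduct R K B ⧸ I)) :=
    IsAlgClosed.algebraMap_bijective_of_isIntegral
  let φ : (TensorProduct R K B ⧸ I) ≃ₐ[K] K := (AlgEquiv.ofBijective (Algebra.ofId K _) hbij).symm
  let Φ : TensorProduct R K B →ₐ[K] K := φ.toAlgHom.comp (Ideal.Quotient.mkₐ K I)
  have hΦ : Φ e = 0 := by
    have : Ideal.Quotient.mkₐ K I e = 0 := Ideal.Quotient.eq_zero_iff_mem.2 heI
    rw [AlgHom.comp_apply, this, map_zero]
  refine ⟨(Φ.restrictScalars R).comp Algebra.TensorProduct.includeRight, ?_⟩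
  rw [he, map_sub, map_add, map_smul, map_smul, AlgHom.commutes, sub_eq_zero] at hΦ
  exact hΦ.symm

end Eigenvalues

/-! ### Linear sections and the degree of a variety. -/

section Degree

open MvPolynomial

variable {k : Type*} [Field k] {n s : ℕ}

/-- Finiteness of the projection gives every component dimension `n - s`, so the `s`-dimensional
fiber of `A` is an admissible section for all components at once. The section of `V` is the union of
their sections. -/
theorem encard_inter_le_varietyDegree (h : s < n) {V : Set (Fin n → AlgebraicClosure k)}
    (hV : zeroLocus (AlgebraicClosure k) (vanishingIdeal k V) = V)
    (hfin : IsFiniteOnComponents (freeVars k n s) (vanishingIdeal k V))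
    {A : (Fin n → AlgebraicClosure k) →ₗ[AlgebraicClosure k] (Fin (n - s) → AlgebraicClosure k)}
    (hA : Function.Surjective A) (c : Fin (n - s) → AlgebraicClosure k)
    (hVA : (V ∩ {x | A x = c}).Finite) : (V ∩ {x | A x = c}).encard ≤ varietyDegree (k := k) V := by
  obtain ⟨x₀, hx₀⟩ := hA c
  set L : AffineSubspace (AlgebraicClosure k) (Fin n → AlgebraicClosure k) :=
    AffineSubspace.mk' x₀ (LinearMap.ker A) with hL
  have hLmem : ∀ x, x ∈ L ↔ A x = c := fun x => by
    rw [hL, AffineSubspace.mem_mk', LinearMap.mem_ker, vsub_eq_sub, map_sub, hx₀, sub_eq_zero]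
  have hrank : Module.finrank (AlgebraicClosure k) L.direction = s := by
    have h1 := A.finrank_range_add_finrank_ker
    rw [LinearMap.range_eq_top.2 hA, finrank_top, Module.finrank_fin_fun,
      Module.finrank_fin_fun] at h1
    rw [hL, AffineSubspace.direction_mk']
    omega
  have hfinP := (vanishingIdeal k V).finite_minimalPrimes_of_isNoetherianRing
    (MvPolynomial (Fin n) k)
  have hZ : ∀ P ∈ (vanishingIdeal k V).minimalPrimes, zeroLocus (AlgebraicClosure k) P ⊆ V :=
    fun P hP => hV ▸ zeroLocus_anti_mono hP.1.2
  have hcover : V ∩ {x | A x = c} ⊆ ⋃ P ∈ hfinP.toFinset,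
      zeroLocus (AlgebraicClosure k) P ∩ (L : Set (Fin n → AlgebraicClosure k)) := by
    rintro x ⟨hx, hxA⟩
    obtain ⟨P, hP, hPx⟩ := Ideal.exists_minimalPrimes_le
      (vanishingIdeal_anti_mono (k := k) (Set.singleton_subset_iff.2 hx))
    simp only [Set.mem_iUnion]
    exact ⟨P, hfinP.mem_toFinset.2 hP, fun f hf => hPx hf x rfl, (hLmem x).2 hxA⟩
  refine (Set.encard_le_encard hcover).trans ((hfinP.toFinset.set_encard_biUnion_le _).trans ?_)
  refine Finset.sum_le_sum fun P hP => ?_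
  have hP' := hfinP.mem_toFinset.1 hP
  have := hP'.1.1
  have hdim : ringKrullDim (MvPolynomial (Fin n) k ⧸ P) = ((n - s : ℕ) : WithBot ℕ∞) := by
    rw [ringKrullDim_quotient_eq (hfin P hP').1 (hfin P hP').2,
      MvPolynomial.ringKrullDim_of_isNoetherianRing, ringKrullDim_eq_zero_of_field, zero_add,
      Nat.card_fin]
  exact le_iSup (fun L : {L : AffineSubspace (AlgebraicClosure k) (Fin n → AlgebraicClosure k) //
      ringKrullDim (MvPolynomial (Fin n) k ⧸ P) +
          ((Module.finrank (AlgebraicClosure k) L.direction : ℕ) : WithBot ℕ∞) =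
        ((n : ℕ) : WithBot ℕ∞) ∧
      (zeroLocus (AlgebraicClosure k) P ∩ (L : Set (Fin n → AlgebraicClosure k))).Finite} =>
    (zeroLocus (AlgebraicClosure k) P ∩ (L.1 : Set (Fin n → AlgebraicClosure k))).encard)
    ⟨L, by rw [hdim, hrank, ← Nat.cast_add, Nat.sub_add_cancel h.le],
      hVA.subset fun x hx => ⟨hZ P hP' hx.1, (hLmem x).1 hx.2⟩⟩

end Degree

/-! ### The pencil of characteristic polynomials and the parametrizations `W`. -/

section Pencil

open Polynomial Matrix

/-- The coefficient of the `j`-th power of the inner variable. -/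
noncomputable def innerCoeff {R : Type*} [CommRing R] (j : ℕ) (P : R[X][X]) : R[X] :=
  P.sum fun n c => monomial n (c.coeff j)

theorem coeff_innerCoeff {R : Type*} [CommRing R] (j : ℕ) (P : R[X][X]) (n : ℕ) :
    (innerCoeff j P).coeff n = (P.coeff n).coeff j := by
  rw [innerCoeff, Polynomial.sum_def, finsetSum_coeff]
  simp only [coeff_monomial, Finset.sum_ite_eq', mem_support_iff, ne_eq]
  split_ifs with h
  · rfl
  · rw [notMem_support_iff.1 h, coeff_zero]

theorem innerCoeff_add {R : Type*} [CommRing R] (j : ℕ) (P Q : R[X][X]) :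
    innerCoeff j (P + Q) = innerCoeff j P + innerCoeff j Q := by
  ext n
  simp only [coeff_innerCoeff, coeff_add]

theorem innerCoeff_monomial {R : Type*} [CommRing R] (j n : ℕ) (c : R[X]) :
    innerCoeff j (monomial n c) = monomial n (c.coeff j) := by
  ext l
  simp only [coeff_innerCoeff, coeff_monomial]
  split_ifs <;> simp

/-- With Λ the inner variable, this is the derivative at Λ = 0 of P(Λ, b₁ + Λ b₂): the chain rule,
expressed through coefficients. -/
theorem coeff_one_eval₂ {R B : Type*} [CommRing R] [CommRing B] [Algebra R B] (P : R[X][X])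
    (b₁ b₂ : B) : (P.eval₂ (mapRingHom (algebraMap R B)) (C b₁ + X * C b₂)).coeff 1 =
      aeval b₁ (derivative (P.map (evalRingHom 0))) * b₂ + aeval b₁ (innerCoeff 1 P) := by
  induction P using Polynomial.induction_on' with
  | add P Q hP hQ =>
    rw [eval₂_add, coeff_add, hP, hQ, innerCoeff_add, Polynomial.map_add, derivative_add,
      map_add, map_add]
    ring
  | monomial n c =>
    have h0 : ((C b₁ + X * C b₂) ^ n).coeff 0 = b₁ ^ n := by
      simp [coeff_zero_eq_eval_zero]
    have h1 : ((C b₁ + X * C b₂) ^ n).coeff 1 = n * b₁ ^ (n - 1) * b₂ := by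
      have := coeff_derivative ((C b₁ + X * C b₂) ^ n) 0
      rw [zero_add, Nat.cast_zero, zero_add, mul_one] at this
      rw [← this, coeff_zero_eq_eval_zero, derivative_pow]
      simp
    rw [eval₂_monomial, mul_coeff_one, h0, h1, innerCoeff_monomial, map_monomial,
      derivative_monomial, aeval_monomial, aeval_monomial, coe_mapRingHom, coeff_map, coeff_map,
      map_mul, map_natCast, coe_evalRingHom, coeff_zero_eq_eval_zero c]
    ring

variable {R B ι : Type*} [CommRing R] [CommRing B] [Algebra R B] [Fintype ι] [DecidableEq ι]

/-- The characteristic polynomial of multiplication by `b₁ + Λ b₂`, with coefficients in `R[Λ]`. -/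
noncomputable def pencil (bas : Module.Basis ι R B) (b₁ b₂ : B) : R[X][X] :=
  ((Algebra.leftMulMatrix bas b₁).map C + (X : R[X]) • (Algebra.leftMulMatrix bas b₂).map C).charpoly

variable (bas : Module.Basis ι R B)

theorem monic_pencil (b₁ b₂ : B) : (pencil bas b₁ b₂).Monic := charpoly_monic _

theorem natDegree_pencil [Nontrivial R] (b₁ b₂ : B) :
    (pencil bas b₁ b₂).natDegree = Fintype.card ι := charpoly_natDegree_eq_dim _

theorem map_pencil {A : Type*} [CommRing A] (θ : R[X] →+* A) (b₁ b₂ : B) :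
    (pencil bas b₁ b₂).map θ = ((1 : A) • (Algebra.leftMulMatrix bas b₁).map (θ.comp C) +
      θ X • (Algebra.leftMulMatrix bas b₂).map (θ.comp C)).charpoly := by
  rw [pencil, ← charpoly_map]
  congr 1
  ext i j
  simp only [map_apply, Matrix.add_apply, Matrix.smul_apply,
    smul_eq_mul, map_add, map_mul, one_mul, RingHom.comp_apply]

theorem eval_map_pencil {A : Type*} [CommRing A] (ψ : B →+* A) (θ : R[X] →+* A)
    (h : θ.comp C = ψ.comp (algebraMap R B)) (b₁ b₂ : B) :
    ((pencil bas b₁ b₂).map θ).eval (ψ b₁ + θ X * ψ b₂) = 0 := by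
  have := eval_charpoly_eq_zero bas ψ 1 (θ X) b₁ b₂
  rwa [one_mul, ← h, ← map_pencil] at this

theorem map_evalRingHom_pencil (b₁ b₂ : B) (c : R) : (pencil bas b₁ b₂).map (evalRingHom c) =
    (Algebra.leftMulMatrix bas b₁ + c • Algebra.leftMulMatrix bas b₂).charpoly := by
  rw [map_pencil]
  congr 1
  ext i j
  simp

theorem map_evalRingHom_zero_pencil (b₁ b₂ : B) : (pencil bas b₁ b₂).map (evalRingHom 0) =
    (Algebra.leftMulMatrix bas b₁).charpoly := by
  rw [map_evalRingHom_pencil, zero_smul, add_zero]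

theorem aeval_charpoly_leftMulMatrix (b : B) :
    aeval b (Algebra.leftMulMatrix bas b).charpoly = 0 := by
  refine Algebra.leftMulMatrix_injective bas ?_
  rw [← aeval_algHom_apply, aeval_self_charpoly, map_zero]

/-- Over `B[Λ]`, the element `b₁ + Λ * b₂` is a root of its own characteristic polynomial; the
identity is the vanishing of the coefficient of Λ. -/
theorem aeval_derivative_charpoly_mul (b₁ b₂ : B) :
    aeval b₁ (derivative (Algebra.leftMulMatrix bas b₁).charpoly) * b₂ =
      aeval b₁ (-innerCoeff 1 (pencil bas b₁ b₂)) := by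
  have h1 := eval_map_pencil bas (C : B →+* B[X]) (mapRingHom (algebraMap R B))
    (RingHom.ext fun c => by simp) b₁ b₂
  rw [eval_map, coe_mapRingHom, Polynomial.map_X] at h1
  have h2 := coeff_one_eval₂ (pencil bas b₁ b₂) b₁ b₂
  rw [h1, coeff_zero, map_evalRingHom_zero_pencil] at h2
  rw [map_neg]
  linear_combination -h2

/-- The pencil is monic, so its leading coefficient does not involve Λ. -/
theorem degree_innerCoeff_pencil_lt [Nontrivial R] (b₁ b₂ : B) :
    (innerCoeff 1 (pencil bas b₁ b₂)).degree < Fintype.card ι := by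
  rw [degree_lt_iff_coeff_zero]
  intro n hn
  rw [coeff_innerCoeff]
  rcases hn.eq_or_lt with rfl | hn
  · have := (monic_pencil bas b₁ b₂).coeff_natDegree
    rw [natDegree_pencil] at this
    rw [this, coeff_one, if_neg one_ne_zero]
  · rw [coeff_eq_zero_of_natDegree_lt (p := pencil bas b₁ b₂) (by rwa [natDegree_pencil]),
      coeff_zero]

end Pencil

/-! ### The rank and the characteristic polynomial, read off at the fiber. -/

section Rank

open Polynomial Matrix

variable {k B ι : Type*} [Field k] [CommRing B] [Algebra k[X] B] {a : k} {m : k[X]} {b : B}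

theorem eval_repr_eq_zero_of_mem_span (bas : Module.Basis ι k[X] B) {x : B}
    (hx : x ∈ Ideal.span {algebraMap k[X] B (X - C a)}) (i : ι) : (bas.repr x i).eval a = 0 := by
  obtain ⟨y, rfl⟩ := Ideal.mem_span_singleton'.1 hx
  rw [mul_comm, ← Algebra.smul_def, map_smul, Finsupp.smul_apply, smul_eq_mul, eval_mul, eval_sub,
    eval_X, eval_C, sub_self, zero_mul]

/-- Reducing coordinates at `X = a` identifies the fiber ring with `ι → k`, and division by `m`
shows that polynomials in `b` of degree below `m.natDegree` already fill it. -/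
theorem card_le_natDegree [Fintype ι] (bas : Module.Basis ι k[X] B) (hm : m.Monic)
    (hb : aeval b (m.map C) ∈ Ideal.span {algebraMap k[X] B (X - C a)})
    (hgen : ∀ x, ∃ q : k[X][X], aeval b q - x ∈ Ideal.span {algebraMap k[X] B (X - C a)}) :
    Fintype.card ι ≤ m.natDegree := by
  let φ : k[X] →ₗ[k] (ι → k) :=
    { toFun := fun q i => (bas.repr (aeval b (q.map C)) i).eval a
      map_add' := fun q r => by
        funext i
        rw [Polynomial.map_add, map_add, map_add, Finsupp.add_apply, eval_add, Pi.add_apply]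
      map_smul' := fun c q => by
        funext i
        rw [smul_eq_C_mul, Polynomial.map_mul, map_C, map_mul, aeval_C, ← Algebra.smul_def,
          map_smul, Finsupp.smul_apply, smul_eq_mul, eval_mul, eval_C, RingHom.id_apply,
          Pi.smul_apply, smul_eq_mul] }
  have hφ : Function.Surjective (φ.comp (degreeLT k m.natDegree).subtype) := by
    intro w
    obtain ⟨q, hq⟩ := hgen (∑ i, (C (w i) : k[X]) • bas i)
    refine ⟨⟨q.map (evalRingHom a) %ₘ m, mem_degreeLT.2 ?_⟩, funext fun i => ?_⟩
    · rw [← degree_eq_natDegree hm.ne_zero]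
      exact degree_modByMonic_lt _ hm
    · change (bas.repr (aeval b ((q.map (evalRingHom a) %ₘ m).map C)) i).eval a = w i
      have h1 : aeval b ((q.map (evalRingHom a) %ₘ m).map C) - ∑ i, (C (w i) : k[X]) • bas i ∈
          Ideal.span {algebraMap k[X] B (X - C a)} := by
        obtain ⟨r, hr⟩ := dvd_sub_map_map_eval a q
        have h2 : aeval b q - aeval b ((q.map (evalRingHom a)).map C) ∈
            Ideal.span {algebraMap k[X] B (X - C a)} := by
          rw [← map_sub (aeval (R := k[X]) b), hr, map_mul, aeval_C]
          exact Ideal.mul_mem_right _ _ (Ideal.mem_span_singleton_self _)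
        have h3 := congrArg (fun p => aeval b (p.map C)) (modByMonic_add_div (q.map (evalRingHom a)) m)
        simp only [Polynomial.map_add, Polynomial.map_mul, map_add, map_mul] at h3
        convert sub_mem (sub_mem hq h2) (Ideal.mul_mem_right
          (aeval b ((q.map (evalRingHom a) /ₘ m).map C)) _ hb) using 1
        linear_combination h3
      have h2 := eval_repr_eq_zero_of_mem_span bas h1 i
      rw [map_sub bas.repr, Finsupp.sub_apply, eval_sub, sub_eq_zero, bas.repr_sum_self,
        eval_C] at h2
      exact h2
  have h1 := LinearMap.finrank_le_finrank_of_surjective hφ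
  rw [Module.finrank_pi, (degreeLTEquiv k m.natDegree).finrank_eq, Module.finrank_fin_fun] at h1
  exact h1

/-- By Cayley–Hamilton `m` divides the specialized characteristic polynomial, which is monic of
degree the rank; the rank is at most `m.natDegree`. -/
theorem map_charpoly_eq [Fintype ι] [DecidableEq ι] (bas : Module.Basis ι k[X] B) (hm : m.Monic)
    (hb : aeval b (m.map C) ∈ Ideal.span {algebraMap k[X] B (X - C a)})
    (hgen : ∀ x, ∃ q : k[X][X], aeval b q - x ∈ Ideal.span {algebraMap k[X] B (X - C a)})
    (hdvd : ∀ q : k[X][X], aeval b q ∈ Ideal.span {algebraMap k[X] B (X - C a)} →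
      m ∣ q.map (evalRingHom a)) :
    (Algebra.leftMulMatrix bas b).charpoly.map (evalRingHom a) = m ∧
      Fintype.card ι = m.natDegree := by
  have h1 : m ∣ (Algebra.leftMulMatrix bas b).charpoly.map (evalRingHom a) :=
    hdvd _ (by rw [aeval_charpoly_leftMulMatrix]; exact zero_mem _)
  have h2 : ((Algebra.leftMulMatrix bas b).charpoly.map (evalRingHom a)).Monic :=
    (charpoly_monic _).map _
  have h3 : ((Algebra.leftMulMatrix bas b).charpoly.map (evalRingHom a)).natDegree =
      Fintype.card ι := by
    rw [(charpoly_monic _).natDegree_map, charpoly_natDegree_eq_dim]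
  have h4 := card_le_natDegree bas hm hb hgen
  have h5 := natDegree_le_of_dvd h1 h2.ne_zero
  exact ⟨eq_of_monic_of_dvd_of_natDegree_le hm h2 h1 (by omega), by omega⟩

end Rank

/-! ### Total degree through coefficients. -/

section BivariateDegree

open Polynomial

variable {k : Type*} [Field k] {Q : k[X][X]}

theorem bivariateDegree_le_iff {d : ℕ} :
    bivariateDegree Q ≤ d ↔ ∀ i j, d < i + j → (Q.coeff i).coeff j = 0 := by
  rw [bivariateDegree, Finset.sup_le_iff]
  constructor
  · intro h i j hij
    by_cases hi : i ∈ Q.support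
    · exact coeff_eq_zero_of_natDegree_lt (by have := h i hi; omega)
    · rw [notMem_support_iff.1 hi, coeff_zero]
  · intro h i hi
    by_contra! hd
    exact mem_support_iff.1 hi (leadingCoeff_eq_zero.1 (h i _ (by omega)))

theorem exists_coeff_coeff_ne_zero (hQ : Q ≠ 0) :
    ∃ i j, i + j = bivariateDegree Q ∧ (Q.coeff i).coeff j ≠ 0 := by
  obtain ⟨i, hi, h⟩ := Finset.exists_mem_eq_sup Q.support (support_nonempty.2 hQ)
    (fun i => (Q.coeff i).natDegree + i)
  exact ⟨i, _, by rw [bivariateDegree, h, add_comm],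
    leadingCoeff_ne_zero.2 (mem_support_iff.1 hi)⟩

end BivariateDegree

/-! ### Points of the curve as homomorphisms from its coordinate ring. -/

section Points

open MvPolynomial

variable {k : Type*} [Field k] {n s : ℕ} {V : Set (Fin n → AlgebraicClosure k)}
  {p : Fin (n - s) → k}

/-- `ρ` is the restriction of polynomials to the lifting curve, with values in its coordinate
ring `B`, an algebra over `k[X_{n-s}]`. -/
structure IsCurveRestriction (h : s < n) (V : Set (Fin n → AlgebraicClosure k))
    (p : Fin (n - s) → k) {B : Type*} [CommRing B] [Algebra (Polynomial k) B]
    (ρ : MvPolynomial (Fin n) k →+* B) : Prop where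
  surjective : Function.Surjective ρ
  eq_zero_iff : ∀ f, ρ f = 0 ↔ ∀ x ∈ liftingCurve V p, aeval x f = 0
  aeval_paramIdx : ∀ c, ρ (Polynomial.aeval (X (paramIdx h)) c) = algebraMap (Polynomial k) B c

theorem exists_isCurveRestriction.{u} {k : Type u} [Field k] (h : s < n)
    {V : Set (Fin n → AlgebraicClosure k)}
    (hV : zeroLocus (AlgebraicClosure k) (vanishingIdeal k V) = V)
    (hfin : IsFiniteOnComponents (freeVars k n s) (vanishingIdeal k V)) (p : Fin (n - s) → k) :
    ∃ (B : Type u) (_ : CommRing B) (_ : Algebra (Polynomial k) B)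
      (ρ : MvPolynomial (Fin n) k →+* B), IsCurveRestriction h V p ρ ∧
        Module.Finite (Polynomial k) B ∧ Module.IsTorsionFree (Polynomial k) B := by
  refine ⟨CurveRing h (liftingCurve V p), _, _, toCurveRing h V p,
    ⟨toCurveRing_surjective h V p, fun _ => toCurveRing_eq_zero_iff h,
      toCurveRing_aeval_paramIdx h V p⟩, curveRing_finite h hfin p,
    Module.isTorsionFree_iff_smul_eq_zero.2 fun c b hcb => ?_⟩
  rw [Algebra.smul_def] at hcb
  exact or_iff_not_imp_left.2 fun hc => curveRing_algebraMap_mul_eq_zero h hV hfin hc b hcb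

variable {B : Type*} [CommRing B] [Algebra (Polynomial k) B] {ρ : MvPolynomial (Fin n) k →+* B}
  {h : s < n}

theorem IsCurveRestriction.X_paramIdx (hρ : IsCurveRestriction h V p ρ) :
    ρ (X (paramIdx h)) = algebraMap (Polynomial k) _ Polynomial.X := by
  rw [← hρ.aeval_paramIdx, Polynomial.aeval_X]

theorem IsCurveRestriction.map_C (hρ : IsCurveRestriction h V p ρ) (c : k) :
    ρ (C c) = algebraMap (Polynomial k) B (Polynomial.C c) := by
  rw [← hρ.aeval_paramIdx, Polynomial.aeval_C]
  rfl

theorem IsCurveRestriction.map_X_castLE (hρ : IsCurveRestriction h V p ρ) {i : Fin (n - s)}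
    (hi : i.val < n - s - 1) : ρ (X (Fin.castLE (Nat.sub_le n s) i)) = ρ (C (p i)) := by
  rw [← sub_eq_zero, ← map_sub, hρ.eq_zero_iff]
  intro y hy
  rw [map_sub, aeval_X, aeval_C, hy.2 i hi, sub_self]

theorem IsCurveRestriction.exists_mem_liftingCurve (hρ : IsCurveRestriction h V p ρ)
    (hV : zeroLocus (AlgebraicClosure k) (vanishingIdeal k V) = V) {t₀ : AlgebraicClosure k}
    {ψ : B →+* AlgebraicClosure k}
    (hψ : ∀ c, ψ (algebraMap (Polynomial k) _ c) = Polynomial.aeval t₀ c) :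
    ∃ x ∈ liftingCurve V p, ∀ f, aeval x f = ψ (ρ f) := by
  set x : Fin n → AlgebraicClosure k := fun l => ψ (ρ (X l)) with hx
  have key : ∀ f, aeval x f = ψ (ρ f) := by
    intro f
    have : (aeval x : _ →ₐ[k] AlgebraicClosure k).toRingHom = ψ.comp ρ := by
      refine MvPolynomial.ringHom_ext (fun c => ?_) fun l => ?_
      · rw [RingHom.comp_apply, hρ.map_C, hψ, Polynomial.aeval_C]
        exact aeval_C x c
      · exact aeval_X x l
    exact RingHom.congr_fun this f
  refine ⟨x, ⟨?_, fun i hi => ?_⟩, key⟩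
  · rw [← hV]
    intro f hf
    rw [key, (hρ.eq_zero_iff f).2 fun y hy => hf y hy.1, map_zero]
  · rw [← aeval_X (R := k) x, key, hρ.map_X_castLE hi, ← key, aeval_C]

theorem IsCurveRestriction.exists_ringHom (hρ : IsCurveRestriction h V p ρ)
    {x : Fin n → AlgebraicClosure k} (hx : x ∈ liftingCurve V p) :
    ∃ ψ : B →+* AlgebraicClosure k, (∀ f, ψ (ρ f) = aeval x f) ∧
      ∀ c, ψ (algebraMap (Polynomial k) _ c) = Polynomial.aeval (x (paramIdx h)) c := by
  have h0 : RingHom.ker ρ ≤ RingHom.ker (aeval x : _ →ₐ[k] AlgebraicClosure k).toRingHom :=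
    fun f hf => (hρ.eq_zero_iff f).1 hf x hx
  have h1 : ∀ f, RingHom.liftOfSurjective ρ hρ.surjective ⟨_, h0⟩ (ρ f) = aeval x f :=
    fun f => RingHom.liftOfRightInverse_comp_apply _ _ _ _ _
  refine ⟨_, h1, fun c => ?_⟩
  rw [← hρ.aeval_paramIdx, h1, ← Polynomial.aeval_algHom_apply, aeval_X]

end Points

/-! ### The degree bound at a fixed value of Λ. -/

section DegreeBound

open MvPolynomial

variable {k : Type*} [Field k] {n s : ℕ} {V : Set (Fin n → AlgebraicClosure k)}
  {p : Fin (n - s) → k}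

/-- The linear map whose fibers cut out the points of the lifting curve over the line
`t = u + β T`, where `T = X_{n-s+1} + ν X_{n-s+i}`. -/
theorem exists_linearMap (h : s < n) (ℓ : (Fin n → AlgebraicClosure k) →ₗ[AlgebraicClosure k]
      AlgebraicClosure k) (β : AlgebraicClosure k)
    (hℓ : ∀ x, (∀ j, x (depIdx h j) = 0) → ℓ x = 0) :
    ∃ A : (Fin n → AlgebraicClosure k) →ₗ[AlgebraicClosure k] (Fin (n - s) → AlgebraicClosure k),
      Function.Surjective A ∧ ∀ x l, A x l = if l.val < n - s - 1 then
        x (Fin.castLE (Nat.sub_le n s) l) else x (paramIdx h) - β * ℓ x := by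
  refine ⟨LinearMap.pi fun l => if l.val < n - s - 1 then
    LinearMap.proj (Fin.castLE (Nat.sub_le n s) l) else LinearMap.proj (paramIdx h) - β • ℓ,
    fun c => ⟨fun l => if hl : l.val < n - s then c ⟨l, hl⟩ else 0, funext fun l => ?_⟩,
    fun x l => ?_⟩
  · rw [LinearMap.pi_apply]
    split_ifs with hl
    · rw [LinearMap.proj_apply, Fin.val_castLE, dif_pos l.2]
    · have hl' : l = ⟨n - s - 1, by omega⟩ := Fin.ext (by simp only; omega)
      rw [LinearMap.sub_apply, LinearMap.smul_apply, hℓ, smul_zero, sub_zero, LinearMap.proj_apply,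
        hl']
      · exact dif_pos _
      · intro j
        rw [dif_neg]
        simp [depIdx]
  · rw [LinearMap.pi_apply]
    split_ifs <;> rfl

/-- Roots of the pencil over a parameter value are exactly the values there of `ℓ`, the linear form
`X_z + ν * X_i` on the curve. A generic line `t = u + β T` meets the plane curve in as many points
as its total degree, and its preimage is a section of `V` by a fiber of `A`. That section maps onto
these points and has at most `varietyDegree V` elements. -/
theorem IsCurveRestriction.bivariateDegree_map_pencil_le {B : Type*} [CommRing B]
    [Algebra (Polynomial k) B] {ρ : MvPolynomial (Fin n) k →+* B} {h : s < n}
    (hρ : IsCurveRestriction h V p ρ)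
    (hV : zeroLocus (AlgebraicClosure k) (vanishingIdeal k V) = V)
    (hfin : IsFiniteOnComponents (freeVars k n s) (vanishingIdeal k V)) {δ : ℕ}
    (hδ : varietyDegree (k := k) V = δ) {ι : Type*} [Fintype ι] [DecidableEq ι]
    (bas : Module.Basis ι (Polynomial k) B) (z i : Fin s)
    (ν a : AlgebraicClosure k)
    {θ : Polynomial (Polynomial k) →+* Polynomial (AlgebraicClosure k)}
    (hθ : θ = Polynomial.eval₂RingHom
      (Polynomial.mapRingHom (algebraMap k (AlgebraicClosure k))) (Polynomial.C ν))
    (hsep : (((pencil bas (ρ (X (depIdx h z))) (ρ (X (depIdx h i)))).map θ).map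
      (Polynomial.evalRingHom a)).Separable) :
    bivariateDegree ((pencil bas (ρ (X (depIdx h z))) (ρ (X (depIdx h i)))).map θ) ≤
      δ := by
  classical
  set χ := (pencil bas (ρ (X (depIdx h z))) (ρ (X (depIdx h i)))).map θ with hχ
  have hmonic : χ.Monic := (monic_pencil bas _ _).map θ
  obtain ⟨i₀, j₀, hij, hne⟩ := exists_coeff_coeff_ne_zero hmonic.ne_zero
  obtain ⟨β, u, T, hT, hmem⟩ := exists_line_card_eq hmonic a hsep
    (bivariateDegree_le_iff.1 le_rfl) hij hne
  -- the specialization of `χ` at `t = t₀`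
  have hθt : ∀ t₀ : AlgebraicClosure k, ((Polynomial.evalRingHom t₀).comp θ).comp Polynomial.C =
      (Polynomial.aeval t₀ : Polynomial k →ₐ[k] AlgebraicClosure k).toRingHom := by
    intro t₀
    refine RingHom.ext fun c => ?_
    rw [hθ]
    simp [Polynomial.aeval_def, Polynomial.eval_map]
  have hθX : ∀ t₀ : AlgebraicClosure k, ((Polynomial.evalRingHom t₀).comp θ) Polynomial.X = ν := by
    intro t₀
    rw [hθ]
    simp
  have hev : ∀ t₀ w, χ.evalEval t₀ w = ((pencil bas (ρ (X (depIdx h z)))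
      (ρ (X (depIdx h i)))).map ((Polynomial.evalRingHom t₀).comp θ)).eval w := by
    intro t₀ w
    rw [← Polynomial.map_map, ← hχ, Polynomial.map_evalRingHom_eval]
  set ℓ : (Fin n → AlgebraicClosure k) →ₗ[AlgebraicClosure k] AlgebraicClosure k :=
    LinearMap.proj (depIdx h z) + ν • LinearMap.proj (depIdx h i) with hℓ
  have hℓx : ∀ x, ℓ x = x (depIdx h z) + ν * x (depIdx h i) := fun x => rfl
  obtain ⟨A, hA, hAx⟩ := exists_linearMap h ℓ β fun x hx => by rw [hℓx, hx, hx, mul_zero, add_zero]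
  set c : Fin (n - s) → AlgebraicClosure k := fun l =>
    if l.val < n - s - 1 then algebraMap k _ (p l) else u with hc
  have hAc : ∀ x, A x = c ↔ (∀ l : Fin (n - s), l.val < n - s - 1 →
      x (Fin.castLE (Nat.sub_le n s) l) = algebraMap k _ (p l)) ∧
      x (paramIdx h) = u + β * ℓ x := by
    intro x
    rw [funext_iff]
    constructor
    · intro hx
      refine ⟨fun l hl => ?_, ?_⟩
      · have := hx l
        rw [hAx, if_pos hl, hc] at this
        simpa only [hl, if_true] using this
      · have := hx ⟨n - s - 1, by omega⟩
        rw [hAx, if_neg (lt_irrefl _), hc] at this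
        simp only [lt_irrefl, if_false] at this
        rw [← this]
        ring
    · rintro ⟨h1, h2⟩ l
      rw [hAx, hc]
      by_cases hl : l.val < n - s - 1
      · rw [if_pos hl]
        simp only [hl, if_true]
        exact h1 l hl
      · rw [if_neg hl]
        simp only [hl, if_false]
        rw [h2]
        ring
  have hroot : ∀ x ∈ V ∩ {x | A x = c}, ℓ x ∈ T ∧ ∀ l, ((Algebra.leftMulMatrix bas
      (ρ (X l))).charpoly.map (Polynomial.aeval (u + β * ℓ x) :
        Polynomial k →ₐ[k] AlgebraicClosure k).toRingHom).eval (x l) = 0 := by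
    rintro x ⟨hxV, hxA⟩
    obtain ⟨hx1, hx2⟩ := (hAc x).1 hxA
    obtain ⟨ψ, hψ, hψc⟩ := hρ.exists_ringHom
      (show x ∈ liftingCurve V p from ⟨hxV, hx1⟩)
    constructor
    · rw [hmem, hev]
      have h1 := eval_map_pencil bas ψ ((Polynomial.evalRingHom (u + β * ℓ x)).comp θ)
        (by rw [hθt, ← hx2]; exact RingHom.ext fun c => (hψc c).symm)
        (ρ (X (depIdx h z))) (ρ (X (depIdx h i)))
      rw [hθX, hψ, hψ, aeval_X, aeval_X] at h1
      exact h1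
    · intro l
      have h1 := congrArg ψ (aeval_charpoly_leftMulMatrix bas (ρ (X l)))
      rw [map_zero, Polynomial.aeval_def, Polynomial.hom_eval₂, hψ, aeval_X] at h1
      rw [Polynomial.eval_map, ← h1, ← hx2]
      congr 1
      exact RingHom.ext fun c => (hψc c).symm
  -- Once `ℓ x` is one of the finitely many elements of `T`, the parameter is fixed and every
  -- coordinate is a root of a monic polynomial.
  have hVA : (V ∩ {x | A x = c}).Finite := by
    refine (T.finite_toSet.biUnion fun τ _ => Set.Finite.pi' (t := fun l => {w |
      ((Algebra.leftMulMatrix bas (ρ (X l))).charpoly.map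
        (Polynomial.aeval (u + β * τ) : Polynomial k →ₐ[k] AlgebraicClosure k).toRingHom).eval w =
          0}) fun l => ?_).subset fun x hx => Set.mem_biUnion (hroot x hx).1 fun l => (hroot x hx).2 l
    exact Polynomial.finite_setOfPred_isRoot ((Matrix.charpoly_monic _).map _).ne_zero
  have hsub : (T : Set (AlgebraicClosure k)) ⊆ ℓ '' (V ∩ {x | A x = c}) := by
    intro τ hτ
    have h1 := (hmem τ).1 hτ
    rw [hev, map_pencil, hθX, hθt] at h1
    -- The closure becomes a `k[X]`-algebra by evaluation at `u + β * τ`, so the algebra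
    -- homomorphism obtained next is a point of the curve over that parameter.
    let _ : Algebra (Polynomial k) (AlgebraicClosure k) :=
      (Polynomial.aeval (u + β * τ) : Polynomial k →ₐ[k] AlgebraicClosure k).toRingHom.toAlgebra
    obtain ⟨ψ, hψ⟩ := exists_algHom_of_eval_charpoly_eq_zero bas h1
    obtain ⟨x, hx, hxψ⟩ := hρ.exists_mem_liftingCurve hV (t₀ := u + β * τ)
      (ψ := ψ.toRingHom) fun c => ψ.commutes c
    have h2 : ∀ l, x l = ψ (ρ (X l)) := fun l => by
      rw [← aeval_X (R := k) x l, hxψ]; rfl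
    have h3 : ℓ x = τ := by
      rw [hℓx, h2, h2, ← hψ, one_mul]
    refine ⟨x, ⟨hx.1, (hAc x).2 ⟨hx.2, ?_⟩⟩, h3⟩
    rw [h3, h2, hρ.X_paramIdx, ψ.commutes]
    exact Polynomial.aeval_X (R := k) (u + β * τ)
  have h1 := ((Set.encard_le_encard hsub).trans (Set.encard_image_le _ _)).trans
    (encard_inter_le_varietyDegree h hV hfin hA c hVA)
  rw [Set.encard_coe_eq_coe_finsetCard, hT, hδ] at h1
  exact_mod_cast h1

end DegreeBound

/-! ### From numerical values of Λ to its coefficients. -/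

section InnerCoeff

open Polynomial

theorem coeff_eval₂_C {k K : Type*} [Field k] [Field K] [Algebra k K] (ν : K) (j : ℕ)
    (q : k[X][X]) : (q.eval₂ (mapRingHom (algebraMap k K)) (C ν)).coeff j =
      ((innerCoeff j q).map (algebraMap k K)).eval ν := by
  induction q using Polynomial.induction_on' with
  | add p q hp hq =>
    rw [eval₂_add, coeff_add, hp, hq, innerCoeff_add, Polynomial.map_add, eval_add]
  | monomial n c =>
    rw [eval₂_monomial, innerCoeff_monomial, map_monomial, eval_monomial, ← C_pow, coeff_mul_C,
      coe_mapRingHom, coeff_map]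

end InnerCoeff

section TotalDegree

open Polynomial

variable {k : Type*} [Field k] {n s : ℕ} {V : Set (Fin n → AlgebraicClosure k)}
  {p : Fin (n - s) → k}

/-- The total degree of the pencil of characteristic polynomials in `t`, `T` is at most `deg V`. -/
theorem IsCurveRestriction.coeff_pencil_eq_zero {B : Type*} [CommRing B]
    [Algebra k[X] B] {ρ : MvPolynomial (Fin n) k →+* B} {h : s < n}
    (hρ : IsCurveRestriction h V p ρ)
    (hV : MvPolynomial.zeroLocus (AlgebraicClosure k) (MvPolynomial.vanishingIdeal k V) = V)
    (hfin : IsFiniteOnComponents (freeVars k n s) (MvPolynomial.vanishingIdeal k V)) {δ : ℕ}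
    (hδ : varietyDegree (k := k) V = δ) {ι : Type*} [Fintype ι] [DecidableEq ι]
    (bas : Module.Basis ι k[X] B) (z i : Fin s) (a : k)
    (hsep : ((Algebra.leftMulMatrix bas (ρ (MvPolynomial.X (depIdx h z)))).charpoly.map
      (evalRingHom a)).Separable) {e l j : ℕ} (hj : δ < e + j) :
    (((pencil bas (ρ (MvPolynomial.X (depIdx h z)))
      (ρ (MvPolynomial.X (depIdx h i)))).coeff e).coeff l).coeff j = 0 := by
  set b₁ := ρ (MvPolynomial.X (depIdx h z))
  set b₂ := ρ (MvPolynomial.X (depIdx h i))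
  set κ := algebraMap k (AlgebraicClosure k)
  -- The pencil over the fiber, in the variables Λ and `T`. It is separable at Λ = 0, so the
  -- resultant with its derivative is a nonzero polynomial `c` in Λ, and the bound applies at every
  -- `ν` with `c.eval ν ≠ 0`.
  set ξ := (pencil bas b₁ b₂).map (mapRingHom (κ.comp (evalRingHom a))) with hξ
  have hξ0 : ξ.map (evalRingHom 0) =
      ((Algebra.leftMulMatrix bas b₁).charpoly.map (evalRingHom a)).map κ := by
    rw [hξ, ← map_evalRingHom_zero_pencil bas b₁ b₂, Polynomial.map_map, Polynomial.map_map,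
      Polynomial.map_map]
    congr 1
    ext <;> simp
  obtain ⟨A, D, c, hc, hc0⟩ := exists_combination_eq_C (χ := ξ) (H := derivative ξ)
    ((monic_pencil bas b₁ b₂).map _) 0 (by
      rw [← derivative_map, hξ0]
      exact hsep.map)
  have hinf : Infinite (AlgebraicClosure k) := IsAlgClosed.instInfinite
  have hmain : ∀ ν, (c * (innerCoeff j ((pencil bas b₁ b₂).coeff e)).map κ).eval ν = 0 := by
    intro ν
    rw [eval_mul, mul_eq_zero, or_iff_not_imp_left]
    intro hν
    set θ := eval₂RingHom (mapRingHom κ) (C ν) with hθ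
    have hs : (((pencil bas b₁ b₂).map θ).map (evalRingHom (κ a))).Separable := by
      have h1 : ((pencil bas b₁ b₂).map θ).map (evalRingHom (κ a)) = ξ.map (evalRingHom ν) := by
        rw [hξ, Polynomial.map_map, Polynomial.map_map]
        congr 1
        ext <;> simp [hθ]
      have h2 := congrArg (Polynomial.map (evalRingHom ν)) hc
      rw [Polynomial.map_add, Polynomial.map_mul, Polynomial.map_mul, ← derivative_map, Polynomial.map_C,
        coe_evalRingHom] at h2
      rw [h1]
      refine ⟨C (c.eval ν)⁻¹ * A.map (evalRingHom ν), C (c.eval ν)⁻¹ * D.map (evalRingHom ν), ?_⟩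
      rw [mul_assoc, mul_assoc, ← mul_add, h2, ← C_mul, inv_mul_cancel₀ hν, C_1]
    have h1 := bivariateDegree_le_iff.1
      (hρ.bivariateDegree_map_pencil_le hV hfin hδ bas z i ν (κ a) hθ hs) e j hj
    rw [coeff_map, hθ, coe_eval₂RingHom, coeff_eval₂_C] at h1
    exact h1
  have h0 : c * (innerCoeff j ((pencil bas b₁ b₂).coeff e)).map κ = 0 :=
    Polynomial.funext fun ν => by rw [hmain, eval_zero]
  have h1 := (mul_eq_zero.1 h0).resolve_left fun hc' => hc0 (by rw [hc', eval_zero])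
  rw [Polynomial.map_eq_zero] at h1
  rw [← coeff_innerCoeff, h1, coeff_zero]

end TotalDegree

/-! ### The hypotheses on the fiber yield lifting data. -/

section LiftingData

open MvPolynomial

variable {k : Type*} [Field k] {n r s : ℕ} {V : Set (Fin n → AlgebraicClosure k)}
  {p : Fin (n - s) → k} {B : Type*} [CommRing B] [Algebra (Polynomial k) B]
  {ρ : MvPolynomial (Fin n) k →+* B} {h : s < n}

/-- A function on the curve vanishes on the fiber if and only if it is divisible by `t - a`. -/
theorem IsCurveRestriction.mem_span_iff (hρ : IsCurveRestriction h V p ρ)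
    (hred : fiberIdeal V p = vanishingIdeal k (fiber V p)) (f : MvPolynomial (Fin n) k) :
    ρ f ∈ Ideal.span {algebraMap (Polynomial k) B
      (Polynomial.X - Polynomial.C (lastCoord h p))} ↔ f ∈ fiberIdeal V p := by
  have hpar : Fin.castLE (Nat.sub_le n s) ⟨n - s - 1, by omega⟩ = paramIdx h := rfl
  have hX : ρ (X (paramIdx h) - C (lastCoord h p)) =
      algebraMap (Polynomial k) _ (Polynomial.X - Polynomial.C (lastCoord h p)) := by
    rw [map_sub, map_sub, hρ.X_paramIdx, hρ.map_C]
  constructor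
  · intro hf
    obtain ⟨b, hb⟩ := Ideal.mem_span_singleton'.1 hf
    obtain ⟨g, rfl⟩ := hρ.surjective b
    rw [← hX, ← map_mul, eq_comm, ← sub_eq_zero, ← map_sub, hρ.eq_zero_iff] at hb
    rw [hred]
    intro x hx
    have h1 := hb x (fiber_subset_liftingCurve V p hx)
    have h2 := hx.2 ⟨n - s - 1, by omega⟩
    rw [hpar] at h2
    rw [map_sub, map_mul, map_sub, aeval_X, h2, aeval_C, lastCoord, sub_self, mul_zero,
      sub_zero] at h1
    exact h1
  · intro hf
    obtain ⟨f₁, hf₁, f₂, hf₂, rfl⟩ := Submodule.mem_sup.1 hf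
    rw [map_add, (hρ.eq_zero_iff _).2 fun x hx => hf₁ x hx.1, zero_add]
    have h1 : Ideal.span (Set.range fun i => X (Fin.castLE (Nat.sub_le n s) i) - C (p i)) ≤
        (Ideal.span {algebraMap (Polynomial k) B
          (Polynomial.X - Polynomial.C (lastCoord h p))}).comap ρ := by
      rw [Ideal.span_le]
      rintro _ ⟨i, rfl⟩
      rw [SetLike.mem_coe, Ideal.mem_comap]
      by_cases hi : i.val < n - s - 1
      · rw [map_sub ρ, hρ.map_X_castLE hi, sub_self]
        exact zero_mem _
      · have : i = ⟨n - s - 1, by omega⟩ := Fin.ext (by simp only; omega)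
        rw [this]
        simp only [hpar]
        exact hX ▸ Ideal.mem_span_singleton_self _
    exact h1 hf₂

theorem IsCurveRestriction.aeval_specialize (hρ : IsCurveRestriction h V p ρ)
    (f : MvPolynomial (Fin n) k) :
    MvPolynomial.aeval (fun i => ρ (X (depIdx h i))) (specialize p f) = ρ f := by
  have : ((MvPolynomial.aeval fun i => ρ (X (depIdx h i))) :
      MvPolynomial (Fin s) (Polynomial k) →ₐ[Polynomial k] B).toRingHom.comp
        (specialize p).toRingHom = ρ := by
    refine MvPolynomial.ringHom_ext (fun c => ?_) fun l => ?_
    · have h1 : specialize (s := s) p (C c : MvPolynomial (Fin n) k) = C (Polynomial.C c) :=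
        (specialize p).commutes c
      simp only [RingHom.comp_apply, AlgHom.toRingHom_eq_coe, RingHom.coe_coe]
      rw [h1, aeval_C, hρ.map_C]
    · simp only [RingHom.comp_apply, AlgHom.toRingHom_eq_coe, RingHom.coe_coe]
      rcases eq_castLE_or_eq_depIdx h l with ⟨i, rfl⟩ | ⟨i, rfl⟩
      · by_cases hi : i.val < n - s - 1
        · rw [hρ.map_X_castLE hi, hρ.map_C, specialize, aeval_X, dif_pos (by exact i.2),
            if_pos (by exact hi), aeval_C]
          rfl
        · have : Fin.castLE (Nat.sub_le n s) i = paramIdx h :=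
            Fin.ext (by simp only [Fin.val_castLE, paramIdx]; omega)
          rw [this, specialize_X_paramIdx, aeval_C, hρ.X_paramIdx]
      · rw [specialize_X_depIdx, aeval_X]
  exact RingHom.congr_fun this f

theorem IsCurveRestriction.map_aeval_X (hρ : IsCurveRestriction h V p ρ) (l : Fin n)
    (q : Polynomial k) : ρ (Polynomial.aeval (X l) q) =
      Polynomial.aeval (ρ (X l)) (q.map Polynomial.C) := by
  induction q using Polynomial.induction_on' with
  | add p q hp hq => rw [map_add, map_add, hp, hq, Polynomial.map_add, map_add]
  | monomial j c =>
    rw [Polynomial.map_monomial, Polynomial.aeval_monomial, Polynomial.aeval_monomial, map_mul,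
      map_pow, ← hρ.map_C]
    rfl

variable {F : Fin r → MvPolynomial (Fin n) k} {G : MvPolynomial (Fin n) k}

/-- Since the fiber is reduced, `B` modulo `X - a` is the ring of functions on it, so congruences in
`B` can be checked at the points described by `m` and `v`. The polynomials `τ` express all
coordinates through the primitive element. -/
theorem IsCurveRestriction.isLiftingData [PerfectField k] {ι : Type*} [Fintype ι] [DecidableEq ι]
    (bas : Module.Basis ι (Polynomial k) B)
    (hs : 1 ≤ s) (hsr : s ≤ r) (hFG : IsReducedRegularSequence F G)
    (hρ : IsCurveRestriction h (affineClosure F G s) p ρ)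
    (hfin : IsFiniteOnComponents (freeVars k n s) (vanishingIdeal k (affineClosure F G s)))
    (hunram : ∀ x ∈ fiber (affineClosure F G s) p, IsUnramifiedAt k s (affineClosure F G s) x)
    (hG : ∀ x ∈ fiber (affineClosure F G s) p, aeval x G ≠ 0)
    {z : Fin s} {m : Polynomial k} {v : Fin s → Polynomial k} (hm : m.Monic)
    (hdeg : morphismDegree ((Ideal.Quotient.mk (vanishingIdeal k (affineClosure F G s))).comp
      (freeVars k n s)) = m.natDegree)
    (hfiber : fiber (affineClosure F G s) p = {x : Fin n → AlgebraicClosure k |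
      (∀ i : Fin (n - s), x (Fin.castLE (Nat.sub_le n s) i) =
        algebraMap k (AlgebraicClosure k) (p i)) ∧
      Polynomial.aeval (x (depIdx h z)) m = 0 ∧
      ∀ i : Fin s, i ≠ z → x (depIdx h i) = Polynomial.aeval (x (depIdx h z)) (v i)}) :
    IsLiftingData (lastCoord h p) (fun i => specialize p (F (Fin.castLE hsr i))) z m v
      (Algebra.leftMulMatrix bas (ρ (X (depIdx h z)))).charpoly (fun i => ρ (X (depIdx h i))) ∧
      Fintype.card ι = m.natDegree := by
  set V := affineClosure F G s with hV
  have hred := fiberIdeal_eq_vanishingIdeal hFG hs hsr h hunram hG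
  have hspan := hρ.mem_span_iff hred
  -- the coordinates as polynomials in the primitive element
  set τ : Fin n → Polynomial k := fun l => if hl : l.val < n - s then Polynomial.C (p ⟨l, hl⟩)
    else if (⟨l.val - (n - s), by omega⟩ : Fin s) = z then Polynomial.X
    else v ⟨l.val - (n - s), by omega⟩ with hτdef
  have hτfree : ∀ i, τ (Fin.castLE (Nat.sub_le n s) i) = Polynomial.C (p i) := fun i => by
    rw [hτdef]
    exact dif_pos i.2
  have hτdep : ∀ i, τ (depIdx h i) = if i = z then Polynomial.X else v i := fun i => by
    have h1 : (⟨(depIdx h i).val - (n - s), by have := (depIdx h i).2; omega⟩ : Fin s) = i :=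
      Fin.ext (by simp [depIdx])
    simp only [hτdef, h1]
    exact dif_neg (by simp [depIdx])
  have hτ : ∀ l, X l - Polynomial.aeval (X (depIdx h z)) (τ l) ∈ fiberIdeal V p := by
    intro l
    rw [hred]
    intro x hx
    rw [map_sub, aeval_X, ← Polynomial.aeval_algHom_apply, aeval_X, sub_eq_zero]
    rw [hfiber] at hx
    rcases eq_castLE_or_eq_depIdx h l with ⟨i, rfl⟩ | ⟨i, rfl⟩
    · rw [hτfree, Polynomial.aeval_C, hx.1]
    · rw [hτdep]
      split_ifs with hi
      · rw [hi, Polynomial.aeval_X]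
      · exact hx.2.2 i hi
  have hI : ∀ q : Polynomial k, Polynomial.aeval (X (depIdx h z)) q ∈ fiberIdeal V p ↔
      ∀ t : AlgebraicClosure k, Polynomial.aeval t m = 0 → Polynomial.aeval t q = 0 := by
    intro q
    rw [hred]
    have hx : ∀ x : Fin n → AlgebraicClosure k, aeval x (Polynomial.aeval (X (depIdx h z)) q) =
        Polynomial.aeval (x (depIdx h z)) q := fun x => by
      rw [← Polynomial.aeval_algHom_apply, aeval_X]
    constructor
    -- Every root of `m` occurs on the fiber, at the point with coordinates `τ l` evaluated at `t`.
    · intro hq t ht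
      have hz : Polynomial.aeval t (τ (depIdx h z)) = t := by
        rw [hτdep, if_pos rfl, Polynomial.aeval_X]
      have h1 := hq (fun l => Polynomial.aeval t (τ l)) (by
        rw [hfiber]
        refine ⟨fun i => ?_, ?_, fun i hi => ?_⟩
        · simp only [hτfree, Polynomial.aeval_C]
        · simp only [hz, ht]
        · simp only [hz]
          rw [hτdep, if_neg hi])
      rw [hx] at h1
      simpa only [hz] using h1
    · intro hq x hxf
      rw [hx]
      rw [hfiber] at hxf
      exact hq _ hxf.2.1
  obtain ⟨hcop, hdvd⟩ := separable_and_dvd hfin hτ hm hdeg hI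
  have hdvd' : ∀ q : Polynomial (Polynomial k), Polynomial.aeval (ρ (X (depIdx h z))) q ∈
      Ideal.span {algebraMap (Polynomial k) B (Polynomial.X - Polynomial.C (lastCoord h p))} →
      m ∣ q.map (Polynomial.evalRingHom (lastCoord h p)) := by
    intro q hq
    refine hdvd _ ((hspan _).1 ?_)
    obtain ⟨c, hc⟩ := dvd_sub_map_map_eval (lastCoord h p) q
    rw [hρ.map_aeval_X, ← sub_sub_cancel q ((q.map _).map _), hc,
      map_sub (Polynomial.aeval (R := Polynomial k) _), map_mul, Polynomial.aeval_C]
    exact sub_mem hq (Ideal.mul_mem_right _ _ (Ideal.mem_span_singleton_self _))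
  have hgen : ∀ b, ∃ q : Polynomial (Polynomial k),
      Polynomial.aeval (ρ (X (depIdx h z))) q - b ∈
      Ideal.span {algebraMap (Polynomial k) B (Polynomial.X - Polynomial.C (lastCoord h p))} := by
    intro b
    obtain ⟨f, rfl⟩ := hρ.surjective b
    refine ⟨(aeval τ f : Polynomial k).map Polynomial.C, ?_⟩
    rw [← hρ.map_aeval_X, ← map_sub ρ, hspan, ← neg_sub]
    exact neg_mem (exists_aeval_X_sub_mem hτ f)
  have hmz : Polynomial.aeval (ρ (X (depIdx h z))) (m.map Polynomial.C) ∈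
      Ideal.span {algebraMap (Polynomial k) B (Polynomial.X - Polynomial.C (lastCoord h p))} := by
    rw [← hρ.map_aeval_X, hspan, hI]
    exact fun _ ht => ht
  obtain ⟨hmap, hcard⟩ := map_charpoly_eq bas hm hmz hgen hdvd'
  refine ⟨⟨Matrix.charpoly_monic _, aeval_charpoly_leftMulMatrix bas _, hmap, hdvd', fun j => ?_, ?_,
    fun i hi => ?_, hgen, fun b hb => ?_, hcop⟩, hcard⟩
  · rw [hρ.aeval_specialize, hρ.eq_zero_iff]
    exact fun x hx => aeval_eq_zero_of_mem_affineClosure hx.1 j.2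
  · have hu : IsUnit (Ideal.Quotient.mk (fiberIdeal V p)
        (depJacobian h fun i => F (Fin.castLE hsr i)).det) := by
      refine isUnit_mk_of_aeval_ne_zero fun x hx => ?_
      rw [zeroLocus_fiberIdeal (zeroLocus_vanishingIdeal_affineClosure F G s) p] at hx
      exact det_depJacobian_ne_zero hFG hs hsr h hx.1 (hunram x hx) (hG x hx)
    obtain ⟨w, hw⟩ := hu.exists_left_inv
    obtain ⟨w, rfl⟩ := Ideal.Quotient.mk_surjective w
    rw [← map_mul, ← map_one (Ideal.Quotient.mk (fiberIdeal V p)), Ideal.Quotient.eq] at hw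
    refine ⟨ρ w, ?_⟩
    rw [jacobian_specialize h p fun i => F (Fin.castLE hsr i), hρ.aeval_specialize, ← map_mul,
      ← map_one ρ, ← map_sub ρ, hspan]
    exact hw
  · rw [← hρ.map_aeval_X, ← map_sub ρ, hspan, ← neg_sub]
    have := hτ (depIdx h i)
    rw [hτdep, if_neg hi] at this
    exact neg_mem this
  · have := Module.Free.of_basis bas
    rw [← Algebra.smul_def] at hb
    exact (smul_eq_zero.1 hb).resolve_left (Polynomial.X_sub_C_ne_zero _)

end LiftingData

/-! ### Kronecker representations over the fraction field. -/

section Kronecker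

open Polynomial

/-- By `mem_pow_iff`, `q` vanishes modulo `M` at every precision; having low degree, its
coefficients are divisible by all powers of `X - a`. For each coefficient, an exponent beyond its
degree forces it to be zero. -/
theorem IsLiftingData.eq_zero_of_degree_lt {k : Type*} [Field k] {s : ℕ} {B : Type*} [CommRing B]
    [Algebra k[X] B] {a : k} {F : Fin s → MvPolynomial (Fin s) k[X]} {z : Fin s} {m : k[X]}
    {v : Fin s → k[X]} {M : k[X][X]} {y : Fin s → B} (h : IsLiftingData a F z m v M y)
    {q : k[X][X]} (hq : q.degree < M.degree) (h0 : aeval (y z) q = 0) : q = 0 := by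
  ext1 i
  rw [coeff_zero]
  obtain ⟨u, w, e⟩ := (mem_precisionIdeal a).1
    ((h.mem_pow_iff ((q.coeff i).natDegree + 1) q).1 (by rw [h0]; exact zero_mem _))
  have h1 : q = (X - C a) ^ ((q.coeff i).natDegree + 1) • (w %ₘ M) := by
    conv_lhs => rw [← (modByMonic_eq_self_iff h.monic).2 hq, ← e]
    rw [add_modByMonic, mul_self_modByMonic h.monic, zero_add, mul_comm, ← smul_eq_C_mul,
      smul_modByMonic]
  refine eq_zero_of_dvd_of_natDegree_lt (p := (X - C a) ^ ((q.coeff i).natDegree + 1)) ?_ ?_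
  · have h2 := congrArg (fun f => f.coeff i) h1
    simp only [coeff_smul, smul_eq_mul] at h2
    exact ⟨_, h2⟩
  · rw [natDegree_pow, natDegree_X_sub_C, mul_one]
    exact Nat.lt_succ_self _

/-- Separability at one parameter value makes the resultant nonzero, hence invertible in the
fraction field. -/
theorem isCoprime_map_derivative {k : Type*} [Field k] {M : k[X][X]} (hM : M.Monic)
    {a : k} (h : IsCoprime (M.map (evalRingHom a)) (derivative (M.map (evalRingHom a)))) :
    IsCoprime (M.map (algebraMap k[X] (FractionRing k[X])))
      (derivative (M.map (algebraMap k[X] (FractionRing k[X])))) := by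
  rw [derivative_map] at h
  obtain ⟨A, D, c, hc, hc0⟩ := exists_combination_eq_C hM a h
  have hc' : algebraMap k[X] (FractionRing k[X]) c ≠ 0 := by
    rw [Ne, FaithfulSMul.algebraMap_eq_zero_iff]
    rintro rfl
    exact hc0 eval_zero
  have h2 := congrArg (Polynomial.map (algebraMap k[X] (FractionRing k[X]))) hc
  rw [Polynomial.map_add, Polynomial.map_mul, Polynomial.map_mul, ← derivative_map,
    Polynomial.map_C] at h2
  refine ⟨C (algebraMap k[X] (FractionRing k[X]) c)⁻¹ * A.map (algebraMap k[X] (FractionRing k[X])),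
    C (algebraMap k[X] (FractionRing k[X]) c)⁻¹ * D.map (algebraMap k[X] (FractionRing k[X])), ?_⟩
  rw [mul_assoc, mul_assoc, ← mul_add, h2, ← C_mul, inv_mul_cancel₀ hc', C_1]

variable {R : Type*} [CommRing R] {s : ℕ} {z : Fin s} {B : Type*} [CommRing B]
  [Algebra R B] {y : Fin s → B} {I : Ideal (MvPolynomial (Fin s) R)} {M : R[X]}

theorem map_aeval_X (q : R[X]) : MvPolynomial.map (algebraMap R (FractionRing R))
    (aeval (MvPolynomial.X z : MvPolynomial (Fin s) R) q) =
      aeval (MvPolynomial.X z) (q.map (algebraMap R (FractionRing R))) := by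
  induction q using Polynomial.induction_on' with
  | add p q hp hq => rw [map_add, map_add, hp, hq, Polynomial.map_add, map_add]
  | monomial j c =>
    rw [Polynomial.map_monomial, aeval_monomial, aeval_monomial, map_mul, map_pow,
      MvPolynomial.map_X, MvPolynomial.algebraMap_eq, MvPolynomial.map_C]
    rfl

theorem exists_C_mul_mem_of_map_mem [IsDomain R] {g : MvPolynomial (Fin s) R}
    (hg : MvPolynomial.map (algebraMap R (FractionRing R)) g ∈
      I.map (MvPolynomial.map (algebraMap R (FractionRing R)))) :
    ∃ d ∈ nonZeroDivisors R, MvPolynomial.C d * g ∈ I := by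
  let _ : Algebra (MvPolynomial (Fin s) R) (MvPolynomial (Fin s) (FractionRing R)) :=
    MvPolynomial.algebraMvPolynomial
  have := MvPolynomial.isLocalization (σ := Fin s) (nonZeroDivisors R) (FractionRing R)
  obtain ⟨c, ⟨d, hd, rfl⟩, hc⟩ := (IsLocalization.algebraMap_mem_map_algebraMap_iff
    ((nonZeroDivisors R).map (MvPolynomial.C : R →+* MvPolynomial (Fin s) R))
    (MvPolynomial (Fin s) (FractionRing R)) I _).1 hg
  exact ⟨d, hd, hc⟩

theorem eq_zero_of_aeval_X_mem_map [IsDomain R]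
    (hI : ∀ g, g ∈ I ↔ MvPolynomial.aeval y g = 0)
    (hinj : ∀ q : R[X], q.degree < M.degree → aeval (y z) q = 0 → q = 0) {q : (FractionRing R)[X]}
    (hq : q.degree < M.degree) (hqI : aeval (MvPolynomial.X z) q ∈
      I.map (MvPolynomial.map (algebraMap R (FractionRing R)))) : q = 0 := by
  obtain ⟨b, hb, hbq⟩ := IsLocalization.integerNormalization_spec (nonZeroDivisors R) q
  have hsupp := IsLocalization.integerNormalization_support (nonZeroDivisors R) q
  set q₀ := IsLocalization.integerNormalization (nonZeroDivisors R) q with hq₀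
  obtain ⟨d, hd, hdI⟩ := exists_C_mul_mem_of_map_mem (I := I) (g := aeval (MvPolynomial.X z) q₀) (by
    rw [map_aeval_X, hbq, algebra_compatible_smul (FractionRing R), map_smul,
      MvPolynomial.smul_eq_C_mul]
    exact Ideal.mul_mem_left _ _ hqI)
  rw [hI, ← MvPolynomial.smul_eq_C_mul, ← map_smul, ← aeval_algHom_apply,
    MvPolynomial.aeval_X] at hdI
  have h2 := hinj _ ((degree_smul_le _ _).trans_lt ((degree_mono hsupp).trans_lt hq)) hdI
  exact (IsLocalization.integerNormalization_eq_zero_iff le_rfl q).1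
    ((smul_eq_zero.1 h2).resolve_left (nonZeroDivisors.ne_zero hd))

/-- Let `J` be the ideal of the proposed generators. Inverting `M'` modulo `M` turns the generators
into formulas for the `Y_i`, so modulo `J` everything is a polynomial in `Y_z` of degree below that
of `M`. No nonzero such polynomial lies in `Ie`, and `J ≤ Ie`; this gives equality, the dimension
and the minimal polynomial together. -/
theorem isKroneckerRepresentation_of_aeval [IsDomain R]
    (hfin : IsFiniteOnComponents (MvPolynomial.C : R →+* MvPolynomial (Fin s) R) I)
    (hI : ∀ g, g ∈ I ↔ MvPolynomial.aeval y g = 0)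
    (hM : M.Monic) (hMz : aeval (y z) M = 0)
    (hinj : ∀ q : R[X], q.degree < M.degree → aeval (y z) q = 0 → q = 0)
    (hcop : IsCoprime (M.map (algebraMap R (FractionRing R)))
      (derivative (M.map (algebraMap R (FractionRing R)))))
    {W : Fin s → R[X]} (hWdeg : ∀ i, (W i).degree < M.degree)
    (hW : ∀ i, aeval (y z) (derivative M) * y i = aeval (y z) (W i)) :
    IsKroneckerRepresentation z I M fun i => (W i).map (algebraMap R (FractionRing R)) := by
  set Ie := I.map (MvPolynomial.map (algebraMap R (FractionRing R))) with hIe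
  set J := Ideal.span
      ({aeval (MvPolynomial.X z) (M.map (algebraMap R (FractionRing R)))} ∪
        {f : MvPolynomial (Fin s) (FractionRing R) | ∃ i, i ≠ z ∧ f =
          aeval (MvPolynomial.X z) (derivative (M.map (algebraMap R (FractionRing R)))) *
              MvPolynomial.X i -
            aeval (MvPolynomial.X z) ((W i).map (algebraMap R (FractionRing R)))}) with hJ
  have hMmonic := hM.map (algebraMap R (FractionRing R))
  have hMdeg : (M.map (algebraMap R (FractionRing R))).degree = M.degree := hM.degree_map _
  have hMJ : aeval (MvPolynomial.X z : MvPolynomial (Fin s) (FractionRing R))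
      (M.map (algebraMap R (FractionRing R))) ∈ J :=
    Ideal.subset_span (Or.inl rfl)
  have hJI : J ≤ Ie := by
    rw [hJ, Ideal.span_le]
    rintro _ (rfl | ⟨i, -, rfl⟩)
    · rw [← map_aeval_X]
      refine Ideal.mem_map_of_mem _ ((hI _).2 ?_)
      rw [← aeval_algHom_apply, MvPolynomial.aeval_X, hMz]
    · rw [derivative_map, ← map_aeval_X, ← map_aeval_X,
        ← MvPolynomial.map_X (algebraMap R (FractionRing R)) i, ← map_mul, ← map_sub]
      refine Ideal.mem_map_of_mem _ ((hI _).2 ?_)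
      rw [map_sub, map_mul, ← aeval_algHom_apply, ← aeval_algHom_apply, MvPolynomial.aeval_X,
        MvPolynomial.aeval_X, hW, sub_self]
  obtain ⟨U, D, hUD⟩ := hcop
  have hτ : ∀ i, MvPolynomial.X i - aeval (MvPolynomial.X z)
      (if i = z then X else D * (W i).map (algebraMap R (FractionRing R))) ∈ J := by
    intro i
    split_ifs with hi
    · rw [aeval_X, hi, sub_self]
      exact zero_mem _
    · have h1 := Ideal.mul_mem_left J (aeval (MvPolynomial.X z) D)
        (Ideal.subset_span (Or.inr ⟨i, hi, rfl⟩))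
      have h2 := Ideal.mul_mem_left J
        (aeval (MvPolynomial.X z) U * (MvPolynomial.X i : MvPolynomial (Fin s) (FractionRing R))) hMJ
      have h3 := congrArg (aeval (MvPolynomial.X z : MvPolynomial (Fin s) (FractionRing R))) hUD
      rw [map_add, map_mul, map_mul, map_one] at h3
      convert add_mem h1 h2 using 1
      rw [map_mul]
      linear_combination -(MvPolynomial.X i : MvPolynomial (Fin s) (FractionRing R)) * h3
  have hred : ∀ f, ∃ q : (FractionRing R)[X], q.degree < M.degree ∧
      f - aeval (MvPolynomial.X z) q ∈ J := by
    intro f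
    obtain ⟨g, hg⟩ : ∃ g : (FractionRing R)[X], f - aeval (MvPolynomial.X z) g ∈ J :=
      ⟨_, exists_aeval_X_sub_mem hτ f⟩
    refine ⟨g %ₘ M.map (algebraMap R (FractionRing R)), hMdeg ▸ degree_modByMonic_lt _ hMmonic, ?_⟩
    have h2 := congrArg (aeval (MvPolynomial.X z : MvPolynomial (Fin s) (FractionRing R)))
      (modByMonic_add_div g (M.map (algebraMap R (FractionRing R))))
    rw [map_add, map_mul] at h2
    convert add_mem hg (Ideal.mul_mem_right
      (aeval (MvPolynomial.X z) (g /ₘ M.map (algebraMap R (FractionRing R)))) _ hMJ) using 1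
    linear_combination -h2
  have hinj' : ∀ q : (FractionRing R)[X], q.degree < M.degree →
      aeval (MvPolynomial.X z) q ∈ Ie → q = 0 := fun q => eq_zero_of_aeval_X_mem_map hI hinj
  have haeval : ∀ q : (FractionRing R)[X], aeval (Ideal.Quotient.mk Ie (MvPolynomial.X z)) q =
      Ideal.Quotient.mk Ie (aeval (MvPolynomial.X z) q) := fun q =>
    aeval_algHom_apply (Ideal.Quotient.mkₐ (FractionRing R) Ie) (MvPolynomial.X z) q
  refine ⟨hfin, hM, minpoly.unique' _ _ hMmonic ?_ fun q hq => ?_, ?_, fun i _ => ?_,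
    le_antisymm (fun f hf => ?_) hJI⟩
  · rw [haeval, Ideal.Quotient.eq_zero_iff_mem]
    exact hJI hMJ
  · rw [or_iff_not_imp_right, not_not, haeval, Ideal.Quotient.eq_zero_iff_mem]
    exact hinj' q (hMdeg ▸ hq)
  · let φ : degreeLT (FractionRing R) M.natDegree →ₗ[FractionRing R]
        (MvPolynomial (Fin s) (FractionRing R) ⧸ Ie) :=
      ((Ideal.Quotient.mkₐ (FractionRing R) Ie).comp (aeval (MvPolynomial.X z))).toLinearMap.comp
        (degreeLT (FractionRing R) M.natDegree).subtype
    have hφ : Function.Bijective φ := by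
      constructor
      · rw [injective_iff_map_eq_zero]
        intro q hq
        refine Subtype.ext (hinj' q ?_ (Ideal.Quotient.eq_zero_iff_mem.1 hq))
        rw [degree_eq_natDegree hM.ne_zero]
        exact mem_degreeLT.1 q.2
      · intro b
        obtain ⟨f, rfl⟩ := Ideal.Quotient.mk_surjective b
        obtain ⟨q, hq, hqf⟩ := hred f
        rw [degree_eq_natDegree hM.ne_zero] at hq
        exact ⟨⟨q, mem_degreeLT.2 hq⟩, (Ideal.Quotient.eq.2 (hJI hqf)).symm⟩
    rw [← (LinearEquiv.ofBijective φ hφ).finrank_eq,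
      (degreeLTEquiv (FractionRing R) M.natDegree).finrank_eq, Module.finrank_fin_fun]
  · exact degree_map_le.trans_lt (hWdeg i)
  · obtain ⟨q, hq, hqf⟩ := hred f
    have h1 : aeval (MvPolynomial.X z) q ∈ Ie := by
      have := sub_mem hf (hJI hqf)
      rwa [sub_sub_cancel] at this
    rw [hinj' q hq h1, map_zero, sub_zero] at hqf
    exact hqf

end Kronecker

/-! ### Evaluation at points and assembly. -/

section Main

open Polynomial

theorem aevalAeval_eq {k K B : Type*} [Field k] [Field K] [Algebra k K] [CommRing B]
    [Algebra k[X] B] {ψ : B →+* K} {t : K} (hψ : ∀ c, ψ (algebraMap k[X] B c) = aeval t c) (b : B)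
    (Q : k[X][X]) : aevalAeval t (ψ b) Q = ψ (aeval b Q) := by
  induction Q using Polynomial.induction_on' with
  | add p q hp hq => rw [map_add, map_add, map_add, hp, hq]
  | monomial j c =>
    rw [aeval_monomial, map_mul, map_pow, hψ, ← C_mul_X_pow_eq_monomial, map_mul, map_pow,
      aevalAeval_C, aevalAeval_Y]

theorem bivariateDegree_eq_natDegree_of_monic {k : Type*} [Field k] {M : k[X][X]} (hM : M.Monic)
    (h : bivariateDegree M ≤ M.natDegree) : bivariateDegree M = M.natDegree := by
  refine le_antisymm h ?_
  have h1 : M.natDegree ∈ M.support := natDegree_mem_support_of_nonzero hM.ne_zero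
  exact (Nat.le_add_left _ _).trans
    (Finset.le_sup (f := fun i => (M.coeff i).natDegree + i) h1)

end Main

end NewtonLifting

theorem mainTheorem8 {k : Type*} [Field k] [PerfectField k] {n r s δ : ℕ}
    (hs : 1 ≤ s) (hsr : s < r) (hrn : r ≤ n)
    (F : Fin r → MvPolynomial (Fin n) k) (G : MvPolynomial (Fin n) k)
    (hFG : NewtonLifting.IsReducedRegularSequence F G)
    -- `π_s : V_s → 𝔸^{n-s}` is finite and `deg π_s = δ_s = deg V_s`
    (hfin : NewtonLifting.IsFiniteOnComponents (NewtonLifting.freeVars k n s)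
      (MvPolynomial.vanishingIdeal k (NewtonLifting.affineClosure F G s)))
    (hdegV : NewtonLifting.varietyDegree (k := k) (NewtonLifting.affineClosure F G s) = (δ : ℕ∞))
    (hdegπ : NewtonLifting.morphismDegree
      ((Ideal.Quotient.mk (MvPolynomial.vanishingIdeal k (NewtonLifting.affineClosure F G s))).comp
        (NewtonLifting.freeVars k n s)) = δ)
    -- the point `p^s` and the conditions on its fiber
    (p : Fin (n - s) → k)
    (hunram : ∀ x ∈ NewtonLifting.fiber (NewtonLifting.affineClosure F G s) p,
      NewtonLifting.IsUnramifiedAt k s (NewtonLifting.affineClosure F G s) x)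
    (hG : ∀ x ∈ NewtonLifting.fiber (NewtonLifting.affineClosure F G s) p,
      MvPolynomial.aeval x G ≠ 0)
    (hsep : Set.InjOn (fun x : Fin n → AlgebraicClosure k =>
        x (NewtonLifting.depIdx (hsr.trans_le hrn) ⟨0, hs⟩))
      (NewtonLifting.fiber (NewtonLifting.affineClosure F G s) p))
    -- the given Kronecker representation of the lifting fiber
    (m : Polynomial k) (v : Fin s → Polynomial k) (hm : m.Monic) (hmδ : m.natDegree = δ)
    (hv : ∀ i : Fin s, i ≠ ⟨0, hs⟩ → (v i).degree < m.degree)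
    (hfiber : NewtonLifting.fiber (NewtonLifting.affineClosure F G s) p =
      {x : Fin n → AlgebraicClosure k |
        (∀ i : Fin (n - s), x (Fin.castLE (Nat.sub_le n s) i) =
          algebraMap k (AlgebraicClosure k) (p i)) ∧
        Polynomial.aeval (x (NewtonLifting.depIdx (hsr.trans_le hrn) ⟨0, hs⟩)) m = 0 ∧
        ∀ i : Fin s, i ≠ ⟨0, hs⟩ → x (NewtonLifting.depIdx (hsr.trans_le hrn) i) =
          Polynomial.aeval (x (NewtonLifting.depIdx (hsr.trans_le hrn) ⟨0, hs⟩)) (v i)}) :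
    ∃ (M : Polynomial (Polynomial k)) (W : Fin s → Polynomial (Polynomial k)),
      -- the algorithm succeeds, with output `M`, `W`
      NewtonLifting.newtonLifting (NewtonLifting.lastCoord (hsr.trans_le hrn) p)
        (fun i : Fin s => NewtonLifting.specialize p (F (Fin.castLE hsr.le i)))
        ⟨0, hs⟩ m v = some (M, W) ∧
      -- the output is the Kronecker representation of `C_s` with primitive element `X_{n-s+1}`
      NewtonLifting.IsKroneckerRepresentation ⟨0, hs⟩
        (NewtonLifting.curveIdeal (hsr.trans_le hrn)
          (NewtonLifting.liftingCurve (NewtonLifting.affineClosure F G s) p))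
        M (fun i => (W i).map (algebraMap (Polynomial k) (FractionRing (Polynomial k)))) ∧
      -- degrees
      NewtonLifting.bivariateDegree M = δ ∧ M.natDegree = δ ∧
      (∀ i : Fin s, (W i).degree < δ ∧ NewtonLifting.bivariateDegree (W i) ≤ δ) ∧
      -- the defining congruences on `C_s`
      (∀ x ∈ NewtonLifting.liftingCurve (NewtonLifting.affineClosure F G s) p,
        Polynomial.aevalAeval (x (NewtonLifting.paramIdx (hsr.trans_le hrn)))
          (x (NewtonLifting.depIdx (hsr.trans_le hrn) ⟨0, hs⟩)) M = 0 ∧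
        ∀ i : Fin s,
          Polynomial.aevalAeval (x (NewtonLifting.paramIdx (hsr.trans_le hrn)))
              (x (NewtonLifting.depIdx (hsr.trans_le hrn) ⟨0, hs⟩)) (Polynomial.derivative M) *
            x (NewtonLifting.depIdx (hsr.trans_le hrn) i) =
          Polynomial.aevalAeval (x (NewtonLifting.paramIdx (hsr.trans_le hrn)))
            (x (NewtonLifting.depIdx (hsr.trans_le hrn) ⟨0, hs⟩)) (W i)) ∧
      -- the output lifts the input
      M.map (Polynomial.evalRingHom (NewtonLifting.lastCoord (hsr.trans_le hrn) p)) = m ∧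
      IsCoprime (Polynomial.derivative m) m ∧
      (∀ i : Fin s, i ≠ ⟨0, hs⟩ →
        m ∣ Polynomial.derivative m * v i -
          (W i).map (Polynomial.evalRingHom (NewtonLifting.lastCoord (hsr.trans_le hrn) p))) := by
  classical
  have h : s < n := hsr.trans_le hrn
  set V := NewtonLifting.affineClosure F G s with hVdef
  have hV := NewtonLifting.zeroLocus_vanishingIdeal_affineClosure F G s
  obtain ⟨B, _, _, ρ, hρ, _, _⟩ := NewtonLifting.exists_isCurveRestriction h hV hfin p
  -- A finite torsion-free module over a principal ideal domain is free.
  set bas := Module.Free.chooseBasis (Polynomial k) B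
  set a := NewtonLifting.lastCoord h p with ha
  set z : Fin s := ⟨0, hs⟩ with hz
  set y : Fin s → B := fun i => ρ (MvPolynomial.X (NewtonLifting.depIdx h i)) with hy
  obtain ⟨hL, hcard⟩ := hρ.isLiftingData bas hs hsr.le hFG hfin hunram hG hm
    (hdegπ.trans hmδ.symm) hfiber
  set M := (Algebra.leftMulMatrix bas (y z)).charpoly with hM
  -- `M` and `W` are fixed independently of the algorithm; `newtonLifting_eq` then identifies them
  -- with its output.
  set W : Fin s → Polynomial (Polynomial k) := fun i =>
    -NewtonLifting.innerCoeff 1 (NewtonLifting.pencil bas (y z) (y i)) with hWdef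
  have hMdeg : M.natDegree = δ := by
    rw [hM, Matrix.charpoly_natDegree_eq_dim, hcard, hmδ]
  have hMdeg' : M.degree = δ := by
    rw [Polynomial.degree_eq_natDegree hL.monic.ne_zero, hMdeg]
  have hWdeg : ∀ i, (W i).degree < M.degree := by
    intro i
    rw [hMdeg', hWdef, Polynomial.degree_neg, ← hmδ, ← hcard]
    exact NewtonLifting.degree_innerCoeff_pencil_lt bas _ _
  have hW : ∀ i, Polynomial.aeval (y z) (Polynomial.derivative M) * y i =
      Polynomial.aeval (y z) (W i) := fun i =>
    NewtonLifting.aeval_derivative_charpoly_mul bas _ _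
  have hsep' : (M.map (Polynomial.evalRingHom a)).Separable := by
    rw [hL.map_eval]
    exact hL.coprime
  have hpencil : ∀ i e l j, δ < e + j →
      (((NewtonLifting.pencil bas (y z) (y i)).coeff e).coeff l).coeff j = 0 := fun i e l j hj =>
    hρ.coeff_pencil_eq_zero hV hfin hdegV bas z i a hsep' hj
  have hMbi : NewtonLifting.bivariateDegree M ≤ δ := by
    rw [NewtonLifting.bivariateDegree_le_iff]
    intro e j hj
    -- `M` is the value of the pencil at Λ = 0, so it inherits the degree bound.
    rw [hM, ← NewtonLifting.map_evalRingHom_zero_pencil bas (y z) (y z), Polynomial.coeff_map,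
      Polynomial.coe_evalRingHom, ← Polynomial.coeff_zero_eq_eval_zero]
    exact hpencil z e 0 j hj
  have hWbi : ∀ i, NewtonLifting.bivariateDegree (W i) ≤ δ := by
    intro i
    rw [NewtonLifting.bivariateDegree_le_iff]
    intro e j hj
    rw [hWdef, Polynomial.coeff_neg, NewtonLifting.coeff_innerCoeff, Polynomial.coeff_neg,
      hpencil i e 1 j hj, neg_zero]
  have hcoeff : ∀ Q : Polynomial (Polynomial k), NewtonLifting.bivariateDegree Q ≤ δ →
      ∀ l, (Q.coeff l).natDegree ≤ m.natDegree := by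
    intro Q hQ l
    rw [hmδ, Polynomial.natDegree_le_iff_coeff_eq_zero]
    exact fun j hj => NewtonLifting.bivariateDegree_le_iff.1 hQ l j (by omega)
  refine ⟨M, W, hL.newtonLifting_eq (hcoeff M hMbi) W hWdeg (fun i => hcoeff (W i) (hWbi i)) hW,
    ?_, ?_, hMdeg, fun i => ⟨hMdeg' ▸ hWdeg i, hWbi i⟩, fun x hx => ?_, hL.map_eval,
    hL.coprime.symm, fun i hi => ?_⟩
  · refine NewtonLifting.isKroneckerRepresentation_of_aeval (y := y)
      (NewtonLifting.isFiniteOnComponents_curveIdeal h hV hfin p) (fun g => ?_) hL.monic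
      hL.aeval_eq_zero (fun q hq hq0 => hL.eq_zero_of_degree_lt hq hq0)
      (NewtonLifting.isCoprime_map_derivative hL.monic hsep') hWdeg hW
    obtain ⟨f, rfl⟩ := NewtonLifting.specialize_surjective h p g
    rw [hρ.aeval_specialize, NewtonLifting.specialize_mem_curveIdeal_iff, hρ.eq_zero_iff]
  · rw [← hMdeg]
    exact NewtonLifting.bivariateDegree_eq_natDegree_of_monic hL.monic (hMdeg ▸ hMbi)
  · obtain ⟨ψ, hψ, hψc⟩ := hρ.exists_ringHom hx
    have hψy : ∀ i, ψ (y i) = x (NewtonLifting.depIdx h i) := fun i => by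
      rw [hy, hψ, MvPolynomial.aeval_X]
    rw [← hψy]
    refine ⟨?_, fun i => ?_⟩
    · rw [NewtonLifting.aevalAeval_eq hψc, hL.aeval_eq_zero, map_zero]
    · rw [← hψy, NewtonLifting.aevalAeval_eq hψc, NewtonLifting.aevalAeval_eq hψc, ← map_mul, hW]
  · have h1 := hL.dvd_of_mem (Polynomial.derivative M * (v i).map Polynomial.C - W i) (by
      rw [map_sub (Polynomial.aeval (R := Polynomial k) _), map_mul, ← hW, ← mul_sub]
      exact Ideal.mul_mem_left _ _ (hL.coord i hi))
    have h2 : (Polynomial.evalRingHom a).comp Polynomial.C = RingHom.id k := by ext x; simp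
    rw [Polynomial.map_sub, Polynomial.map_mul, ← Polynomial.derivative_map, hL.map_eval,
      Polynomial.map_map, h2, Polynomial.map_id] at h1
    exact h1
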